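/- Let $q$ be a power of an odd prime and let $n\ge 1$ be such that $|n|_2=|q-1|_2$, where $|k|_2$ denotes the largest power of $2$ dividing $k$ (so $n$ is even). An element $g$ of a group $G$ is called real in $G$ if $hgh^{-1}=g^{-1}$ for some $h\in G$; a conjugacy class of real elements is called a real class. Regard $PSL_n(q)$ as the image of $SL_n(q)$ in $PGL_n(q)$. For a partition $\nu=(\nu_1,\dots,\nu_r)=1^{n_1}2^{n_2}\cdots$ of $n$ put $h_\nu=\gcd(q-1,\nu_1,\dots,\nu_r)$ and $d=|\gcd(n_1,n_2,\dots)|_2$. An element $g\in GL_n(q)$ is of type $\nu$ if the $\mathbb F_q[t]$-module on $\mathbb F_q^n$ defined by $g$ is isomorphic to $\bigoplus_j \mathbb F_q[t]/(p_j^{e_j})$ with $p_j$ monic irreducible, $e_j\ge 1$, and $n_i=\sum_{e_j=i}\deg p_j$ for all $i$; a class of $PGL_n(q)$ is of type $\nu$ if its elements lift to elements of type $\nu$. Let $psl_\nu$ be the number of conjugacy classes of $PGL_n(q)$ of type $\nu$ which are contained in $PSL_n(q)$ and consist of elements that are real in $PSL_n(q)$. Let $n_{q,m}$ be the number of polynomials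 $f\in\mathbb F_q[t]$ of degree $m$ with $f(0)=1$ whose multiset of roots in $\overline{\mathbb F_q}$ is invariant under $\alpha\mapsto\alpha^{-1}$, and put $$sl_\nu=\begin{cases}\prod_{n_i>0}n_{q,n_i} & \text{if } n_i=0 \text{ for all odd } i,\\ \frac12\prod_{n_i>0}n_{q,n_i} & \text{if } i\,n_i \text{ is odd for some } i,\\ \frac{(q+1)^r+(q-1)^r}{2}\prod_{i\text{ odd},\,n_i>0}q^{\frac{n_i}{2}-1}\prod_{i\text{ even},\,n_i>0}n_{q,n_i} & \text{otherwise,}\end{cases}$$ where, in the last line, $r$ is the number of odd $i$ with $n_i>0$. Then the number of real classes of $PSL_n(q)$ is $\sum_{\nu} h_\nu\, psl_\nu$, the sum being over all partitions $\nu$ of $n$. If $4\mid n$, then $$psl_\nu=\begin{cases}\frac12\prod_{n_i>0}n_{q,n_i} & \text{if } d>1 \text{ and } n_i>0 \text{ for some odd } i,\\ \frac12 sl_\nu & \text{otherwise.}\end{cases}$$ If $4\nmid n$, then $$psl_\nu=\begin{cases}\frac12\prod_{n_i>0}n_{q,n_i} & \text{if } d>1 \text{ and } n_i>0 \text{ for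 some odd } i,\\ \frac12 sl_\nu & \text{if } d=1 \text{ and } n_i>0 \text{ for some odd } i,\\ 0 & \text{otherwise.}\end{cases}$$ Moreover, if $4\mid n$ or $n_i>0$ for some odd $i$, then $psl_\nu$ is also the number of conjugacy classes of $PGL_n(q)$ of type $\nu$ which are contained in $PSL_n(q)$ and consist of elements that are real in $PGL_n(q)$. -/

import Mathlib

open scoped MatrixGroups DirectSum Polynomial

namespace RealClasses

noncomputable section

/-! ### Real elements and real classes -/

/-- An element `g` of a group is real if it is conjugate to its inverse. -/
def IsReal {G : Type*} [Group G] (g : G) : Prop := ∃ h : G, h * g * h⁻¹ = g⁻¹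

/-- The number of real conjugacy classes of a (finite) group. -/
def numRealClasses (G : Type*) [Group G] : ℕ :=
  Nat.card {C : ConjClasses G // ∀ g ∈ C.carrier, IsReal g}

/-! ### Arithmetic of partitions -/

/-- `|k|₂`, the largest power of `2` which divides `k` (for `k ≠ 0`). -/
def twoPart (k : ℕ) : ℕ := 2 ^ padicValNat 2 k

/-- `n_i`, the number of parts equal to `i` in the partition `ν = 1^{n_1} 2^{n_2} ⋯`. -/
def mult {n : ℕ} (ν : n.Partition) (i : ℕ) : ℕ := ν.parts.count i

/-- `h_ν = (q - 1, ν_1, …, ν_r)`, the greatest common divisor of `q - 1` and the parts of `ν`. -/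
def hNu (q : ℕ) {n : ℕ} (ν : n.Partition) : ℕ := Nat.gcd (q - 1) ν.parts.gcd

/-- `d = |(n_1, n_2, …)|₂`, the `2`-part of the greatest common divisor of the multiplicities. -/
def dNu {n : ℕ} (ν : n.Partition) : ℕ := twoPart ((Finset.Icc 1 n).gcd (mult ν))

/-- There is an odd `i` with `n_i > 0`. -/
def HasOddPart {n : ℕ} (ν : n.Partition) : Prop := ∃ i, Odd i ∧ 0 < mult ν i

/-! ### Self-reciprocal polynomials -/

/-- A polynomial is self-reciprocal if its list of roots in an algebraic closure, taken with
multiplicity, coincides with the list of the inverses of these roots. -/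
def SelfReciprocal {F : Type*} [Field F] (f : F[X]) : Prop :=
  (f.aroots (AlgebraicClosure F)).map (fun a => a⁻¹) = f.aroots (AlgebraicClosure F)

/-- `n_{q,d}`: the number of self-reciprocal polynomials `f` over the field with `q` elements that
have degree `d` and satisfy `f(0) = 1`. -/
def nSelfRec (F : Type*) [Field F] (d : ℕ) : ℕ :=
  Nat.card {f : F[X] // f.natDegree = d ∧ f.eval 0 = 1 ∧ SelfReciprocal f}

/-- `∏_{n_i > 0} n_{q,n_i}`. -/
def glNu (F : Type*) [Field F] {n : ℕ} (ν : n.Partition) : ℕ :=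
  ∏ i ∈ ν.parts.toFinset, nSelfRec F (mult ν i)

open Classical in
/-- The number `sl_ν`, for `q` odd. In the last case all `n_i` with `i` odd are even, so that the
exponents `n_i / 2 - 1` are genuine non-negative integers. -/
def slNu (F : Type*) [Field F] {n : ℕ} (ν : n.Partition) : ℚ :=
  if ∀ i, Odd i → mult ν i = 0 then (glNu F ν : ℚ)
  else if ∃ i, Odd (i * mult ν i) then (1 / 2 : ℚ) * glNu F ν
  else
    ((Nat.card F + 1 : ℚ) ^ (ν.parts.toFinset.filter (fun i => Odd i)).card
        + (Nat.card F - 1 : ℚ) ^ (ν.parts.toFinset.filter (fun i => Odd i)).card) / 2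
      * (∏ i ∈ ν.parts.toFinset.filter (fun i => Odd i), (Nat.card F : ℚ) ^ (mult ν i / 2 - 1))
      * (∏ i ∈ ν.parts.toFinset.filter (fun i => Even i), (nSelfRec F (mult ν i) : ℚ))

/-! ### The type of an element, and the classes of `PGL_n(q)` contained in `PSL_n(q)` -/

/-- The matrix `g` is of type `ν`: as an `F[t]`-module on which `t` acts as `g`, the space `F ^ n`
is a direct sum of cyclic modules `F[t] / (p_j ^ e_j)` with `p_j` monic irreducible, and `ν` has
`deg p_j` parts equal to `e_j` for every `j`. Thus `n_i` is the degree of the product of those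
`p_j` for which `e_j = i`. -/
def HasType {F : Type*} [Field F] {n : ℕ} (g : GL (Fin n) F) (ν : n.Partition) : Prop :=
  ∃ (k : ℕ) (p : Fin k → F[X]) (e : Fin k → ℕ),
    (∀ j, (p j).Monic ∧ Irreducible (p j) ∧ 0 < e j) ∧
    Nonempty (Module.AEval' (Matrix.toLin' (g : Matrix (Fin n) (Fin n) F)) ≃ₗ[F[X]]
      ⨁ j : Fin k, F[X] ⧸ Ideal.span {p j ^ e j}) ∧
    ν.parts = ∑ j, Multiset.replicate (p j).natDegree (e j)

/-- A conjugacy class of `PGL_n(F)` is of type `ν` if one of its elements lifts to a matrix of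
type `ν` (all lifts of all its elements are then of type `ν`). -/
def ClassHasType {F : Type*} [Field F] {n : ℕ} (C : ConjClasses (Matrix.ProjGenLinGroup (Fin n) F))
    (ν : n.Partition) : Prop :=
  ∃ g : GL (Fin n) F, Matrix.ProjGenLinGroup.mk g ∈ C.carrier ∧ HasType g ν

/-- A conjugacy class of `PGL_n(F)` is contained in `PSL_n(F)`, regarded as a subgroup
of `PGL_n(F)`. -/
def InPSL {F : Type*} [Field F] {n : ℕ}
    (C : ConjClasses (Matrix.ProjGenLinGroup (Fin n) F)) : Prop :=
  ∀ x ∈ C.carrier, x ∈ (Matrix.ProjectiveSpecialLinearGroup.toPGL (n := Fin n) (R := F)).range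

/-- `psl_ν`: the number of conjugacy classes of `PGL_n(F)` of type `ν` that are contained in
`PSL_n(F)` and consist of elements which are real in `PSL_n(F)`. -/
def pslNu (F : Type*) [Field F] {n : ℕ} (ν : n.Partition) : ℕ :=
  Nat.card {C : ConjClasses (Matrix.ProjGenLinGroup (Fin n) F) //
    ClassHasType C ν ∧ InPSL C ∧
    ∀ y : Matrix.ProjectiveSpecialLinearGroup (Fin n) F,
      Matrix.ProjectiveSpecialLinearGroup.toPGL y ∈ C.carrier → IsReal y}

/-- The number of conjugacy classes of `PGL_n(F)` of type `ν` that are contained in `PSL_n(F)` and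
consist of elements which are real in `PGL_n(F)`. -/
def pslNuPGL (F : Type*) [Field F] {n : ℕ} (ν : n.Partition) : ℕ :=
  Nat.card {C : ConjClasses (Matrix.ProjGenLinGroup (Fin n) F) //
    ClassHasType C ν ∧ InPSL C ∧ ∀ x ∈ C.carrier, IsReal x}

end

end RealClasses

namespace RealClasses

open Polynomial Module

/-! ### Determinants of maps that commute up to sign with a nilpotent map -/

section LinearAlgebra

variable {F : Type*} [Field F]

/-! Write q for the order of `F`. A conjugacy class of GL_n(q) is recorded by the sequence f, where
f_i is the product of the primes p_j whose elementary divisor is p_j^i; the type ν is given by the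
degrees deg f_i = n_i. Multiplying a matrix by the scalar l multiplies all roots by l
(`MatInv.scalar_mul`), and passing to l g⁻¹ replaces each root α by l/α (`MatInv.scalar_mul_inv`).
So classes of PGL are orbits of such sequences under scaling, and reality in PGL means that f is
invariant under α ↦ l/α for some l.

The passage between PGL and PSL rests on determinants. If b conjugates g to l g or to l g⁻¹, then b
commutes, up to a sign ε = 1 or -1, with N = g^m - g^(-m), where m is a suitable multiple of q - 1.
This N is nilpotent and its Jordan type is ν. Filtering the space by the images of N^j shows that
det b is an h_ν-th power, times (-1)^(∑ n_i i(i-1)/2) when b inverts (`MatInv.exists_det_eq_pow`).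
Conversely, norms from finite extensions make every h_ν-th power the determinant of an element of
the centralizer (`MatInv.exists_commute_det`). Hence a PGL class inside PSL splits into h_ν classes
of PSL (`card_classes_over`), which gives the sum formula. Reality in PGL implies reality in PSL
when the sign above is an h_ν-th power. This holds if some part is odd, because then h_ν is odd. If
all parts are even, the exponent of the sign is congruent to n/2 modulo 2, so it is harmless when 4
divides n. When 4 does not divide n, reality in PSL would make -1 a square although q is 3 modulo 4
(`pslNu_eq_zero`).

It remains to count the PGL classes. The symmetries l of a given f form a coset of its stabilizer,
and scaling by a turns the symmetry l into l a². A Burnside count (`two_mul_card_orbits`) therefore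
gives twice the number of orbits as N_1 + N_z, where N_l counts the sequences with symmetry l and z
is any nonsquare. Such a sequence has determinant equal to l^(n/2) times a product of signs. The
hypothesis |n|_2 = |q-1|_2 provides z with z^(n/2) = -1 and prevents -1 from being an n-th power. So
the condition of lying in PSL says that the product of signs is 1 for l = 1 and -1 for l = z. Adding
1 and the signed indicator gives 2 N_l = G + S for l = 1 and G - S for l = z, where G is the number
of all sequences and S their signed count. If all n_i are even, S cancels and the answer is G/2. If
some n_i is odd, N_z = 0 and the answer is (G + S)/4, which is half of sl_ν (`slNu_eq`). -/

theorem det_eq_mul_of_exact {A B C : Type*} [AddCommGroup A] [Module F A] [AddCommGroup B]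
    [Module F B] [AddCommGroup C] [Module F C] [FiniteDimensional F B]
    (i : A →ₗ[F] B) (s : B →ₗ[F] C) (hi : Function.Injective i) (hs : Function.Surjective s)
    (his : LinearMap.ker s = LinearMap.range i) (a : End F A) (b : End F B) (c : End F C)
    (hab : ∀ x, b (i x) = i (a x)) (hbc : ∀ x, s (b x) = c (s x)) :
    LinearMap.det b = LinearMap.det a * LinearMap.det c := by
  have hW : LinearMap.range i ≤ (LinearMap.range i).comap b := by
    rintro _ ⟨x, rfl⟩
    exact ⟨a x, (hab x).symm⟩
  rw [LinearMap.det_eq_det_mul_det (LinearMap.range i) b hW]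
  congr 1
  · rw [← LinearMap.det_conj a (LinearEquiv.ofInjective i hi)]
    congr 1
    ext ⟨_, x, rfl⟩
    have : (LinearEquiv.ofInjective i hi).symm ⟨i x, x, rfl⟩ = x := by
      rw [LinearEquiv.symm_apply_eq]; rfl
    simp [this, hab]
  · let e : (B ⧸ LinearMap.range i) ≃ₗ[F] C :=
      (Submodule.quotEquivOfEq _ _ his.symm).trans (s.quotKerEquivOfSurjective hs)
    have he : ∀ x, e (Submodule.Quotient.mk x) = s x := fun x => rfl
    rw [← LinearMap.det_conj _ e]
    congr 1
    ext y
    obtain ⟨x, rfl⟩ := hs y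
    have : e.symm (s x) = Submodule.Quotient.mk x := by
      rw [LinearEquiv.symm_apply_eq]; rfl
    simp [this, he, hbc]

open Classical in
/-- The determinant of the restriction of `h` to a subspace `W` which it maps into itself. -/
noncomputable def detOn {V : Type*} [AddCommGroup V] [Module F V] (h : End F V)
    (W : Submodule F V) : F :=
  if hW : ∀ x ∈ W, h x ∈ W then LinearMap.det (h.restrict hW) else 1

variable {V : Type*} [AddCommGroup V] [Module F V]

theorem detOn_top (h : End F V) : detOn h ⊤ = LinearMap.det h := by
  rw [detOn, dif_pos (by simp), ← LinearMap.det_conj h (Submodule.topEquiv (R := F)).symm]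
  rfl

theorem detOn_bot (h : End F V) : detOn h ⊥ = 1 := by
  rw [detOn, dif_pos (by simp)]
  have : FiniteDimensional F (⊥ : Submodule F V) := inferInstance
  exact LinearMap.det_eq_one_of_subsingleton _

theorem map_range_pow_of_comm {h N : End F V} {ε : F}
    (hN : ∀ x, h (N x) = ε • N (h x)) (j : ℕ) :
    ∀ x ∈ LinearMap.range (N ^ j), h x ∈ LinearMap.range (N ^ j) := by
  have key : ∀ j : ℕ, ∀ x, h ((N ^ j) x) = ε ^ j • (N ^ j) (h x) := by
    intro j
    induction j with
    | zero => simp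
    | succ j ih =>
      intro x
      rw [pow_succ', Module.End.mul_apply, hN, ih, map_smul, smul_smul, ← pow_succ',
        Module.End.mul_apply]
  rintro _ ⟨x, rfl⟩
  exact ⟨ε ^ j • h x, by rw [key, map_smul]⟩

variable [FiniteDimensional F V]

/-- `N` maps the image of `N ^ j` onto the image of `N ^ (j + 1)` with kernel `ker N ⊓ range (N ^
j)`, and it intertwines `h` with `ε • h`. The power of `ε` is the determinant of that scalar. -/
theorem detOn_range_pow {h N : End F V} {ε : F} (hN : ∀ x, h (N x) = ε • N (h x)) (hε : ε * ε = 1)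
    (j : ℕ) : detOn h (LinearMap.range (N ^ j)) =
      detOn h (LinearMap.ker N ⊓ LinearMap.range (N ^ j)) *
        (ε ^ finrank F (LinearMap.range (N ^ (j + 1))) *
          detOn h (LinearMap.range (N ^ (j + 1)))) := by
  have hV := map_range_pow_of_comm hN j
  have hV' := map_range_pow_of_comm hN (j + 1)
  have hW : ∀ x ∈ LinearMap.ker N ⊓ LinearMap.range (N ^ j),
      h x ∈ LinearMap.ker N ⊓ LinearMap.range (N ^ j) := by
    intro x hx
    refine ⟨?_, hV x hx.2⟩
    have h1 := hN x
    rw [LinearMap.mem_ker.mp hx.1, map_zero] at h1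
    have h2 : ε • ε • N (h x) = 0 := by rw [← h1, smul_zero]
    rwa [smul_smul, hε, one_smul] at h2
  rw [detOn, dif_pos hV, detOn, dif_pos hW, detOn, dif_pos hV', ← LinearMap.det_smul]
  have hNV : ∀ x ∈ LinearMap.range (N ^ j), N x ∈ LinearMap.range (N ^ (j + 1)) := by
    rintro _ ⟨x, rfl⟩
    exact ⟨x, by rw [pow_succ']; rfl⟩
  refine det_eq_mul_of_exact (Submodule.inclusion inf_le_right) (N.restrict hNV)
    (Submodule.inclusion_injective _) ?_ ?_ _ _ _ (fun x => rfl) ?_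
  · rintro ⟨_, x, rfl⟩
    refine ⟨⟨(N ^ j) x, x, rfl⟩, Subtype.ext ?_⟩
    simp [pow_succ']
  · ext ⟨x, hx⟩
    simp only [LinearMap.mem_ker, Submodule.range_inclusion, Submodule.mem_comap,
      Submodule.subtype_apply, Submodule.mem_inf, hx, and_true]
    rw [← Subtype.coe_inj]; rfl
  · rintro ⟨x, hx⟩
    apply Subtype.ext
    have h1 := hN x
    simp only [LinearMap.coe_restrict_apply, LinearMap.smul_apply, Submodule.coe_smul]
    rw [h1, smul_smul, hε, one_smul]

theorem det_eq_prod_detOn {h N : End F V} {ε : F} (hN : ∀ x, h (N x) = ε • N (h x))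
    (hε : ε * ε = 1) {m : ℕ} (hm : N ^ m = 0) :
    LinearMap.det h =
      ε ^ (∑ j ∈ Finset.range m, finrank F (LinearMap.range (N ^ (j + 1)))) *
      ∏ j ∈ Finset.range m, detOn h (LinearMap.ker N ⊓ LinearMap.range (N ^ j)) := by
  have key : ∀ m, LinearMap.det h =
      ε ^ (∑ j ∈ Finset.range m, finrank F (LinearMap.range (N ^ (j + 1)))) *
      (∏ j ∈ Finset.range m, detOn h (LinearMap.ker N ⊓ LinearMap.range (N ^ j))) *
        detOn h (LinearMap.range (N ^ m)) := by
    intro m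
    induction m with
    | zero => simp [Module.End.one_eq_id, LinearMap.range_id, detOn_top]
    | succ m ih =>
      rw [ih, detOn_range_pow hN hε, Finset.sum_range_succ, Finset.prod_range_succ, pow_add]
      ring
  rw [key m, hm, LinearMap.range_zero, detOn_bot, mul_one]

/-- Rank-nullity for `N` restricted to the image of `N ^ j`. The dimension on the left is the number
of Jordan blocks of size greater than `j` when `N` is nilpotent. -/
theorem finrank_ker_inf_range (N : End F V) (j : ℕ) :
    finrank F (LinearMap.ker N ⊓ LinearMap.range (N ^ j) : Submodule F V) +
      finrank F (LinearMap.ker (N ^ j)) = finrank F (LinearMap.ker (N ^ (j + 1))) := by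
  have h1 := LinearMap.finrank_range_add_finrank_ker (N ^ j)
  have h2 := LinearMap.finrank_range_add_finrank_ker (N ^ (j + 1))
  have h3 := LinearMap.finrank_range_add_finrank_ker
    (N.domRestrict (LinearMap.range (N ^ j)))
  have h4 : LinearMap.range (N.domRestrict (LinearMap.range (N ^ j))) =
      LinearMap.range (N ^ (j + 1)) := by
    rw [LinearMap.range_domRestrict, ← LinearMap.range_comp, pow_succ']; rfl
  rw [h4] at h3
  have h5 : finrank F (LinearMap.ker (N.domRestrict (LinearMap.range (N ^ j)))) =
      finrank F (LinearMap.ker N ⊓ LinearMap.range (N ^ j) : Submodule F V) := by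
    rw [LinearMap.ker_domRestrict, ← Submodule.finrank_map_subtype_eq,
      Submodule.map_comap_subtype, inf_comm]
  omega

/-- The sequence is constant on each block of `k` consecutive indices starting at a multiple of `k`,
so each block contributes a `k`-th power. -/
theorem prod_range_mul_eq_pow {M : Type*} [CommMonoid M] (δ : ℕ → M) (k : ℕ)
    (hδ : ∀ j, ¬ k ∣ j + 1 → δ j = δ (j + 1)) (L : ℕ) :
    ∃ y, ∏ j ∈ Finset.range (k * L), δ j = y ^ k := by
  induction L with
  | zero => exact ⟨1, by simp⟩
  | succ L ih =>
    obtain ⟨y, hy⟩ := ih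
    refine ⟨y * δ (k * L), ?_⟩
    rw [mul_add_one, Finset.prod_range_add, hy, mul_pow]
    congr 1
    have : ∀ i, i < k → δ (k * L + i) = δ (k * L) := by
      intro i hi
      induction i with
      | zero => rfl
      | succ i ih =>
        rw [← ih (by omega), eq_comm, ← add_assoc]
        apply hδ
        rw [add_assoc, Nat.dvd_add_right (dvd_mul_right k L)]
        exact Nat.not_dvd_of_pos_of_lt (by omega) hi
    rw [Finset.prod_congr rfl fun i hi => this i (Finset.mem_range.mp hi)]
    simp

/-- If `h` commutes with the nilpotent `N` up to the sign `ε`, and the dimension of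
`ker N ⊓ range (N ^ j)` can drop from `j` to `j + 1` only if `k ∣ j + 1`, then the determinant of
`h` is a `k`-th power up to an explicit sign. -/
theorem exists_det_eq_pow {h N : End F V} {ε : F} (hN : ∀ x, h (N x) = ε • N (h x))
    (hε : ε * ε = 1) {k L : ℕ} (hm : N ^ (k * L) = 0)
    (hk : ∀ j, ¬ k ∣ j + 1 →
      finrank F (LinearMap.ker (N ^ (j + 1))) + finrank F (LinearMap.ker (N ^ (j + 1))) =
        finrank F (LinearMap.ker (N ^ j)) + finrank F (LinearMap.ker (N ^ (j + 2)))) :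
    ∃ y, LinearMap.det h =
      ε ^ (∑ j ∈ Finset.range (k * L), finrank F (LinearMap.range (N ^ (j + 1)))) * y ^ k := by
  obtain ⟨y, hy⟩ := prod_range_mul_eq_pow
    (fun j => detOn h (LinearMap.ker N ⊓ LinearMap.range (N ^ j))) k (fun j hj => by
      have h1 := finrank_ker_inf_range N j
      have h2 := finrank_ker_inf_range N (j + 1)
      have h3 := hk j hj
      have hle : LinearMap.ker N ⊓ LinearMap.range (N ^ (j + 1)) ≤
          LinearMap.ker N ⊓ LinearMap.range (N ^ j) := by
        refine inf_le_inf_left _ ?_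
        rintro _ ⟨x, rfl⟩
        exact ⟨N x, by rw [pow_succ]; rfl⟩
      -- The vanishing second difference `hk` says that there is no Jordan block of size exactly `j
      -- + 1`, so the two nested subspaces have equal dimension.
      have := Submodule.eq_of_le_of_finrank_eq hle (by
        change _ + _ = finrank F (LinearMap.ker (N ^ (j + 2))) at h2
        omega)
      simp only [this]) L
  exact ⟨y, by rw [det_eq_prod_detOn hN hε hm, hy]⟩

end LinearAlgebra

end RealClasses

namespace RealClasses

open Polynomial Module

/-! ### Kernels and determinants on cyclic modules F[X]/(p^e) -/

section CyclicModules

variable {F : Type*} [Field F]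

/-- Multiplication by `h`, as a map from `F[X] / (g)` to `F[X] / (g * h)`. -/
noncomputable def quotMul (g h : F[X]) :
    (F[X] ⧸ Ideal.span {g}) →ₗ[F[X]] (F[X] ⧸ Ideal.span {g * h}) :=
  Submodule.mapQ _ _ (LinearMap.mulRight F[X] h) (by
    intro x hx
    rw [Ideal.mem_span_singleton] at hx
    rw [Submodule.mem_comap, LinearMap.mulRight_apply, Ideal.mem_span_singleton]
    exact mul_dvd_mul_right hx h)

theorem quotMul_mk (g h x : F[X]) :
    quotMul g h (Ideal.Quotient.mk _ x) = Ideal.Quotient.mk _ (x * h) := rfl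

theorem quotMul_injective (g : F[X]) {h : F[X]} (hh : h ≠ 0) :
    Function.Injective (quotMul g h) := by
  rw [injective_iff_map_eq_zero]
  intro x hx
  obtain ⟨x, rfl⟩ := Ideal.Quotient.mk_surjective x
  rw [quotMul_mk, Ideal.Quotient.eq_zero_iff_mem, Ideal.mem_span_singleton] at hx
  rw [Ideal.Quotient.eq_zero_iff_mem, Ideal.mem_span_singleton]
  exact (mul_dvd_mul_iff_right hh).mp hx

theorem mk_mem_range_quotMul (g h x : F[X]) :
    Ideal.Quotient.mk (Ideal.span {g * h}) x ∈ LinearMap.range (quotMul g h) ↔ h ∣ x := by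
  constructor
  · rintro ⟨y, hy⟩
    obtain ⟨y, rfl⟩ := Ideal.Quotient.mk_surjective y
    rw [quotMul_mk, Ideal.Quotient.mk_eq_mk_iff_sub_mem, Ideal.mem_span_singleton] at hy
    have := (dvd_mul_left h g).trans hy
    exact (dvd_sub_right (dvd_mul_left h y)).mp this
  · rintro ⟨y, rfl⟩
    exact ⟨Ideal.Quotient.mk _ y, by rw [quotMul_mk, mul_comm y h]⟩

theorem finiteDimensional_quot {p : F[X]} (hp : p ≠ 0) :
    FiniteDimensional F (F[X] ⧸ Ideal.span {p}) :=
  (AdjoinRoot.powerBasis hp).finite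

/-- Here `g` is the gcd of `a` and `b`; the kernel is generated by `b'` and is a copy of F[X]/(g).
-/
theorem finrank_ker_lsmul_quot {a b g a' b' : F[X]} (hb : b ≠ 0) (hg : b = g * b')
    (ha : a = g * a') (h : IsCoprime a' b') :
    finrank F (LinearMap.ker (Algebra.lsmul F F (F[X] ⧸ Ideal.span {b}) a)) = g.natDegree := by
  subst hg
  have hb' : b' ≠ 0 := right_ne_zero_of_mul hb
  have : LinearMap.ker (Algebra.lsmul F F (F[X] ⧸ Ideal.span {g * b'}) a) =
      LinearMap.range ((quotMul g b').restrictScalars F) := by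
    ext x
    obtain ⟨x, rfl⟩ := Ideal.Quotient.mk_surjective x
    have h1 := mk_mem_range_quotMul g b' x
    have h2 : (Ideal.Quotient.mk (Ideal.span {g * b'}) x ∈
        LinearMap.range ((quotMul g b').restrictScalars F)) ↔ b' ∣ x := h1
    rw [h2, LinearMap.mem_ker]
    have : Algebra.lsmul F F _ a (Ideal.Quotient.mk (Ideal.span {g * b'}) x) =
      Ideal.Quotient.mk (Ideal.span {g * b'}) (a * x) := rfl
    rw [this, Ideal.Quotient.eq_zero_iff_mem, Ideal.mem_span_singleton, ha, mul_assoc,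
      mul_dvd_mul_iff_left (left_ne_zero_of_mul hb)]
    exact ⟨h.symm.dvd_of_dvd_mul_left, fun hx => hx.mul_left _⟩
  rw [this, LinearMap.finrank_range_of_inj (f := (quotMul g b').restrictScalars F)
    (quotMul_injective g hb'),
    finrank_quotient_span_eq_natDegree]

/-- Multiplicativity of the determinant along 0 → F[X]/(g) → F[X]/(gh) → F[X]/(h) → 0. -/
theorem det_lsmul_quot_mul (a : F[X]) {g h : F[X]} (hg : g ≠ 0) (hh : h ≠ 0) :
    LinearMap.det (Algebra.lsmul F F (F[X] ⧸ Ideal.span {g * h}) a) =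
      LinearMap.det (Algebra.lsmul F F (F[X] ⧸ Ideal.span {g}) a) *
      LinearMap.det (Algebra.lsmul F F (F[X] ⧸ Ideal.span {h}) a) := by
  have := finiteDimensional_quot (mul_ne_zero hg hh)
  have hle : Ideal.span {g * h} ≤ Ideal.span {h} := by
    rw [Ideal.span_singleton_le_span_singleton]; exact dvd_mul_left h g
  refine det_eq_mul_of_exact ((quotMul g h).restrictScalars F)
    ((Submodule.factor hle).restrictScalars F) (quotMul_injective g hh)
    (Submodule.factor_surjective hle) ?_ _ _ _ ?_ ?_
  · ext x
    obtain ⟨x, rfl⟩ := Ideal.Quotient.mk_surjective x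
    have h1 := mk_mem_range_quotMul g h x
    have h2 : (Ideal.Quotient.mk (Ideal.span {g * h}) x ∈
        LinearMap.range ((quotMul g h).restrictScalars F)) ↔ h ∣ x := h1
    rw [h2, LinearMap.mem_ker]
    have : ((Submodule.factor hle).restrictScalars F) (Ideal.Quotient.mk (Ideal.span {g * h}) x) =
      Ideal.Quotient.mk (Ideal.span {h}) x := rfl
    rw [this, Ideal.Quotient.eq_zero_iff_mem, Ideal.mem_span_singleton]
  · intro x
    exact ((quotMul g h).map_smul a x).symm
  · intro x
    exact (Submodule.factor hle).map_smul a x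

theorem det_lsmul_quot_pow (a : F[X]) {p : F[X]} (hp : p ≠ 0) (e : ℕ) :
    LinearMap.det (Algebra.lsmul F F (F[X] ⧸ Ideal.span {p ^ e}) a) =
      LinearMap.det (Algebra.lsmul F F (F[X] ⧸ Ideal.span {p}) a) ^ e := by
  induction e with
  | zero =>
    have : Subsingleton (F[X] ⧸ Ideal.span {p ^ 0}) := by
      rw [Ideal.Quotient.subsingleton_iff, pow_zero, Ideal.span_singleton_one]
    rw [LinearMap.det_eq_one_of_subsingleton, pow_zero]
  | succ e ih => rw [pow_succ, det_lsmul_quot_mul a (pow_ne_zero e hp) hp, ih, pow_succ]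

theorem det_lsmul_quot_X {p : F[X]} (hp : p.Monic) :
    LinearMap.det (Algebra.lsmul F F (F[X] ⧸ Ideal.span {p}) (X : F[X])) =
      (-1) ^ p.natDegree * p.coeff 0 := by
  have h := Algebra.PowerBasis.norm_gen_eq_coeff_zero_minpoly (AdjoinRoot.powerBasis hp.ne_zero)
  rw [AdjoinRoot.powerBasis_gen, AdjoinRoot.minpoly_root hp.ne_zero, hp.leadingCoeff, inv_one, C_1,
    mul_one, AdjoinRoot.powerBasis_dim] at h
  rw [← h]
  rfl

/-- The determinant is the norm of the residue field of `p`, and norms between finite fields are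
surjective. -/
theorem exists_det_lsmul_quot [Finite F] {p : F[X]} (hp : Irreducible p) (c : F) :
    ∃ a : F[X], LinearMap.det (Algebra.lsmul F F (F[X] ⧸ Ideal.span {p}) a) = c := by
  have := Fact.mk hp
  have : Module.Finite F (AdjoinRoot p) := (AdjoinRoot.powerBasis hp.ne_zero).finite
  have : Finite (AdjoinRoot p) := Module.finite_of_finite F
  obtain ⟨x, hx⟩ := FiniteField.norm_surjective F (AdjoinRoot p) c
  obtain ⟨a, rfl⟩ := AdjoinRoot.mk_surjective x
  exact ⟨a, hx⟩

theorem det_piMap {k : ℕ} {M : Fin k → Type*} [∀ j, AddCommGroup (M j)] [∀ j, Module F (M j)]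
    [∀ j, FiniteDimensional F (M j)] (φ : ∀ j, End F (M j)) :
    LinearMap.det (LinearMap.piMap φ) = ∏ j, LinearMap.det (φ j) := by
  induction k with
  | zero => rw [LinearMap.det_eq_one_of_subsingleton]; simp
  | succ k ih =>
    rw [Fin.prod_univ_succ, ← ih fun j => φ j.succ, ← LinearMap.det_prodMap,
      ← LinearMap.det_conj _ (Fin.consLinearEquiv F M)]
    congr 1
    refine LinearMap.ext fun x => funext fun j => ?_
    induction j using Fin.cases <;> simp [Fin.consLinearEquiv, Fin.tail]

end CyclicModules

end RealClasses

namespace RealClasses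

open Polynomial Module

/-! ### Elementary divisors as a complete invariant of an endomorphism -/

section ElementaryDivisors

variable {F : Type*} [Field F] {V : Type*} [AddCommGroup V] [Module F V]

/-- The `F[X]`-module defined by `T` is the product of the cyclic modules `F[X] / (p j ^ e j)`. -/
def ElemDiv (T : End F V) {k : ℕ} (p : Fin k → F[X]) (e : Fin k → ℕ) : Prop :=
  (∀ j, (p j).Monic ∧ Irreducible (p j) ∧ 0 < e j) ∧
    Nonempty (AEval' T ≃ₗ[F[X]] Π j : Fin k, F[X] ⧸ Ideal.span {p j ^ e j})

/-- The multiset of those `p j` for which `e j = i`. -/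
def factorsAt {R : Type*} {k : ℕ} (p : Fin k → R) (e : Fin k → ℕ) (i : ℕ) : Multiset R :=
  (Finset.univ.filter fun j => e j = i).val.map p

/-- `f i` is the product of those `p j` for which `e j = i`, for the elementary divisors
`p j ^ e j` of `T`. -/
def HasInv (T : End F V) (f : ℕ → F[X]) : Prop :=
  ∃ (k : ℕ) (p : Fin k → F[X]) (e : Fin k → ℕ), ElemDiv T p e ∧ ∀ i, f i = (factorsAt p e i).prod

theorem exists_elemDiv [FiniteDimensional F V] (T : End F V) :
    ∃ (k : ℕ) (p : Fin k → F[X]) (e : Fin k → ℕ), ElemDiv T p e := by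
  classical
  obtain ⟨ι, hι, p, hp, e, ⟨Φ⟩⟩ := equiv_directSum_of_isTorsion
    (AEval.isTorsion_of_finiteDimensional F V T)
  let ι' := {i : ι // 0 < e i}
  let σ : Fin (Fintype.card ι') ≃ ι' := (Fintype.equivFin ι').symm
  let Q : ι → Type _ := fun i => F[X] ⧸ Ideal.span {p i ^ e i}
  have hQ : ∀ i, ¬ 0 < e i → Subsingleton (Q i) := fun i hi => by
    have : p i ^ e i = 1 := by rw [Nat.eq_zero_of_not_pos hi, pow_zero]
    rw [Ideal.Quotient.subsingleton_iff, this, Ideal.span_singleton_one]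
  -- The structure theorem allows exponent zero; those summands are trivial modules and are dropped.
  let r : (Π i, Q i) ≃ₗ[F[X]] (Π i : ι', Q i) := LinearEquiv.ofBijective
    (LinearMap.pi fun i : ι' => LinearMap.proj (R := F[X]) (φ := Q) i.1) ⟨fun x y hxy => by
      funext i
      by_cases hi : 0 < e i
      · exact congrFun hxy ⟨i, hi⟩
      · have := hQ i hi
        exact Subsingleton.elim _ _, fun y => ⟨fun i => if hi : 0 < e i then y ⟨i, hi⟩ else 0, by
      funext i
      exact dif_pos i.2⟩⟩
  let r' : (Π j, Q (σ j)) ≃ₗ[F[X]] (Π i : ι', Q i) :=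
    LinearEquiv.piCongrLeft F[X] (fun i : ι' => Q i) σ
  let r'' : (Π j, Q (σ j)) ≃ₗ[F[X]] (Π j, F[X] ⧸ Ideal.span {normalize (p (σ j)) ^ e (σ j)}) :=
    LinearEquiv.piCongrRight fun j => Submodule.quotEquivOfEq _ _
      (Ideal.span_singleton_eq_span_singleton.mpr ((associated_normalize _).pow_pow))
  exact ⟨Fintype.card ι', fun j => normalize (p (σ j)), fun j => e (σ j), ⟨fun j =>
    ⟨monic_normalize (hp _).ne_zero, (normalize_associated _).symm.irreducible (hp _), (σ j).2⟩,
    ⟨(((Φ.trans (DirectSum.linearEquivFunOnFintype F[X] ι _)).trans r).trans r'.symm).trans r''⟩⟩⟩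

theorem finrank_ker_aeval {T : End F V} {k : ℕ} {p : Fin k → F[X]} {e : Fin k → ℕ}
    (h : ElemDiv T p e) (a : F[X]) : finrank F (LinearMap.ker (aeval T a)) =
      ∑ j, finrank F (LinearMap.ker (Algebra.lsmul F F (F[X] ⧸ Ideal.span {p j ^ e j}) a)) := by
  obtain ⟨h1, ⟨Φ⟩⟩ := h
  have := fun j => finiteDimensional_quot (pow_ne_zero (e j) (h1 j).1.ne_zero)
  have hfree := fun j => Module.Free.of_divisionRing F
    (LinearMap.ker (Algebra.lsmul F F (F[X] ⧸ Ideal.span {p j ^ e j}) a))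
  rw [← Module.finrank_pi_fintype]
  let Ψ : V ≃ₗ[F] Π j : Fin k, F[X] ⧸ Ideal.span {p j ^ e j} :=
    (AEval'.of T).trans (Φ.restrictScalars F)
  have hΨ : ∀ x, Ψ (aeval T a x) = a • Ψ x := fun x => Φ.map_smul a (AEval'.of T x)
  have hm : ∀ (x : LinearMap.ker (aeval T a)) j,
      Ψ x j ∈ LinearMap.ker (Algebra.lsmul F F (F[X] ⧸ Ideal.span {p j ^ e j}) a) := by
    intro x j
    have := hΨ x.1
    rw [LinearMap.mem_ker.mp x.2, map_zero] at this
    exact (congrFun this j).symm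
  let Θ : LinearMap.ker (aeval T a) →ₗ[F]
      Π j, LinearMap.ker (Algebra.lsmul F F (F[X] ⧸ Ideal.span {p j ^ e j}) a) :=
    { toFun := fun x j => ⟨Ψ x.1 j, hm x j⟩
      map_add' := fun x y => by ext; simp
      map_smul' := fun c x => by ext; simp }
  refine LinearEquiv.finrank_eq (LinearEquiv.ofBijective Θ ⟨?_, ?_⟩)
  · intro x y hxy
    refine Subtype.ext (Ψ.injective (funext fun j => ?_))
    exact congrArg Subtype.val (congrFun hxy j)
  · intro y
    refine ⟨⟨Ψ.symm fun j => (y j).1, ?_⟩, ?_⟩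
    · rw [LinearMap.mem_ker]
      apply Ψ.injective
      rw [hΨ, map_zero, LinearEquiv.apply_symm_apply]
      exact funext fun j => LinearMap.mem_ker.mp (y j).2
    · funext j
      exact Subtype.ext (congrFun (Ψ.apply_symm_apply _) j)

theorem ElemDiv.finrank_eq {T : End F V} {k : ℕ} {p : Fin k → F[X]} {e : Fin k → ℕ}
    (h : ElemDiv T p e) : finrank F V = ∑ j, e j * (p j).natDegree := by
  obtain ⟨h1, ⟨Φ⟩⟩ := h
  have := fun j => finiteDimensional_quot (pow_ne_zero (e j) (h1 j).1.ne_zero)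
  rw [((AEval'.of T).trans (Φ.restrictScalars F)).finrank_eq, Module.finrank_pi_fintype]
  exact Finset.sum_congr rfl fun j _ => by rw [finrank_quotient_span_eq_natDegree, natDegree_pow]

/-- The predicate `d` selects the `p j` that divide `a` exactly once. The generality serves two
cases: `a` a single prime, for uniqueness of the invariants, and `a` a polynomial X^(2m) - 1
divisible once by every `p j`, for the nilpotent map built from `T`. -/
theorem ElemDiv.finrank_ker_pow {T : End F V} {k : ℕ} {p : Fin k → F[X]} {e : Fin k → ℕ}
    (h : ElemDiv T p e) {a : F[X]} (d : Fin k → Prop) [DecidablePred d]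
    (hd : ∀ j, d j → ∃ w, a = p j * w ∧ IsCoprime w (p j))
    (hd' : ∀ j, ¬ d j → IsCoprime a (p j)) (s : ℕ) :
    finrank F (LinearMap.ker (aeval T a ^ s)) =
      ∑ j, if d j then min s (e j) * (p j).natDegree else 0 := by
  rw [← map_pow, finrank_ker_aeval h]
  refine Finset.sum_congr rfl fun j _ => ?_
  have hp := (h.1 j).1.ne_zero
  split_ifs with hj
  · obtain ⟨w, rfl, hw⟩ := hd j hj
    have h1 : ∀ m n, IsCoprime (w ^ m) (p j ^ n) := fun m n => hw.pow
    rcases le_total s (e j) with hs | hs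
    · rw [finrank_ker_lsmul_quot (g := p j ^ s) (a' := w ^ s) (b' := p j ^ (e j - s))
        (pow_ne_zero _ hp) (by rw [← pow_add]; congr 1; omega) (mul_pow ..) (h1 _ _),
        natDegree_pow, min_eq_left hs]
    · rw [finrank_ker_lsmul_quot (g := p j ^ e j) (a' := p j ^ (s - e j) * w ^ s) (b' := 1)
        (pow_ne_zero _ hp) (by rw [mul_one]) (by
          rw [mul_pow, ← mul_assoc, ← pow_add]; congr 2; omega) isCoprime_one_right,
        natDegree_pow, min_eq_right hs]
  · rw [finrank_ker_lsmul_quot (g := 1) (a' := a ^ s) (b' := p j ^ e j)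
        (pow_ne_zero _ hp) (by rw [one_mul]) (by rw [one_mul]) (hd' j hj).pow, natDegree_one]

theorem count_factorsAt {R : Type*} [DecidableEq R] {k : ℕ} (p : Fin k → R) (e : Fin k → ℕ)
    (i : ℕ) (q : R) : (factorsAt p e i).count q =
      (Finset.univ.filter fun j => e j = i ∧ p j = q).card := by
  rw [factorsAt, Multiset.count_map, ← Finset.filter_val, Finset.filter_filter]
  simp only [Finset.card_val, eq_comm]

theorem ElemDiv.finrank_ker_succ {T : End F V} {k : ℕ} {p : Fin k → F[X]} {e : Fin k → ℕ}
    (h : ElemDiv T p e) {q : F[X]} (hq : q.Monic) (hq' : Irreducible q) (s : ℕ)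
    [DecidableEq F[X]] :
    finrank F (LinearMap.ker (aeval T q ^ (s + 1))) = finrank F (LinearMap.ker (aeval T q ^ s)) +
      (Finset.univ.filter fun j => s < e j ∧ p j = q).card * q.natDegree := by
  have key := h.finrank_ker_pow (a := q) (fun j => p j = q)
    (fun j hj => ⟨1, by rw [hj, mul_one], isCoprime_one_left⟩)
    (fun j hj => (hq'.coprime_iff_not_dvd).mpr fun hd => hj
      (eq_of_monic_of_associated hq (h.1 j).1 ((hq'.associated_of_dvd (h.1 j).2.1) hd)).symm)
  rw [key, key, Finset.card_filter, Finset.sum_mul, ← Finset.sum_add_distrib]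
  refine Finset.sum_congr rfl fun j _ => ?_
  by_cases hj : p j = q
  · subst hj
    simp only [if_true, and_true]
    split_ifs with hs
    · rw [min_eq_left (by omega), min_eq_left (by omega)]; ring
    · rw [min_eq_right (by omega), min_eq_right (by omega)]; ring
  · simp [hj]

/-- The elementary divisors are determined by the dimensions of the kernels of `q(T) ^ s`. -/
theorem ElemDiv.count_eq [DecidableEq F[X]] {T : End F V} {k : ℕ} {p : Fin k → F[X]}
    {e : Fin k → ℕ} (h : ElemDiv T p e) {V' : Type*} [AddCommGroup V'] [Module F V']
    {T' : End F V'} {k' : ℕ} {p' : Fin k' → F[X]} {e' : Fin k' → ℕ} (h' : ElemDiv T' p' e')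
    {q q' : F[X]} (hq : q.Monic) (hqi : Irreducible q) (hq' : q'.Monic) (hqi' : Irreducible q')
    (hdeg : q.natDegree = q'.natDegree)
    (H : ∀ s, finrank F (LinearMap.ker (aeval T q ^ s)) =
      finrank F (LinearMap.ker (aeval T' q' ^ s))) {i : ℕ} :
    (factorsAt p e i).count q = (factorsAt p' e' i).count q' := by
  -- First differences of the kernel dimensions count the divisors of exponent greater than `s`; a
  -- second difference then isolates a single exponent.
  have H2 : ∀ s, (Finset.univ.filter fun j => s < e j ∧ p j = q).card =
      (Finset.univ.filter fun j => s < e' j ∧ p' j = q').card := by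
    intro s
    have h1 := h.finrank_ker_succ hq hqi s
    have h2 := h'.finrank_ker_succ hq' hqi' s
    rw [H, H, h2, ← hdeg] at h1
    exact (Nat.eq_of_mul_eq_mul_right hqi.natDegree_pos (by omega)).symm
  rcases i with _ | i
  · have : ∀ {k : ℕ} {p : Fin k → F[X]} {e : Fin k → ℕ} (q : F[X]), (∀ j, 0 < e j) →
        (factorsAt p e 0).count q = 0 := by
      intro k p e q he
      rw [count_factorsAt, Finset.card_eq_zero, Finset.filter_eq_empty_iff]
      rintro j - ⟨h0, -⟩
      exact (he j).ne' h0
    rw [this q fun j => (h.1 j).2.2, this q' fun j => (h'.1 j).2.2]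
  · have : ∀ {k : ℕ} (p : Fin k → F[X]) (e : Fin k → ℕ) (q : F[X]),
        (Finset.univ.filter fun j => i < e j ∧ p j = q).card =
        (factorsAt p e (i + 1)).count q +
          (Finset.univ.filter fun j => i + 1 < e j ∧ p j = q).card := by
      intro k p e q
      rw [count_factorsAt, ← Finset.card_union_of_disjoint]
      · congr 1
        ext j
        simp only [Finset.mem_filter, Finset.mem_univ, true_and, Finset.mem_union, ← or_and_right]
        refine and_congr_left fun _ => ?_
        omega
      · rw [Finset.disjoint_filter]
        omega
    have h1 := this p e q
    have h2 := this p' e' q'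
    have h3 := H2 i
    have h4 := H2 (i + 1)
    omega

theorem mem_factorsAt {R : Type*} {k : ℕ} {p : Fin k → R} {e : Fin k → ℕ} {i : ℕ} {q : R} :
    q ∈ factorsAt p e i ↔ ∃ j, e j = i ∧ p j = q := by
  simp [factorsAt]

theorem ElemDiv.mem_factorsAt {T : End F V} {k : ℕ} {p : Fin k → F[X]}
    {e : Fin k → ℕ} (h : ElemDiv T p e) {i : ℕ} {q : F[X]} (hq : q ∈ factorsAt p e i) :
    q.Monic ∧ Irreducible q := by
  obtain ⟨j, -, rfl⟩ := RealClasses.mem_factorsAt.mp hq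
  exact ⟨(h.1 j).1, (h.1 j).2.1⟩

theorem ElemDiv.factorsAt_eq {T : End F V} {k : ℕ} {p : Fin k → F[X]}
    {e : Fin k → ℕ} (h : ElemDiv T p e) {V' : Type*} [AddCommGroup V'] [Module F V']
    {T' : End F V'} {k' : ℕ} {p' : Fin k' → F[X]} {e' : Fin k' → ℕ} (h' : ElemDiv T' p' e')
    (H : ∀ (q : F[X]) (s : ℕ), finrank F (LinearMap.ker (aeval T q ^ s)) =
      finrank F (LinearMap.ker (aeval T' q ^ s))) (i : ℕ) :
    factorsAt p e i = factorsAt p' e' i := by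
  classical
  ext q
  by_cases hq : q.Monic ∧ Irreducible q
  · exact h.count_eq h' hq.1 hq.2 hq.1 hq.2 rfl (H q)
  · rw [Multiset.count_eq_zero_of_notMem fun hm => hq (h.mem_factorsAt hm),
      Multiset.count_eq_zero_of_notMem fun hm => hq (h'.mem_factorsAt hm)]

theorem HasInv.unique {T : End F V} {f f' : ℕ → F[X]} (h : HasInv T f) (h' : HasInv T f') :
    f = f' := by
  obtain ⟨k, p, e, h, hf⟩ := h
  obtain ⟨k', p', e', h', hf'⟩ := h'
  funext i
  rw [hf, hf', h.factorsAt_eq h' fun _ _ => rfl]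

theorem exists_hasInv [FiniteDimensional F V] (T : End F V) : ∃ f, HasInv T f := by
  obtain ⟨k, p, e, h⟩ := exists_elemDiv T
  exact ⟨_, k, p, e, h, fun i => rfl⟩

theorem multiset_eq_of_prod_eq {P P' : Multiset F[X]} (h : ∀ q ∈ P, q.Monic ∧ Irreducible q)
    (h' : ∀ q ∈ P', q.Monic ∧ Irreducible q) (heq : P.prod = P'.prod) : P = P' := by
  have := UniqueFactorizationMonoid.factors_unique (fun q hq => (h q hq).2)
    (fun q hq => (h' q hq).2) (heq ▸ Associated.refl _)
  rw [← Multiset.rel_eq]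
  exact this.mono fun a ha b hb hab => eq_of_monic_of_associated (h a ha).1 (h' b hb).1 hab

theorem exists_equiv_of_factorsAt_eq {R : Type*} {k : ℕ} {p : Fin k → R} {e : Fin k → ℕ} {k' : ℕ}
    {p' : Fin k' → R} {e' : Fin k' → ℕ} (h : ∀ i, factorsAt p e i = factorsAt p' e' i) :
    ∃ σ : Fin k ≃ Fin k', ∀ j, p' (σ j) = p j ∧ e' (σ j) = e j := by
  classical
  have hc : ∀ c : R × ℕ, Nonempty ({j // (p j, e j) = c} ≃ {j // (p' j, e' j) = c}) := by
    rintro ⟨q, i⟩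
    have := congrArg (Multiset.count q) (h i)
    rw [count_factorsAt, count_factorsAt] at this
    refine Fintype.card_eq.mp ?_
    rw [Fintype.card_subtype, Fintype.card_subtype]
    simpa only [Prod.mk.injEq, and_comm] using this
  refine ⟨Equiv.ofFiberEquiv fun c => (hc c).some, fun j => ?_⟩
  have := Equiv.ofFiberEquiv_map (fun c => (hc c).some) j
  exact ⟨congrArg Prod.fst this, congrArg Prod.snd this⟩

/-- Unique factorization recovers from each `f i` the multiset of primes occurring with exponent
`i`, hence the module up to isomorphism; an isomorphism of F[X]-modules is a conjugation. -/
theorem HasInv.exists_conj {T T' : End F V} {f : ℕ → F[X]} (h : HasInv T f) (h' : HasInv T' f) :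
    ∃ Φ : V ≃ₗ[F] V, ∀ x, Φ (T x) = T' (Φ x) := by
  classical
  obtain ⟨k, p, e, h, hf⟩ := h
  obtain ⟨k', p', e', h', hf'⟩ := h'
  obtain ⟨σ, hσ⟩ := exists_equiv_of_factorsAt_eq (p := p) (e := e) (p' := p') (e' := e') fun i =>
    multiset_eq_of_prod_eq (fun q => h.mem_factorsAt) (fun q => h'.mem_factorsAt)
      (by rw [← hf, ← hf'])
  obtain ⟨h1, ⟨Φ⟩⟩ := h
  obtain ⟨h1', ⟨Φ'⟩⟩ := h'
  let r : (Π j, F[X] ⧸ Ideal.span {p j ^ e j}) ≃ₗ[F[X]]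
      (Π j, F[X] ⧸ Ideal.span {p' (σ j) ^ e' (σ j)}) :=
    LinearEquiv.piCongrRight fun j => Submodule.quotEquivOfEq _ _ (by rw [(hσ j).1, (hσ j).2])
  let r' : (Π j, F[X] ⧸ Ideal.span {p' (σ j) ^ e' (σ j)}) ≃ₗ[F[X]] _ :=
    LinearEquiv.piCongrLeft F[X] (fun j => F[X] ⧸ Ideal.span {p' j ^ e' j}) σ
  let Ψ : AEval' T ≃ₗ[F[X]] AEval' T' := ((Φ.trans r).trans r').trans Φ'.symm
  refine ⟨((AEval'.of T).trans (Ψ.restrictScalars F)).trans (AEval'.of T').symm, fun x => ?_⟩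
  have := Ψ.map_smul X (AEval'.of T x)
  rw [AEval'.X_smul_of] at this
  simp only [LinearEquiv.trans_apply, LinearEquiv.restrictScalars_apply, this,
    AEval'.of_symm_X_smul]

theorem HasInv.of_conj {V' : Type*} [AddCommGroup V'] [Module F V'] {T : End F V} {T' : End F V'}
    {f : ℕ → F[X]} (h : HasInv T f) (Φ : V ≃ₗ[F] V') (hΦ : ∀ x, Φ (T x) = T' (Φ x)) :
    HasInv T' f := by
  obtain ⟨k, p, e, ⟨h1, ⟨Ψ⟩⟩, hf⟩ := h
  let Ξ : AEval' T' ≃ₗ[F[X]] AEval' T :=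
    LinearEquiv.ofAEval T' (Φ.symm.trans (AEval'.of T)) fun x => by
      simp only [LinearEquiv.trans_apply]
      rw [AEval'.X_smul_of]
      congr 1
      rw [LinearEquiv.symm_apply_eq, hΦ, LinearEquiv.apply_symm_apply]
      rfl
  exact ⟨k, p, e, ⟨h1, ⟨Ξ.trans Ψ⟩⟩, hf⟩

theorem factorsAt_eq_map_filter {R : Type*} {k : ℕ} (p : Fin k → R) (e : Fin k → ℕ) (i : ℕ) :
    factorsAt p e i = (((Finset.univ.val.map fun j => (p j, e j)).filter
      fun x => x.2 = i).map Prod.fst) := by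
  rw [factorsAt, Multiset.filter_map, Multiset.map_map]
  rfl

theorem exists_monic_irreducible_prod {f : F[X]} (hf : f.Monic) :
    ∃ P : Multiset F[X], (∀ q ∈ P, q.Monic ∧ Irreducible q) ∧ P.prod = f := by
  classical
  refine ⟨UniqueFactorizationMonoid.normalizedFactors f, fun q hq => ⟨?_, ?_⟩, ?_⟩
  · rw [← UniqueFactorizationMonoid.normalize_normalized_factor q hq]
    exact monic_normalize (UniqueFactorizationMonoid.irreducible_of_normalized_factor q hq).ne_zero
  · exact UniqueFactorizationMonoid.irreducible_of_normalized_factor q hq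
  · rw [UniqueFactorizationMonoid.prod_normalizedFactors_eq hf.ne_zero, hf.normalize_eq_self]

/-- Any family of elementary divisors of the right total degree is realised. -/
theorem exists_hasInv_of_sum [FiniteDimensional F V] (f : ℕ → F[X]) (hf : ∀ i, (f i).Monic)
    (hf0 : f 0 = 1) (n : ℕ) (hn : ∀ i, n < i → f i = 1)
    (hV : finrank F V = ∑ i ∈ Finset.range (n + 1), i * (f i).natDegree) :
    ∃ T : End F V, HasInv T f := by
  classical
  choose P hP hPf using fun i => exists_monic_irreducible_prod (hf i)
  have hP1 : ∀ i, f i = 1 → P i = 0 := fun i hi =>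
    multiset_eq_of_prod_eq (hP i) (by simp) (by rw [hPf, hi, Multiset.prod_zero])
  -- The multiset of all pairs (prime, exponent), from which the indexed families `p` and `e` are
  -- read off.
  let D : Multiset (F[X] × ℕ) := ∑ i ∈ Finset.range (n + 1), (P i).map fun q => (q, i)
  have hD : ∀ x ∈ D, x.1 ∈ P x.2 := by
    intro x hx
    obtain ⟨i, -, hi⟩ := Multiset.mem_sum.mp hx
    obtain ⟨q, hq, rfl⟩ := Multiset.mem_map.mp hi
    exact hq
  have hDf : ∀ i, (D.filter fun x => x.2 = i).map Prod.fst = P i := by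
    intro i
    have : ∀ s : Finset ℕ, ((∑ i ∈ s, (P i).map fun q => (q, i)).filter fun x => x.2 = i).map
        Prod.fst = if i ∈ s then P i else 0 := by
      intro s
      induction s using Finset.induction_on with
      | empty => simp
      | insert j s hj ih =>
        rw [Finset.sum_insert hj, Multiset.filter_add, Multiset.map_add, ih, Multiset.filter_map,
          Multiset.map_map]
        by_cases hij : j = i
        · subst hij
          simp [hj]
        · simp [hij, Ne.symm hij]
    rw [this]
    split_ifs with hi
    · rfl
    · rw [hP1 i (hn i (by simpa using hi))]
  let k := D.toList.length
  let p : Fin k → F[X] := fun j => (D.toList.get j).1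
  let e : Fin k → ℕ := fun j => (D.toList.get j).2
  have hpe : (Finset.univ.val.map fun j : Fin k => (p j, e j)) = D := by
    rw [Fin.univ_val_map]
    change ((List.ofFn D.toList.get : List _) : Multiset (F[X] × ℕ)) = D
    rw [List.ofFn_get, Multiset.coe_toList]
  have hmem : ∀ j, p j ∈ P (e j) := fun j =>
    hD (D.toList.get j) (Multiset.mem_toList.mp (List.get_mem _ _))
  have hp : ∀ j, (p j).Monic ∧ Irreducible (p j) ∧ 0 < e j := by
    intro j
    refine ⟨(hP _ _ (hmem j)).1, (hP _ _ (hmem j)).2, Nat.pos_of_ne_zero fun h0 => ?_⟩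
    have := hmem j
    rw [h0, hP1 0 hf0] at this
    simp at this
  have hfin := fun j => finiteDimensional_quot (pow_ne_zero (e j) (hp j).1.ne_zero)
  have hdim : finrank F V = finrank F (Π j : Fin k, F[X] ⧸ Ideal.span {p j ^ e j}) := by
    rw [hV, Module.finrank_pi_fintype]
    have h1 : ∑ j : Fin k, finrank F (F[X] ⧸ Ideal.span {p j ^ e j}) =
        (D.map fun x => x.2 * x.1.natDegree).sum := by
      rw [← hpe, Multiset.map_map]
      refine Finset.sum_congr rfl fun j _ => ?_
      rw [finrank_quotient_span_eq_natDegree, natDegree_pow]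
      rfl
    have h2 : (D.map fun x => x.2 * x.1.natDegree).sum = (Multiset.sumAddMonoidHom.comp
      (Multiset.mapAddMonoidHom fun x : F[X] × ℕ => x.2 * x.1.natDegree)) D := rfl
    rw [h1, h2, map_sum]
    refine Finset.sum_congr rfl fun i _ => ?_
    change _ = (Multiset.map _ (Multiset.map _ _)).sum
    rw [Multiset.map_map]
    simp only [Function.comp_def]
    rw [Multiset.sum_map_mul_left, ← hPf i,
      natDegree_multiset_prod_of_monic _ fun q hq => (hP i q hq).1]
  -- Any linear isomorphism will do: multiplication by `X` on the product is transported to `V`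
  -- along it.
  let Ψ := LinearEquiv.ofFinrankEq V (Π j : Fin k, F[X] ⧸ Ideal.span {p j ^ e j}) hdim
  refine ⟨Ψ.symm.toLinearMap ∘ₗ Algebra.lsmul F F _ (X : F[X]) ∘ₗ Ψ.toLinearMap,
    k, p, e, ⟨hp, ⟨LinearEquiv.ofAEval _ Ψ fun x => ?_⟩⟩, fun i => ?_⟩
  · simp
  · rw [factorsAt_eq_map_filter, hpe, hDf, hPf]

/-- Endomorphisms commuting with `T` obtained by multiplication with `b j` on the summands. -/
theorem ElemDiv.exists_commute_det {T : End F V} {k : ℕ} {p : Fin k → F[X]} {e : Fin k → ℕ}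
    (h : ElemDiv T p e) (b : Fin k → F[X]) : ∃ c : End F V, c * T = T * c ∧
      LinearMap.det c =
        ∏ j, LinearMap.det (Algebra.lsmul F F (F[X] ⧸ Ideal.span {p j}) (b j)) ^ e j ∧
      ((∀ j, b j = X) → c = T) := by
  obtain ⟨h1, ⟨Φ⟩⟩ := h
  have := fun j => finiteDimensional_quot (pow_ne_zero (e j) (h1 j).1.ne_zero)
  let Ψ : V ≃ₗ[F] Π j : Fin k, F[X] ⧸ Ideal.span {p j ^ e j} :=
    (AEval'.of T).trans (Φ.restrictScalars F)
  have hΨ : ∀ x, Ψ (T x) = (X : F[X]) • Ψ x := fun x => by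
    have := Φ.map_smul X (AEval'.of T x)
    rw [AEval'.X_smul_of] at this
    exact this
  let φ : End F (Π j : Fin k, F[X] ⧸ Ideal.span {p j ^ e j}) :=
    LinearMap.piMap fun j => Algebra.lsmul F F (F[X] ⧸ Ideal.span {p j ^ e j}) (b j)
  have hφ : ∀ x j, φ x j = b j • x j := fun x j => rfl
  refine ⟨Ψ.symm.toLinearMap ∘ₗ φ ∘ₗ Ψ.toLinearMap, ?_, ?_, fun hb => ?_⟩
  · ext x
    apply Ψ.injective
    simp only [Module.End.mul_apply, LinearMap.comp_apply, LinearEquiv.coe_coe, hΨ,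
      LinearEquiv.apply_symm_apply]
    funext j
    simp only [hφ, Pi.smul_apply]
    rw [smul_comm]
  · have := LinearMap.det_conj φ Ψ.symm
    rw [LinearEquiv.symm_symm] at this
    rw [this, det_piMap]
    exact Finset.prod_congr rfl fun j _ => det_lsmul_quot_pow _ (h1 j).1.ne_zero _
  · ext x
    apply Ψ.injective
    simp only [LinearMap.comp_apply, LinearEquiv.coe_coe, hΨ, LinearEquiv.apply_symm_apply]
    funext j
    simp [hφ, hb]

end ElementaryDivisors

end RealClasses

namespace RealClasses

open Polynomial Module

/-! ### The substitutions α ↦ l/α and α ↦ lα on roots -/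

section Reciprocal

variable {F : Type*} [Field F]

/-- Monic polynomials without the root zero. -/
def MonicUnit (f : F[X]) : Prop := f.Monic ∧ f.coeff 0 ≠ 0

/-- The monic polynomial whose roots are the `l / α`, for the roots `α` of `f`. -/
noncomputable def recip (l : F) (f : F[X]) : F[X] := (C (f.coeff 0)⁻¹ * f.reverse).scaleRoots l

/-- The product of the roots of the monic polynomial `f`. -/
noncomputable def rootProd (f : F[X]) : F := (-1) ^ f.natDegree * f.coeff 0

theorem MonicUnit.natDegree_reverse {f : F[X]} (hf : MonicUnit f) :
    f.reverse.natDegree = f.natDegree := by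
  rw [reverse_natDegree, natTrailingDegree_eq_zero.mpr (Or.inr hf.2), Nat.sub_zero]

theorem MonicUnit.natDegree_recip {f : F[X]} (hf : MonicUnit f) (l : F) :
    (recip l f).natDegree = f.natDegree := by
  rw [recip, natDegree_scaleRoots, natDegree_C_mul (inv_ne_zero hf.2), hf.natDegree_reverse]

theorem MonicUnit.coeff_recip {f : F[X]} (hf : MonicUnit f) (l : F) {i : ℕ}
    (hi : i ≤ f.natDegree) : (recip l f).coeff i =
      (f.coeff 0)⁻¹ * f.coeff (f.natDegree - i) * l ^ (f.natDegree - i) := by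
  rw [recip, coeff_scaleRoots, natDegree_C_mul (inv_ne_zero hf.2), hf.natDegree_reverse,
    coeff_C_mul, coeff_reverse, revAt_le hi]

theorem MonicUnit.recip {f : F[X]} (hf : MonicUnit f) {l : F} (hl : l ≠ 0) :
    MonicUnit (recip l f) := by
  refine ⟨?_, ?_⟩
  · rw [Monic, leadingCoeff, hf.natDegree_recip, hf.coeff_recip _ le_rfl, Nat.sub_self, pow_zero,
      mul_one, inv_mul_cancel₀ hf.2]
  · rw [hf.coeff_recip _ (Nat.zero_le _), Nat.sub_zero, hf.1.coeff_natDegree, mul_one]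
    exact mul_ne_zero (inv_ne_zero hf.2) (pow_ne_zero _ hl)

theorem MonicUnit.coeff_zero_recip {f : F[X]} (hf : MonicUnit f) (l : F) :
    (RealClasses.recip l f).coeff 0 = (f.coeff 0)⁻¹ * l ^ f.natDegree := by
  rw [hf.coeff_recip _ (Nat.zero_le _), Nat.sub_zero, hf.1.coeff_natDegree, mul_one]

theorem MonicUnit.scaleRoots {f : F[X]} (hf : MonicUnit f) {l : F} (hl : l ≠ 0) :
    MonicUnit (f.scaleRoots l) := by
  refine ⟨(monic_scaleRoots_iff l).mpr hf.1, ?_⟩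
  rw [coeff_scaleRoots]
  exact mul_ne_zero hf.2 (pow_ne_zero _ hl)

theorem MonicUnit.mul {f g : F[X]} (hf : MonicUnit f) (hg : MonicUnit g) : MonicUnit (f * g) :=
  ⟨hf.1.mul hg.1, by rw [mul_coeff_zero]; exact mul_ne_zero hf.2 hg.2⟩

theorem monicUnit_one : MonicUnit (1 : F[X]) := ⟨monic_one, by simp⟩

theorem recip_one (l : F) : recip l (1 : F[X]) = 1 := by
  have : (1 : F[X]).reverse = 1 := by rw [← C_1, reverse_C]
  simp [recip, this]

theorem recip_mul (l : F) (f g : F[X]) : recip l (f * g) = recip l f * recip l g := by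
  rw [recip, recip, recip, ← mul_scaleRoots_of_noZeroDivisors, reverse_mul_of_domain,
    mul_coeff_zero, mul_inv, C_mul]
  ring_nf

theorem recip_multiset_prod (l : F) (P : Multiset F[X]) :
    recip l P.prod = (P.map (recip l)).prod := by
  induction P using Multiset.induction_on with
  | empty => simp [recip_one]
  | cons f P ih => rw [Multiset.prod_cons, recip_mul, ih, Multiset.map_cons, Multiset.prod_cons]

theorem MonicUnit.multiset_prod {P : Multiset F[X]} (h : ∀ f ∈ P, MonicUnit f) :
    MonicUnit P.prod := by
  induction P using Multiset.induction_on with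
  | empty => simpa using monicUnit_one
  | cons f P ih =>
    rw [Multiset.prod_cons]
    exact (h f (Multiset.mem_cons_self f P)).mul
      (ih fun g hg => h g (Multiset.mem_cons_of_mem hg))

theorem ext_of_natDegree {f g : F[X]} (h : f.natDegree = g.natDegree)
    (h' : ∀ i ≤ f.natDegree, f.coeff i = g.coeff i) : f = g := by
  ext i
  rcases le_or_gt i f.natDegree with hi | hi
  · exact h' i hi
  · rw [coeff_eq_zero_of_natDegree_lt hi, coeff_eq_zero_of_natDegree_lt (h ▸ hi)]

/-- On roots: α ↦ l/α ↦ m/(l/α) = (m/l)α. -/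
theorem MonicUnit.recip_recip {f : F[X]} (hf : MonicUnit f) {l m : F} (hl : l ≠ 0) :
    RealClasses.recip m (RealClasses.recip l f) = f.scaleRoots (m / l) := by
  have hr := hf.recip hl
  refine ext_of_natDegree ?_ fun i hi => ?_
  · rw [hr.natDegree_recip, hf.natDegree_recip, natDegree_scaleRoots]
  · rw [hr.natDegree_recip, hf.natDegree_recip] at hi
    rw [hr.coeff_recip _ (by rw [hf.natDegree_recip]; exact hi), hf.natDegree_recip,
      hf.coeff_zero_recip, hf.coeff_recip _ (Nat.sub_le _ _), coeff_scaleRoots, Nat.sub_sub_self hi,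
      div_pow, mul_inv, inv_inv]
    have h1 : l ^ f.natDegree = l ^ i * l ^ (f.natDegree - i) := by
      rw [← pow_add]; congr 1; omega
    have h2 := hf.2
    have h3 := pow_ne_zero i hl
    have h4 := pow_ne_zero (f.natDegree - i) hl
    rw [h1]
    field_simp

theorem MonicUnit.recip_involutive {f : F[X]} (hf : MonicUnit f) {l : F} (hl : l ≠ 0) :
    RealClasses.recip l (RealClasses.recip l f) = f := by
  rw [hf.recip_recip hl, div_self hl, scaleRoots_one]

theorem MonicUnit.recip_scaleRoots {f : F[X]} (hf : MonicUnit f) {l m : F} (hl : l ≠ 0) :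
    RealClasses.recip m (f.scaleRoots l) = RealClasses.recip (m / l) f := by
  have hs := hf.scaleRoots hl
  refine ext_of_natDegree ?_ fun i hi => ?_
  · rw [hs.natDegree_recip, hf.natDegree_recip, natDegree_scaleRoots]
  · rw [hs.natDegree_recip, natDegree_scaleRoots] at hi
    rw [hs.coeff_recip _ (by rwa [natDegree_scaleRoots]), hf.coeff_recip _ hi, coeff_scaleRoots,
      coeff_scaleRoots, natDegree_scaleRoots, Nat.sub_sub_self hi, div_pow, Nat.sub_zero]
    have h1 : l ^ f.natDegree = l ^ i * l ^ (f.natDegree - i) := by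
      rw [← pow_add]; congr 1; omega
    have h2 := hf.2
    have h3 := pow_ne_zero i hl
    have h4 := pow_ne_zero (f.natDegree - i) hl
    rw [h1]
    field_simp

theorem scaleRoots_recip (l m : F) (f : F[X]) :
    (recip l f).scaleRoots m = recip (l * m) f := by
  rw [recip, recip, ← scaleRoots_mul]

theorem MonicUnit.of_dvd {f g : F[X]} (hf : MonicUnit f) (hg : g.Monic) (h : g ∣ f) :
    MonicUnit g := by
  obtain ⟨u, rfl⟩ := h
  refine ⟨hg, fun h0 => hf.2 ?_⟩
  rw [mul_coeff_zero, h0, zero_mul]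

/-- The operation is multiplicative, preserves degrees and is an involution, so a factorization of
the image pulls back to one of `f`. -/
theorem MonicUnit.irreducible_recip {f : F[X]} (hf : MonicUnit f) {l : F} (hl : l ≠ 0)
    (h : Irreducible f) : Irreducible (RealClasses.recip l f) := by
  rw [(hf.recip hl).1.irreducible_iff_natDegree']
  refine ⟨fun h1 => h.natDegree_pos.ne' ?_, fun a b ha hb hab hmem => ?_⟩
  · rw [← hf.natDegree_recip l, h1, natDegree_one]
  · have hr := hf.recip hl
    rw [← hab] at hr
    have ha' := hr.of_dvd ha (dvd_mul_right a b)
    have hb' := hr.of_dvd hb (dvd_mul_left b a)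
    have h2 := (hf.1.irreducible_iff_natDegree'.mp h).2 (RealClasses.recip l a)
      (RealClasses.recip l b) (ha'.recip hl).1 (hb'.recip hl).1
      (by rw [← recip_mul, hab, hf.recip_involutive hl])
    rw [hb'.natDegree_recip, ← hf.natDegree_recip l] at h2
    exact h2 hmem

/-- The relation between `recip l f` and inversion. -/
theorem MonicUnit.aeval_recip {A : Type*} [Ring A] [Algebra F A] {f : F[X]} (hf : MonicUnit f)
    (l : F) (T : Aˣ) :
    ((T : A) ^ f.natDegree) * aeval (algebraMap F A l * ((T⁻¹ : Aˣ) : A))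
      (RealClasses.recip l f) = ((f.coeff 0)⁻¹ * l ^ f.natDegree) • aeval (T : A) f := by
  rw [aeval_eq_sum_range, aeval_eq_sum_range, hf.natDegree_recip, Finset.mul_sum, Finset.smul_sum,
    ← Finset.sum_range_reflect]
  refine Finset.sum_congr rfl fun i hi => ?_
  have hi : i ≤ f.natDegree := by simpa [Nat.lt_succ_iff] using hi
  rw [show f.natDegree + 1 - 1 - i = f.natDegree - i by omega, hf.coeff_recip _ (Nat.sub_le _ _),
    Nat.sub_sub_self hi, (Algebra.commute_algebraMap_left l ((T⁻¹ : Aˣ) : A)).mul_pow, ← map_pow,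
    ← Algebra.smul_def, smul_smul, mul_smul_comm, smul_smul]
  have h1 : (T : A) ^ f.natDegree * ((T⁻¹ : Aˣ) : A) ^ (f.natDegree - i) = (T : A) ^ i := by
    rw [← Units.val_pow_eq_pow_val, ← Units.val_pow_eq_pow_val, ← Units.val_pow_eq_pow_val,
      ← Units.val_mul]
    congr 1
    rw [inv_pow, mul_inv_eq_iff_eq_mul, ← pow_add]
    congr 1; omega
  have h2 : l ^ f.natDegree = l ^ i * l ^ (f.natDegree - i) := by
    rw [← pow_add]; congr 1; omega
  rw [h1, h2]
  congr 1
  ring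

theorem rootProd_mul {f g : F[X]} (hf : f.Monic) (hg : g.Monic) :
    rootProd (f * g) = rootProd f * rootProd g := by
  rw [rootProd, hf.natDegree_mul hg, mul_coeff_zero, pow_add, rootProd, rootProd]
  ring

theorem rootProd_one : rootProd (1 : F[X]) = 1 := by simp [rootProd]

theorem rootProd_multiset_prod {P : Multiset F[X]} (h : ∀ f ∈ P, f.Monic) :
    rootProd P.prod = (P.map rootProd).prod := by
  induction P using Multiset.induction_on with
  | empty => simp [rootProd_one]
  | cons f P ih =>
    have h' : ∀ g ∈ P, g.Monic := fun g hg => h g (Multiset.mem_cons_of_mem hg)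
    rw [Multiset.prod_cons, rootProd_mul (h f (Multiset.mem_cons_self f P))
      (by simpa using monic_multiset_prod_of_monic P id (by simpa using h')),
      ih h', Multiset.map_cons, Multiset.prod_cons]

theorem MonicUnit.rootProd_recip {f : F[X]} (hf : MonicUnit f) (l : F) :
    rootProd (RealClasses.recip l f) = (rootProd f)⁻¹ * l ^ f.natDegree := by
  rw [rootProd, hf.natDegree_recip, hf.coeff_zero_recip, rootProd, mul_inv, ← mul_assoc,
    ← inv_pow, inv_neg, inv_one]

theorem rootProd_scaleRoots (f : F[X]) (l : F) :
    rootProd (f.scaleRoots l) = rootProd f * l ^ f.natDegree := by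
  rw [rootProd, natDegree_scaleRoots, coeff_scaleRoots, Nat.sub_zero, rootProd, mul_assoc]

theorem MonicUnit.rootProd_ne_zero {f : F[X]} (hf : MonicUnit f) : rootProd f ≠ 0 :=
  mul_ne_zero (pow_ne_zero _ (neg_ne_zero.mpr one_ne_zero)) hf.2

end Reciprocal

end RealClasses

namespace RealClasses

open Polynomial Module

/-! ### Invariants of invertible endomorphisms and determinants of conjugating maps -/

section Invariants

variable {F : Type*} [Field F] {V : Type*} [AddCommGroup V] [Module F V]

theorem ElemDiv.monicUnit {T : (End F V)ˣ} {k : ℕ} {p : Fin k → F[X]} {e : Fin k → ℕ}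
    (h : ElemDiv (T : End F V) p e) (j : Fin k) : MonicUnit (p j) := by
  classical
  refine ⟨(h.1 j).1, fun h0 => ?_⟩
  -- A prime with root zero is `X`, and an elementary divisor that is a power of `X` would give `T`
  -- a nonzero kernel.
  have hX : p j = X := eq_of_monic_of_associated (h.1 j).1 monic_X
    (irreducible_X.associated_of_dvd (h.1 j).2.1 (X_dvd_iff.mpr h0)).symm
  have hk := h.finrank_ker_succ monic_X irreducible_X 0
  have hker : LinearMap.ker (T : End F V) = ⊥ := by
    rw [LinearMap.ker_eq_bot']
    intro x hx
    have : ((T⁻¹ : (End F V)ˣ) : End F V) ((T : End F V) x) = x := by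
      rw [← Module.End.mul_apply, Units.inv_mul, Module.End.one_apply]
    rw [← this, hx, map_zero]
  rw [zero_add, pow_one, pow_zero, aeval_X, hker, finrank_bot, natDegree_X, mul_one] at hk
  have : 0 < (Finset.univ.filter fun j => 0 < e j ∧ p j = X).card :=
    Finset.card_pos.mpr ⟨j, by simp [(h.1 j).2.2, hX]⟩
  omega

theorem HasInv.monicUnit {T : (End F V)ˣ} {f : ℕ → F[X]} (h : HasInv (T : End F V) f) (i : ℕ) :
    MonicUnit (f i) := by
  obtain ⟨k, p, e, h, hf⟩ := h
  rw [hf]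
  refine MonicUnit.multiset_prod fun q hq => ?_
  obtain ⟨j, -, rfl⟩ := mem_factorsAt.mp hq
  exact h.monicUnit j

theorem ElemDiv.natDegree_prod {T : End F V} {k : ℕ} {p : Fin k → F[X]} {e : Fin k → ℕ}
    (h : ElemDiv T p e) (i : ℕ) :
    (factorsAt p e i).prod.natDegree = ∑ j with e j = i, (p j).natDegree := by
  rw [natDegree_multiset_prod_of_monic _ fun q hq => (h.mem_factorsAt hq).1, factorsAt,
    Multiset.map_map]
  rfl

theorem ElemDiv.rootProd_prod {T : End F V} {k : ℕ} {p : Fin k → F[X]} {e : Fin k → ℕ}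
    (h : ElemDiv T p e) (i : ℕ) :
    rootProd (factorsAt p e i).prod = ∏ j with e j = i, rootProd (p j) := by
  rw [rootProd_multiset_prod fun q hq => (h.mem_factorsAt hq).1, factorsAt, Multiset.map_map]
  rfl

theorem ElemDiv.mem_of_ne_one {T : End F V} {k : ℕ} {p : Fin k → F[X]} {e : Fin k → ℕ}
    (h : ElemDiv T p e) {f : ℕ → F[X]} (hf : ∀ i, f i = (factorsAt p e i).prod) {s : Finset ℕ}
    (hs : ∀ i ∉ s, f i = 1) (j : Fin k) : e j ∈ s := by
  by_contra hj
  have h1 := h.natDegree_prod (e j)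
  rw [← hf, hs _ hj, natDegree_one, eq_comm, Finset.sum_eq_zero_iff] at h1
  exact (h.1 j).2.1.natDegree_pos.ne' (h1 j (by simp))

theorem HasInv.det_eq {T : End F V} {f : ℕ → F[X]} (h : HasInv T f) {s : Finset ℕ}
    (hs : ∀ i ∉ s, f i = 1) : LinearMap.det T = ∏ i ∈ s, rootProd (f i) ^ i := by
  obtain ⟨k, p, e, h, hf⟩ := h
  obtain ⟨c, -, hc, hcT⟩ := h.exists_commute_det fun _ => X
  rw [← hcT fun _ => rfl, hc, ← Finset.prod_fiberwise_of_maps_to (t := s) (g := e)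
    fun j _ => h.mem_of_ne_one hf hs j]
  refine Finset.prod_congr rfl fun i _ => ?_
  rw [hf, h.rootProd_prod, ← Finset.prod_pow]
  exact Finset.prod_congr rfl fun j hj => by
    rw [(Finset.mem_filter.mp hj).2, det_lsmul_quot_X (h.1 j).1, rootProd]

/-- On one summand F[X]/(p_j^i) multiply by a polynomial whose norm modulo p_j is `a`, and act as
the identity elsewhere. -/
theorem HasInv.exists_commute_det [Finite F] {T : End F V} {f : ℕ → F[X]} (h : HasInv T f)
    {i : ℕ} (hi : f i ≠ 1) (a : F) : ∃ c : End F V, c * T = T * c ∧ LinearMap.det c = a ^ i := by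
  classical
  obtain ⟨k, p, e, h, hf⟩ := h
  obtain ⟨q, hq⟩ : ∃ q, q ∈ factorsAt p e i := by
    by_contra! hq
    exact hi (by rw [hf, Multiset.eq_zero_of_forall_notMem hq, Multiset.prod_zero])
  obtain ⟨j, hj, -⟩ := mem_factorsAt.mp hq
  obtain ⟨b, hb⟩ := exists_det_lsmul_quot (h.1 j).2.1 a
  obtain ⟨c, hc, hdet, -⟩ := h.exists_commute_det fun j' => if j' = j then b else 1
  refine ⟨c, hc, ?_⟩
  rw [hdet, Finset.prod_eq_single j]
  · rw [if_pos rfl, hb, hj]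
  · intro j' _ hj'
    rw [if_neg hj', map_one, map_one, one_pow]
  · simp

theorem commute_aeval {A : Type*} [Ring A] [Algebra F A] {a b : A} (h : Commute a b) (r : F[X]) :
    Commute a (aeval b r) := by
  rw [aeval_eq_sum_range]
  exact Commute.sum_right _ _ _ fun i _ => (h.pow_right i).smul_right _

theorem unit_apply_eq_zero (T : (End F V)ˣ) (x : V) : (T : End F V) x = 0 ↔ x = 0 := by
  refine ⟨fun hx => ?_, fun hx => by rw [hx, map_zero]⟩
  have : ((T⁻¹ : (End F V)ˣ) : End F V) ((T : End F V) x) = x := by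
    rw [← Module.End.mul_apply, Units.inv_mul, Module.End.one_apply]
  rw [← this, hx, map_zero]

/-- The invariants of `l • T⁻¹`. -/
theorem HasInv.recip [FiniteDimensional F V] {T T' : (End F V)ˣ} {f : ℕ → F[X]}
    (h : HasInv (T : End F V) f) {l : F} (hl : l ≠ 0)
    (hT : (T' : End F V) = algebraMap F (End F V) l * ((T⁻¹ : (End F V)ˣ) : End F V)) :
    HasInv (T' : End F V) fun i => RealClasses.recip l (f i) := by
  classical
  obtain ⟨k, p, e, h, hf⟩ := h
  obtain ⟨k', p', e', h'⟩ := exists_elemDiv (T' : End F V)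
  refine ⟨k', p', e', h', fun i => ?_⟩
  simp only [hf]
  rw [recip_multiset_prod]
  congr 1
  have key : ∀ q : F[X], MonicUnit q → Irreducible q →
      (factorsAt p e i).count q = (factorsAt p' e' i).count (RealClasses.recip l q) := by
    intro q hq hqi
    refine h.count_eq h' hq.1 hqi (hq.recip hl).1 (hq.irreducible_recip hl hqi)
      (hq.natDegree_recip l).symm fun s => ?_
    have h1 := hq.aeval_recip l T
    rw [← hT] at h1
    have hcomm : Commute ((T : End F V) ^ q.natDegree)
        (aeval (T' : End F V) (RealClasses.recip l q)) := by
      refine Commute.pow_left (commute_aeval ?_ _) _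
      rw [hT]
      exact (Algebra.commute_algebraMap_right l _).mul_right (by
        rw [commute_iff_eq, Units.mul_inv, Units.inv_mul])
    have h2 := congrArg (· ^ s) h1
    simp only [hcomm.mul_pow, _root_.smul_pow] at h2
    have hu : ((q.coeff 0)⁻¹ * l ^ q.natDegree) ^ s ≠ 0 :=
      pow_ne_zero _ (mul_ne_zero (inv_ne_zero hq.2) (pow_ne_zero _ hl))
    -- By `MonicUnit.aeval_recip` the two operators differ by a nonzero scalar and a power of the
    -- invertible `T`, so their kernels coincide.
    suffices LinearMap.ker (aeval (T : End F V) q ^ s) =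
        LinearMap.ker (aeval (T' : End F V) (RealClasses.recip l q) ^ s) by rw [this]
    ext x
    rw [LinearMap.mem_ker, LinearMap.mem_ker]
    have h3 := congrArg (fun g : End F V => g x) h2
    simp only [Module.End.mul_apply, LinearMap.smul_apply] at h3
    rw [← smul_eq_zero_iff_right hu, ← h3, ← Units.val_pow_eq_pow_val, ← Units.val_pow_eq_pow_val,
      unit_apply_eq_zero]
  ext q
  by_cases hq : MonicUnit q ∧ Irreducible q
  · have h1 := key _ (hq.1.recip hl) (hq.1.irreducible_recip hl hq.2)
    rw [hq.1.recip_involutive hl] at h1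
    rw [← h1, Multiset.count_map, Multiset.count_eq_card_filter_eq]
    congr 1
    refine Multiset.filter_congr fun r hr => ?_
    obtain ⟨j, -, rfl⟩ := mem_factorsAt.mp hr
    constructor
    · rintro rfl
      rw [(h.monicUnit j).recip_involutive hl]
    · intro h2
      rw [← h2, hq.1.recip_involutive hl]
  · rw [Multiset.count_eq_zero_of_notMem, Multiset.count_eq_zero_of_notMem]
    · intro hm
      obtain ⟨j, -, rfl⟩ := mem_factorsAt.mp hm
      exact hq ⟨h'.monicUnit j, (h'.1 j).2.1⟩
    · intro hm
      obtain ⟨r, hr, rfl⟩ := Multiset.mem_map.mp hm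
      obtain ⟨j, -, rfl⟩ := mem_factorsAt.mp hr
      exact hq ⟨(h.monicUnit j).recip hl, (h.monicUnit j).irreducible_recip hl (h.1 j).2.1⟩

theorem sum_range_sub_succ (e m : ℕ) (h : e ≤ m) :
    ∑ t ∈ Finset.range m, (e - (t + 1)) = e * (e - 1) / 2 := by
  obtain ⟨d, rfl⟩ := Nat.exists_eq_add_of_le h
  rw [Finset.sum_range_add, Finset.sum_eq_zero (s := Finset.range d) fun t _ => by omega,
    add_zero, ← Finset.sum_range_id, ← Finset.sum_range_reflect (fun t => t)]
  exact Finset.sum_congr rfl fun t _ => by omega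

/-- A prime divisor `≠ X` of degree dividing `M` divides `X ^ (2 * (q ^ M - 1)) - 1` once. -/
theorem exists_eq_mul_of_irreducible [Finite F] (hq : Odd (Nat.card F)) {p : F[X]}
    (hp : Irreducible p) (hp0 : MonicUnit p) {M : ℕ} (hM : M ≠ 0) (hpM : p.natDegree ∣ M) :
    ∃ w, (X ^ (2 * (Nat.card F ^ M - 1)) - 1 : F[X]) = p * w ∧ IsCoprime w p := by
  have := Fintype.ofFinite F
  have hchar : ringChar F ≠ 2 := fun h => by
    have := FiniteField.even_card_iff_char_two.mp h
    rw [Nat.card_eq_fintype_card, Nat.odd_iff] at hq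
    omega
  -- The exponent equals -2 in `F`, nonzero in odd characteristic; hence the polynomial is separable
  -- and each prime divides it at most once.
  have h0 : ((2 * (Nat.card F ^ M - 1) : ℕ) : F) ≠ 0 := by
    have h1 : ((Nat.card F ^ M : ℕ) : F) = 0 := by
      rw [Nat.cast_pow, Nat.card_eq_fintype_card, Nat.cast_card_eq_zero, zero_pow hM]
    rw [Nat.cast_mul, Nat.cast_sub (Nat.one_le_pow _ _ Nat.card_pos), h1]
    simpa using Ring.two_ne_zero hchar
  have hsep : (X ^ (2 * (Nat.card F ^ M - 1)) - 1 : F[X]).Separable := by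
    rw [← C_1]; exact separable_X_pow_sub_C 1 h0 one_ne_zero
  have hpX : ¬ p ∣ X := fun hd => by
    have := eq_of_monic_of_associated hp0.1 monic_X (hp.associated_of_dvd irreducible_X hd)
    exact hp0.2 (by rw [this, coeff_X_zero])
  have h1 := (hp.natDegree_dvd_iff_dvd_X_pow_card_pow_sub_X (n := M)).mp hpM
  have h2 : (X ^ Nat.card F ^ M - X : F[X]) = X * (X ^ (Nat.card F ^ M - 1) - 1) := by
    rw [mul_sub, ← pow_succ', mul_one, Nat.sub_add_cancel (Nat.one_le_pow _ _ Nat.card_pos)]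
  rw [h2] at h1
  have h3 := (hp.prime.dvd_or_dvd h1).resolve_left hpX
  obtain ⟨w, hw⟩ : p ∣ X ^ (2 * (Nat.card F ^ M - 1)) - 1 := by
    rw [mul_comm 2, pow_mul]
    exact h3.trans (sub_one_dvd_pow_sub_one _ _)
  rw [hw] at hsep
  exact ⟨w, hw, hsep.isCoprime.symm⟩

/-- If `h` conjugates `T ^ m` to `T ^ (± m)` then its determinant is a `k`-th power up to an
explicit sign, where `k` divides all `i` with `f i ≠ 1`. -/
theorem HasInv.exists_det_eq_pow [Finite F] [FiniteDimensional F V] (hq : Odd (Nat.card F))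
    {T : (End F V)ˣ} {f : ℕ → F[X]} (hT : HasInv (T : End F V) f) {s : Finset ℕ}
    (hs : ∀ i ∉ s, f i = 1) {k : ℕ} (hk : ∀ i, f i ≠ 1 → k ∣ i) (hk0 : 0 < k) :
    ∃ m : ℕ, Nat.card F - 1 ∣ m ∧ ∀ (h : End F V) (ε : F), ε * ε = 1 →
      h * (((T ^ m : (End F V)ˣ) : End F V) - ((T ^ m)⁻¹ : (End F V)ˣ)) =
        ε • ((((T ^ m : (End F V)ˣ) : End F V) - ((T ^ m)⁻¹ : (End F V)ˣ)) * h) →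
      ∃ y, LinearMap.det h = ε ^ (∑ i ∈ s, (f i).natDegree * (i * (i - 1) / 2)) * y ^ k := by
  obtain ⟨r, p, e, hpe, hf⟩ := hT
  have hdim := hpe.finrank_eq
  set n := finrank F V with hn
  have hle : ∀ j, e j * (p j).natDegree ≤ n := fun j => by
    rw [hdim]
    exact Finset.single_le_sum (f := fun j => e j * (p j).natDegree) (fun _ _ => Nat.zero_le _)
      (Finset.mem_univ j)
  have hdeg : ∀ j, 0 < (p j).natDegree := fun j => (hpe.1 j).2.1.natDegree_pos
  have hdn : ∀ j, (p j).natDegree ≤ n := fun j => by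
    refine le_trans ?_ (hle j)
    exact Nat.le_mul_of_pos_left _ (hpe.1 j).2.2
  have hen : ∀ j, e j ≤ n := fun j => (Nat.le_mul_of_pos_right _ (hdeg j)).trans (hle j)
  -- All degrees of the `p j` are at most `n` and so divide `n!`. Thus every eigenvalue α satisfies
  -- α^m = 1, and T^m - T^(-m) is nilpotent. Divisibility of `m` by q - 1 later makes scalar factors
  -- disappear in m-th powers.
  set m := Nat.card F ^ n.factorial - 1 with hm
  refine ⟨m, by simpa using Nat.sub_dvd_pow_sub_pow (Nat.card F) 1 n.factorial,
    fun h ε hε hN => ?_⟩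
  set N : End F V := ((T ^ m : (End F V)ˣ) : End F V) - ((T ^ m)⁻¹ : (End F V)ˣ) with hNdef
  have hNA : N = (((T ^ m)⁻¹ : (End F V)ˣ) : End F V) *
      aeval (T : End F V) (X ^ (2 * m) - 1 : F[X]) := by
    rw [map_sub, map_pow, aeval_X, map_one, mul_sub, mul_one, two_mul, pow_add,
      ← Units.val_pow_eq_pow_val, ← mul_assoc, Units.inv_mul, one_mul]
  have hcomm : Commute (((T ^ m)⁻¹ : (End F V)ˣ) : End F V)
      (aeval (T : End F V) (X ^ (2 * m) - 1 : F[X])) := by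
    refine commute_aeval ?_ _
    rw [← inv_pow, Units.val_pow_eq_pow_val]
    exact Commute.pow_left (by rw [commute_iff_eq, Units.mul_inv, Units.inv_mul]) _
  -- `N` is a unit times X^(2m) - 1 evaluated at `T`, which every `p j` divides exactly once. So `N`
  -- behaves as if it had `deg p j` Jordan blocks of size `e j` for each `j`.
  have hker : ∀ t, finrank F (LinearMap.ker (N ^ t)) = ∑ j, min t (e j) * (p j).natDegree := by
    intro t
    have h1 := hpe.finrank_ker_pow (a := X ^ (2 * m) - 1) (fun _ => True)
      (fun j _ => exists_eq_mul_of_irreducible hq (hpe.1 j).2.1 (hpe.monicUnit j)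
        (Nat.factorial_ne_zero n) (Nat.dvd_factorial (hdeg j) (hdn j)))
      (fun j hj => absurd trivial hj) t
    simp only [if_true] at h1
    rw [← h1]
    suffices LinearMap.ker (N ^ t) =
        LinearMap.ker (aeval (T : End F V) (X ^ (2 * m) - 1 : F[X]) ^ t) by rw [this]
    ext x
    rw [LinearMap.mem_ker, LinearMap.mem_ker, hNA, hcomm.mul_pow, Module.End.mul_apply,
      ← Units.val_pow_eq_pow_val, unit_apply_eq_zero]
  have hL : N ^ (k * n) = 0 := by
    rw [← LinearMap.ker_eq_top]
    apply Submodule.eq_top_of_finrank_eq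
    rw [hker, ← hn]
    refine Eq.trans (Finset.sum_congr rfl fun j _ => ?_) hdim.symm
    rw [min_eq_right ((hen j).trans (Nat.le_mul_of_pos_left n hk0))]
  have hdvd : ∀ j, k ∣ e j := fun j => by
    refine hk _ fun h1 => ?_
    have h2 := hpe.natDegree_prod (e j)
    rw [← hf, h1, natDegree_one, eq_comm, Finset.sum_eq_zero_iff] at h2
    exact (hdeg j).ne' (h2 j (by simp))
  obtain ⟨y, hy⟩ := RealClasses.exists_det_eq_pow (h := h) (N := N) (ε := ε) (fun x => by
    have := congrArg (fun g : End F V => g x) hN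
    simpa using this) hε (k := k) (L := n) hL (fun t ht => by
      simp only [hker, ← Finset.sum_add_distrib]
      refine Finset.sum_congr rfl fun j _ => ?_
      rw [← add_mul, ← add_mul]
      congr 1
      have : e j ≠ t + 1 := fun h1 => ht (h1 ▸ hdvd j)
      omega)
  refine ⟨y, ?_⟩
  rw [hy]
  congr 2
  -- The subtraction is truncated. Summing over t ≥ 1, a block of size e contributes (e-1) + (e-2) +
  -- ⋯ = e(e-1)/2 to the exponent of `ε`.
  have hrank : ∀ t, finrank F (LinearMap.range (N ^ t)) = ∑ j, (e j - t) * (p j).natDegree := by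
    intro t
    have h1 := LinearMap.finrank_range_add_finrank_ker (N ^ t)
    rw [hker, ← hn, hdim] at h1
    have h2 : ∑ j, (e j - t) * (p j).natDegree + ∑ j, min t (e j) * (p j).natDegree =
        ∑ j, e j * (p j).natDegree := by
      rw [← Finset.sum_add_distrib]
      refine Finset.sum_congr rfl fun j _ => ?_
      rw [← add_mul]
      congr 1
      omega
    omega
  simp only [hrank]
  rw [Finset.sum_comm, ← Finset.sum_fiberwise_of_maps_to (t := s) (g := e)
    fun j _ => hpe.mem_of_ne_one hf hs j]
  refine Finset.sum_congr rfl fun i _ => ?_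
  rw [hf, hpe.natDegree_prod, Finset.sum_mul]
  refine Finset.sum_congr rfl fun j hj => ?_
  rw [← Finset.sum_mul, sum_range_sub_succ _ _ ((hen j).trans (Nat.le_mul_of_pos_left n hk0)),
    (Finset.mem_filter.mp hj).2, mul_comm]

end Invariants

end RealClasses

namespace RealClasses

open Polynomial Module

/-! ### Multiplicities and gcds of parts -/

section Partitions

variable {n : ℕ}

theorem mult_zero (ν : n.Partition) : mult ν 0 = 0 :=
  Multiset.count_eq_zero_of_notMem fun h => (ν.parts_pos h).ne' rfl

theorem mem_parts_iff (ν : n.Partition) (i : ℕ) : i ∈ ν.parts.toFinset ↔ 0 < mult ν i := by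
  rw [Multiset.mem_toFinset, mult, Multiset.count_pos]

theorem sum_mult (ν : n.Partition) : ∑ i ∈ ν.parts.toFinset, i * mult ν i = n := by
  conv_rhs => rw [← ν.parts_sum, Finset.sum_multiset_count]
  exact Finset.sum_congr rfl fun i _ => by rw [mult, smul_eq_mul, mul_comm]

theorem gcd_parts_pos (ν : n.Partition) (hn : n ≠ 0) : 0 < ν.parts.gcd := by
  refine Nat.pos_of_ne_zero fun h0 => hn ?_
  rw [Multiset.gcd_eq_zero_iff] at h0
  rw [← ν.parts_sum, Multiset.sum_eq_zero h0]

theorem hNu_dvd (q : ℕ) (ν : n.Partition) {i : ℕ} (hi : 0 < mult ν i) : hNu q ν ∣ i :=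
  (Nat.gcd_dvd_right _ _).trans (Multiset.gcd_dvd (Multiset.count_pos.mp hi))

theorem hNu_pos (q : ℕ) (ν : n.Partition) (hn : n ≠ 0) : 0 < hNu q ν :=
  Nat.gcd_pos_of_pos_right _ (gcd_parts_pos ν hn)

end Partitions

/-! ### Invariants, types and determinants of invertible matrices -/

section Matrices

variable {F : Type*} [Field F] {n : ℕ}

/-- The family `f` is of type `ν`: all `f i` are monic without the root zero, and of degree
`mult ν i`. -/
def IsTuple (ν : n.Partition) (f : ℕ → F[X]) : Prop :=
  ∀ i, MonicUnit (f i) ∧ (f i).natDegree = mult ν i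

/-- The invariant polynomials of an invertible matrix. -/
def MatInv (g : GL (Fin n) F) (f : ℕ → F[X]) : Prop :=
  HasInv (Matrix.toLin' (g : Matrix (Fin n) (Fin n) F)) f

/-- An invertible matrix as a unit of the ring of endomorphisms. -/
noncomputable def toUnit : GL (Fin n) F →* (End F (Fin n → F))ˣ :=
  Units.map (Matrix.toLinAlgEquiv' (R := F) (n := Fin n)).toMonoidHom

theorem coe_toUnit (g : GL (Fin n) F) :
    (toUnit g : End F (Fin n → F)) = Matrix.toLin' (g : Matrix (Fin n) (Fin n) F) := rfl

theorem toUnit_scalar (l : Fˣ) :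
    (toUnit (Matrix.GeneralLinearGroup.scalar (Fin n) l) : End F (Fin n → F)) =
      algebraMap F _ (l : F) := by
  refine LinearMap.ext fun x => ?_
  rw [coe_toUnit]
  ext i
  simp [Module.algebraMap_end_apply]

theorem det_toUnit (g : GL (Fin n) F) :
    LinearMap.det (toUnit g : End F (Fin n → F)) = (Matrix.GeneralLinearGroup.det g : F) := by
  rw [coe_toUnit, LinearMap.det_toLin']
  rfl

theorem toUnit_surjective (c : End F (Fin n → F)) (hc : LinearMap.det c ≠ 0) :
    ∃ g : GL (Fin n) F, (toUnit g : End F (Fin n → F)) = c := by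
  have : IsUnit (LinearMap.toMatrix' c).det := by
    rw [LinearMap.det_toMatrix']; exact hc.isUnit
  refine ⟨Matrix.GeneralLinearGroup.mk'' (LinearMap.toMatrix' c) this, ?_⟩
  rw [coe_toUnit]
  exact Matrix.toLin'_toMatrix' c

theorem toUnit_injective {g h : GL (Fin n) F}
    (H : (toUnit g : End F (Fin n → F)) = (toUnit h : End F (Fin n → F))) : g = h :=
  Units.ext (Matrix.toLin'.injective H)

theorem MatInv.unique {g : GL (Fin n) F} {f f' : ℕ → F[X]} (h : MatInv g f) (h' : MatInv g f') :
    f = f' := HasInv.unique h h'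

theorem exists_matInv (g : GL (Fin n) F) : ∃ f, MatInv g f := exists_hasInv _

theorem MatInv.monicUnit {g : GL (Fin n) F} {f : ℕ → F[X]} (h : MatInv g f) (i : ℕ) :
    MonicUnit (f i) := HasInv.monicUnit (T := toUnit g) h i

theorem MatInv.exists_conj {g g' : GL (Fin n) F} {f : ℕ → F[X]} (h : MatInv g f)
    (h' : MatInv g' f) : ∃ b, b * g * b⁻¹ = g' := by
  obtain ⟨Φ, hΦ⟩ := HasInv.exists_conj h h'
  obtain ⟨b, hb⟩ := toUnit_surjective Φ.toLinearMap Φ.isUnit_det'.ne_zero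
  refine ⟨b, ?_⟩
  rw [mul_inv_eq_iff_eq_mul]
  apply toUnit_injective
  rw [map_mul, map_mul, Units.val_mul, Units.val_mul, hb]
  exact LinearMap.ext hΦ

theorem MatInv.conj {g : GL (Fin n) F} {f : ℕ → F[X]} (h : MatInv g f) (b : GL (Fin n) F) :
    MatInv (b * g * b⁻¹) f := by
  refine HasInv.of_conj (T' := toUnit (b * g * b⁻¹)) h
    (LinearMap.GeneralLinearGroup.generalLinearEquiv F _ (toUnit b)) fun x => ?_
  have : (toUnit b : End F (Fin n → F)) * toUnit g = toUnit (b * g * b⁻¹) * toUnit b := by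
    rw [← Units.val_mul, ← Units.val_mul, ← map_mul, ← map_mul]
    simp
  exact congrArg (fun T : End F (Fin n → F) => T x) this

theorem MatInv.scalar_mul_inv {g : GL (Fin n) F} {f : ℕ → F[X]} (h : MatInv g f) (l : Fˣ) :
    MatInv (Matrix.GeneralLinearGroup.scalar (Fin n) l * g⁻¹) fun i => recip (l : F) (f i) :=
  HasInv.recip (T := toUnit g) (T' := toUnit (Matrix.GeneralLinearGroup.scalar (Fin n) l * g⁻¹))
    h l.ne_zero (by rw [map_mul, Units.val_mul, toUnit_scalar, map_inv])

theorem MatInv.scalar_mul {g : GL (Fin n) F} {f : ℕ → F[X]} (h : MatInv g f) (l : Fˣ) :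
    MatInv (Matrix.GeneralLinearGroup.scalar (Fin n) l * g) fun i => (f i).scaleRoots (l : F) := by
  -- Scaling is a composite of two inversions: l g = l (g⁻¹)⁻¹.
  have h1 := (h.scalar_mul_inv 1).scalar_mul_inv l
  have h2 : (fun i => recip (l : F) (recip ((1 : Fˣ) : F) (f i))) =
      fun i => (f i).scaleRoots (l : F) := by
    funext i
    rw [(h.monicUnit i).recip_recip (Units.ne_zero 1), Units.val_one, div_one]
  rw [h2] at h1
  simpa using h1

theorem hasType_iff {g : GL (Fin n) F} {ν : n.Partition} :
    HasType g ν ↔ ∃ f, MatInv g f ∧ IsTuple ν f := by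
  classical
  have key : ∀ {k : ℕ} {p : Fin k → F[X]} {e : Fin k → ℕ},
      ElemDiv (Matrix.toLin' (g : Matrix (Fin n) (Fin n) F)) p e →
      (ν.parts = ∑ j, Multiset.replicate (p j).natDegree (e j) ↔
        ∀ i, (factorsAt p e i).prod.natDegree = mult ν i) := by
    intro k p e h
    rw [Multiset.ext]
    refine forall_congr' fun i => ?_
    rw [h.natDegree_prod, Multiset.count_sum', mult, Finset.sum_filter, eq_comm]
    simp only [Multiset.count_replicate]
  constructor
  · rintro ⟨k, p, e, hp, ⟨Φ⟩, hν⟩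
    have h : ElemDiv (Matrix.toLin' (g : Matrix (Fin n) (Fin n) F)) p e :=
      ⟨hp, ⟨Φ.trans (DirectSum.linearEquivFunOnFintype F[X] (Fin k) _)⟩⟩
    have hinv : MatInv g fun i => (factorsAt p e i).prod := ⟨k, p, e, h, fun i => rfl⟩
    exact ⟨_, hinv, fun i => ⟨hinv.monicUnit i, (key h).mp hν i⟩⟩
  · rintro ⟨f, ⟨k, p, e, h, hf⟩, ht⟩
    have hν := (key h).mpr fun i => by rw [← hf]; exact (ht i).2
    obtain ⟨hp, ⟨Φ⟩⟩ := h
    exact ⟨k, p, e, hp, ⟨Φ.trans (DirectSum.linearEquivFunOnFintype F[X] (Fin k) _).symm⟩, hν⟩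

theorem exists_isTuple {g : GL (Fin n) F} {f : ℕ → F[X]} (h : MatInv g f) :
    ∃ ν : n.Partition, IsTuple ν f := by
  classical
  have hmon := h.monicUnit
  obtain ⟨k, p, e, h, hf⟩ := h
  have hsum := h.finrank_eq
  rw [finrank_fin_fun] at hsum
  refine ⟨⟨∑ j, Multiset.replicate (p j).natDegree (e j), ?_, ?_⟩, fun i => ⟨hmon i, ?_⟩⟩
  · intro i hi
    obtain ⟨j, -, hj⟩ := Multiset.mem_sum.mp hi
    rw [Multiset.eq_of_mem_replicate hj]
    exact (h.1 j).2.2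
  · rw [hsum, Multiset.sum_sum]
    exact Finset.sum_congr rfl fun j _ => by
      rw [Multiset.sum_replicate, smul_eq_mul, mul_comm]
  · rw [hf, h.natDegree_prod, mult, Multiset.count_sum', Finset.sum_filter]
    simp only [Multiset.count_replicate]

theorem IsTuple.type_unique {ν ν' : n.Partition} {f : ℕ → F[X]} (h : IsTuple ν f)
    (h' : IsTuple ν' f) : ν = ν' := by
  refine Nat.Partition.ext (Multiset.ext.mpr fun i => ?_)
  exact (h i).2.symm.trans (h' i).2

theorem IsTuple.eq_one {ν : n.Partition} {f : ℕ → F[X]} (h : IsTuple ν f) :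
    ∀ i ∉ ν.parts.toFinset, f i = 1 := by
  intro i hi
  rw [mem_parts_iff, not_lt, Nat.le_zero] at hi
  exact (h i).1.1.natDegree_eq_zero.mp ((h i).2.trans hi)

theorem IsTuple.mult_pos {ν : n.Partition} {f : ℕ → F[X]} (h : IsTuple ν f) {i : ℕ}
    (hi : f i ≠ 1) : 0 < mult ν i := by
  rw [← mem_parts_iff]
  by_contra h'
  exact hi (h.eq_one i h')

theorem IsTuple.exists_matInv {ν : n.Partition} {f : ℕ → F[X]} (h : IsTuple ν f) :
    ∃ g : GL (Fin n) F, MatInv g f := by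
  obtain ⟨T, hT⟩ := exists_hasInv_of_sum (V := Fin n → F) f (fun i => (h i).1.1)
    ((h 0).1.1.natDegree_eq_zero.mp ((h 0).2.trans (mult_zero ν))) n (fun i hi => by
      refine h.eq_one i fun hi' => ?_
      have := Multiset.le_sum_of_mem (Multiset.mem_toFinset.mp hi')
      rw [ν.parts_sum] at this
      omega) (by
      rw [finrank_fin_fun]
      rw [← Finset.sum_subset (s₁ := ν.parts.toFinset)]
      · exact (sum_mult ν).symm.trans (Finset.sum_congr rfl fun i _ => by rw [(h i).2])
      · intro i hi
        have := Multiset.le_sum_of_mem (Multiset.mem_toFinset.mp hi)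
        rw [ν.parts_sum] at this
        exact Finset.mem_range_succ_iff.mpr this
      · intro i _ hi
        rw [h.eq_one i hi, natDegree_one, mul_zero])
  obtain ⟨g, hg⟩ := toUnit_surjective T (by
    rw [hT.det_eq h.eq_one]
    exact Finset.prod_ne_zero_iff.mpr fun i _ => pow_ne_zero _ (h i).1.rootProd_ne_zero)
  exact ⟨g, by rwa [MatInv, ← coe_toUnit, hg]⟩

theorem MatInv.det_eq {g : GL (Fin n) F} {ν : n.Partition} {f : ℕ → F[X]} (h : MatInv g f)
    (hf : IsTuple ν f) : (Matrix.GeneralLinearGroup.det g : F) =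
      ∏ i ∈ ν.parts.toFinset, rootProd (f i) ^ i := by
  rw [← det_toUnit]
  exact HasInv.det_eq h hf.eq_one

theorem pow_gcd_mem {G : Type*} [Group G] {K : Subgroup G} {a : G} {i j : ℕ} (hi : a ^ i ∈ K)
    (hj : a ^ j ∈ K) : a ^ i.gcd j ∈ K := by
  rw [← zpow_natCast, Nat.gcd_eq_gcd_ab, zpow_add, zpow_mul, zpow_mul, zpow_natCast, zpow_natCast]
  exact K.mul_mem (K.zpow_mem hi _) (K.zpow_mem hj _)

theorem pow_multiset_gcd_mem {G : Type*} [Group G] {K : Subgroup G} {a : G} {P : Multiset ℕ}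
    (h : ∀ i ∈ P, a ^ i ∈ K) : a ^ P.gcd ∈ K := by
  induction P using Multiset.induction_on with
  | empty => simp
  | cons i P ih =>
    rw [Multiset.gcd_cons]
    exact pow_gcd_mem (h i (Multiset.mem_cons_self i P))
      (ih fun j hj => h j (Multiset.mem_cons_of_mem hj))

variable [Finite F]

/-- The determinants of the centralizer of `g` form a subgroup. It contains `a ^ i` for every part
`i` and, trivially, `a ^ (q - 1) = 1`; Bézout then yields the exponent `hNu`, the gcd of all of
these. -/
theorem MatInv.exists_commute_det {g : GL (Fin n) F} {ν : n.Partition} {f : ℕ → F[X]}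
    (h : MatInv g f) (hf : IsTuple ν f) (a : Fˣ) :
    ∃ c : GL (Fin n) F, c * g = g * c ∧
      Matrix.GeneralLinearGroup.det c = a ^ hNu (Nat.card F) ν := by
  classical
  let K : Subgroup Fˣ := (Subgroup.centralizer {g}).map Matrix.GeneralLinearGroup.det
  have h1 : ∀ i ∈ ν.parts, a ^ i ∈ K := by
    intro i hi
    obtain ⟨c, hc, hdet⟩ := HasInv.exists_commute_det h (i := i) (fun h1 => by
      have := (hf i).2
      rw [h1, natDegree_one, mult, eq_comm, Multiset.count_eq_zero] at this
      exact this hi) (a : F)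
    obtain ⟨c, rfl⟩ := toUnit_surjective c (by rw [hdet]; exact pow_ne_zero _ a.ne_zero)
    refine ⟨c, ?_, ?_⟩
    · rw [SetLike.mem_coe, Subgroup.mem_centralizer_singleton_iff]
      apply toUnit_injective
      rw [map_mul, map_mul, Units.val_mul, Units.val_mul]
      exact hc
    · rw [det_toUnit] at hdet
      exact Units.ext (by rw [hdet]; simp)
  have h2 : a ^ hNu (Nat.card F) ν ∈ K := by
    refine pow_gcd_mem ?_ (pow_multiset_gcd_mem h1)
    rw [← Nat.card_units, pow_card_eq_one']
    exact K.one_mem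
  obtain ⟨c, hc, hdet⟩ := h2
  exact ⟨c, Subgroup.mem_centralizer_singleton_iff.mp hc, hdet⟩

/-- The exponent of the sign in the determinant of a matrix inverting a matrix of type `ν`. -/
def signExp (ν : n.Partition) : ℕ := ∑ i ∈ ν.parts.toFinset, mult ν i * (i * (i - 1) / 2)

/-- Both halves come from the nilpotent map g^m - g^(-m): since l^m = 1, `b` conjugates g^m to g^m
or to g^(-m), so it commutes with that map up to the sign 1 or -1. The first half governs the
splitting of classes, the second reality. -/
theorem MatInv.exists_det_eq_pow (hq : Odd (Nat.card F)) (hn : n ≠ 0) {g : GL (Fin n) F}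
    {ν : n.Partition} {f : ℕ → F[X]} (h : MatInv g f) (hf : IsTuple ν f) (b : GL (Fin n) F)
    (l : Fˣ) :
    (b * g * b⁻¹ = Matrix.GeneralLinearGroup.scalar (Fin n) l * g →
      ∃ y : Fˣ, Matrix.GeneralLinearGroup.det b = y ^ hNu (Nat.card F) ν) ∧
    (b * g * b⁻¹ = Matrix.GeneralLinearGroup.scalar (Fin n) l * g⁻¹ →
      ∃ y : Fˣ, Matrix.GeneralLinearGroup.det b =
        (-1) ^ signExp ν * y ^ hNu (Nat.card F) ν) := by
  have hk0 := hNu_pos (Nat.card F) ν hn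
  obtain ⟨m, ⟨r, hr⟩, H⟩ := HasInv.exists_det_eq_pow (T := toUnit g) hq h hf.eq_one
    (k := hNu (Nat.card F) ν) (fun i hi => hNu_dvd _ ν (hf.mult_pos hi)) hk0
  have hl : l ^ m = 1 := by
    rw [hr, pow_mul, ← Nat.card_units, pow_card_eq_one', one_pow]
  have hdet : LinearMap.det (toUnit b : End F (Fin n → F)) ≠ 0 := by
    rw [det_toUnit]; exact Units.ne_zero _
  have hS : ∑ i ∈ ν.parts.toFinset, (f i).natDegree * (i * (i - 1) / 2) = signExp ν :=
    Finset.sum_congr rfl fun i _ => by rw [(hf i).2]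
  rw [hS] at H
  have lift : ∀ (ε : Fˣ), (∃ y : F, LinearMap.det (toUnit b : End F (Fin n → F)) =
      (ε : F) ^ signExp ν * y ^ hNu (Nat.card F) ν) →
      ∃ y : Fˣ, Matrix.GeneralLinearGroup.det b = ε ^ signExp ν * y ^ hNu (Nat.card F) ν := by
    rintro ε ⟨y, hy⟩
    have hy0 : y ≠ 0 := fun h0 => hdet (by rw [hy, h0, zero_pow hk0.ne', mul_zero])
    refine ⟨Units.mk0 y hy0, Units.ext ?_⟩
    rw [← det_toUnit, hy]
    simp
  have hpow : ∀ x : GL (Fin n) F, b * g * b⁻¹ = Matrix.GeneralLinearGroup.scalar (Fin n) l * x →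
      b * g ^ m = x ^ m * b := by
    intro x hx
    have h1 := congrArg (· ^ m) hx
    rw [(show Commute _ x from Matrix.GeneralLinearGroup.scalar_commute l x).mul_pow, ← map_pow, hl, map_one, one_mul,
      conj_pow] at h1
    rw [← h1, inv_mul_cancel_right]
  constructor
  · intro hb
    have h1 := hpow g hb
    have h2 : b * (g ^ m)⁻¹ = (g ^ m)⁻¹ * b := by
      rw [mul_inv_eq_iff_eq_mul, mul_assoc, h1, inv_mul_cancel_left]
    have := lift 1 (H _ _ (by simp) ?_)
    · simpa using this
    · rw [Units.val_one, one_smul, mul_sub, sub_mul, ← Units.val_mul, ← Units.val_mul,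
        ← Units.val_mul, ← Units.val_mul, ← map_pow, ← map_inv, ← map_mul, ← map_mul, ← map_mul,
        ← map_mul, h1, h2]
  · intro hb
    have h1 : b * g ^ m = (g ^ m)⁻¹ * b := by rw [hpow g⁻¹ hb, inv_pow]
    have h2 : b * (g ^ m)⁻¹ = g ^ m * b := by
      rw [mul_inv_eq_iff_eq_mul, mul_assoc, h1, mul_inv_cancel_left]
    refine lift (-1) (H _ _ (by simp) ?_)
    have hneg : ∀ Y : End F (Fin n → F), (-1 : F) • Y = -Y := fun Y =>
      LinearMap.ext fun x => by rw [LinearMap.smul_apply, LinearMap.neg_apply, neg_one_smul]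
    rw [Units.val_neg, Units.val_one, hneg, mul_sub, sub_mul, ← Units.val_mul,
      ← Units.val_mul, ← Units.val_mul, ← Units.val_mul, ← map_pow, ← map_inv, ← map_mul,
      ← map_mul, ← map_mul, ← map_mul, h1, h2, neg_sub]

end Matrices

end RealClasses

namespace RealClasses

open Polynomial Module Matrix Matrix.ProjGenLinGroup

/-! ### Classes and real classes of PSL inside PGL -/

section Projective

variable {F : Type*} [Field F] {n : ℕ}

local notation "PSLF" => Matrix.ProjectiveSpecialLinearGroup (Fin n) F
local notation "PGLF" => Matrix.ProjGenLinGroup (Fin n) F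

theorem mem_range_toPGL {x : PGLF} :
    x ∈ (ProjectiveSpecialLinearGroup.toPGL (n := Fin n) (R := F)).range ↔
      ∃ b : GL (Fin n) F, GeneralLinearGroup.det b = 1 ∧ mk b = x := by
  constructor
  · rintro ⟨y, rfl⟩
    obtain ⟨s, rfl⟩ := QuotientGroup.mk_surjective y
    exact ⟨SpecialLinearGroup.toGL s, SpecialLinearGroup.coeToGL_det s, rfl⟩
  · rintro ⟨b, hb, rfl⟩
    have hb' : (b : Matrix (Fin n) (Fin n) F).det = 1 := congrArg Units.val hb
    let s : SpecialLinearGroup (Fin n) F := ⟨b, hb'⟩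
    have hs : SpecialLinearGroup.toGL s = b := Units.ext rfl
    exact ⟨QuotientGroup.mk s, (ProjectiveSpecialLinearGroup.toPGL_mk s).trans (by rw [hs])⟩

theorem conj_mem_range_toPGL {x : PGLF} (c : PGLF)
    (hx : x ∈ (ProjectiveSpecialLinearGroup.toPGL (n := Fin n) (R := F)).range) :
    c * x * c⁻¹ ∈ (ProjectiveSpecialLinearGroup.toPGL (n := Fin n) (R := F)).range := by
  obtain ⟨b, hb, rfl⟩ := mem_range_toPGL.mp hx
  obtain ⟨c, rfl⟩ := mk_surjective c
  refine mem_range_toPGL.mpr ⟨c * b * c⁻¹, ?_, by simp⟩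
  rw [map_mul, map_mul, hb, map_inv]
  simp

theorem mk_eq_mk_iff_scalar {g g' : GL (Fin n) F} :
    (mk g : PGLF) = mk g' ↔ ∃ l : Fˣ, g = GeneralLinearGroup.scalar (Fin n) l * g' := by
  rw [eq_comm, mk_eq_mk_iff]
  exact exists_congr fun l => by rw [GeneralLinearGroup.scalar_commute, eq_comm]

/-- `x` is inverted by an element of the image of `PSL`. -/
def InvertedInPSL (x : PGLF) : Prop :=
  ∃ b : GL (Fin n) F, GeneralLinearGroup.det b = 1 ∧ mk b * x * (mk b)⁻¹ = x⁻¹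

theorem isReal_iff_invertedInPSL (y : PSLF) :
    IsReal y ↔ InvertedInPSL (ProjectiveSpecialLinearGroup.toPGL y) := by
  constructor
  · rintro ⟨z, hz⟩
    obtain ⟨b, hb, hbz⟩ := mem_range_toPGL.mp ⟨z, rfl⟩
    exact ⟨b, hb, by rw [hbz, ← map_inv, ← map_inv, ← map_mul, ← map_mul, hz]⟩
  · rintro ⟨b, hb, h⟩
    obtain ⟨z, hz⟩ := mem_range_toPGL.mpr ⟨b, hb, rfl⟩
    refine ⟨z, ProjectiveSpecialLinearGroup.toPGL_injective ?_⟩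
    rw [map_mul, map_mul, map_inv, map_inv, hz, h]

/-- Because the image of PSL is normal in PGL, reality in PSL is constant on classes of PGL. -/
theorem InvertedInPSL.conj {x x' : PGLF} (h : InvertedInPSL x) (hx : IsConj x x') :
    InvertedInPSL x' := by
  obtain ⟨b, hb, hbx⟩ := h
  obtain ⟨c, rfl⟩ := isConj_iff.mp hx
  obtain ⟨b', hb', hbb⟩ := mem_range_toPGL.mp
    (conj_mem_range_toPGL c (mem_range_toPGL.mpr ⟨b, hb, rfl⟩))
  refine ⟨b', hb', ?_⟩
  rw [hbb]
  calc c * mk b * c⁻¹ * (c * x * c⁻¹) * (c * mk b * c⁻¹)⁻¹ = c * (mk b * x * (mk b)⁻¹) * c⁻¹ := by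
        group
    _ = (c * x * c⁻¹)⁻¹ := by rw [hbx]; group

theorem mem_carrier_mk {G : Type*} [Group G] {x y : G} :
    x ∈ (ConjClasses.mk y).carrier ↔ IsConj x y := by
  rw [ConjClasses.mem_carrier_iff_mk_eq, ConjClasses.mk_eq_mk_iff_isConj]

theorem inPSL_mk {x : PGLF} : InPSL (ConjClasses.mk x) ↔
    x ∈ (ProjectiveSpecialLinearGroup.toPGL (n := Fin n) (R := F)).range := by
  refine ⟨fun h => h x (mem_carrier_mk.mpr (IsConj.refl x)), fun h y hy => ?_⟩
  obtain ⟨c, rfl⟩ := isConj_iff.mp (mem_carrier_mk.mp hy).symm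
  exact conj_mem_range_toPGL c h

theorem forall_isReal_mk {x : PGLF} :
    (∀ y ∈ (ConjClasses.mk x).carrier, IsReal y) ↔ ∃ b : GL (Fin n) F, mk b * x * (mk b)⁻¹ = x⁻¹ := by
  constructor
  · intro h
    obtain ⟨b, hb⟩ := h x (mem_carrier_mk.mpr (IsConj.refl x))
    obtain ⟨b, rfl⟩ := mk_surjective b
    exact ⟨b, hb⟩
  · rintro ⟨b, hb⟩ y hy
    obtain ⟨c, rfl⟩ := isConj_iff.mp (mem_carrier_mk.mp hy).symm
    refine ⟨c * mk b * c⁻¹, ?_⟩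
    calc c * mk b * c⁻¹ * (c * x * c⁻¹) * (c * mk b * c⁻¹)⁻¹ = c * (mk b * x * (mk b)⁻¹) * c⁻¹ := by
          group
      _ = (c * x * c⁻¹)⁻¹ := by rw [hb]; group

theorem forall_isReal_psl_mk {x : PGLF}
    (hx : x ∈ (ProjectiveSpecialLinearGroup.toPGL (n := Fin n) (R := F)).range) :
    (∀ y : PSLF, ProjectiveSpecialLinearGroup.toPGL y ∈ (ConjClasses.mk x).carrier → IsReal y) ↔
      InvertedInPSL x := by
  constructor
  · intro h
    obtain ⟨y, rfl⟩ := hx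
    exact (isReal_iff_invertedInPSL y).mp (h y (mem_carrier_mk.mpr (IsConj.refl _)))
  · intro h y hy
    exact (isReal_iff_invertedInPSL y).mpr (h.conj (mem_carrier_mk.mp hy).symm)

theorem IsTuple.scaleRoots {ν : n.Partition} {f : ℕ → F[X]} (hf : IsTuple ν f) (l : Fˣ) :
    IsTuple ν fun i => (f i).scaleRoots (l : F) := fun i =>
  ⟨(hf i).1.scaleRoots l.ne_zero, by rw [natDegree_scaleRoots]; exact (hf i).2⟩

theorem isConj_mk_iff {g g' : GL (Fin n) F} : IsConj (mk g : PGLF) (mk g') ↔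
    ∃ (b : GL (Fin n) F) (l : Fˣ), b * g * b⁻¹ = GeneralLinearGroup.scalar (Fin n) l * g' := by
  rw [isConj_iff, mk_surjective.exists]
  refine exists_congr fun b => ?_
  rw [← map_inv, ← map_mul, ← map_mul, mk_eq_mk_iff_scalar]

theorem isConj_mk_iff_matInv {g g' : GL (Fin n) F} {f f' : ℕ → F[X]} (h : MatInv g f)
    (h' : MatInv g' f') : IsConj (mk g : PGLF) (mk g') ↔
      ∃ l : Fˣ, f = fun i => (f' i).scaleRoots (l : F) := by
  rw [isConj_mk_iff]
  constructor
  · rintro ⟨b, l, hb⟩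
    have h1 := h.conj b
    rw [hb] at h1
    exact ⟨l, h1.unique (h'.scalar_mul l)⟩
  · rintro ⟨l, rfl⟩
    obtain ⟨b, hb⟩ := h.exists_conj (h'.scalar_mul l)
    exact ⟨b, l, hb⟩

theorem classHasType_mk {g : GL (Fin n) F} {f : ℕ → F[X]} (h : MatInv g f) {ν : n.Partition} :
    ClassHasType (ConjClasses.mk (mk g : PGLF)) ν ↔ IsTuple ν f := by
  constructor
  · rintro ⟨g', hg', ht⟩
    obtain ⟨f', h', hf'⟩ := hasType_iff.mp ht
    obtain ⟨l, rfl⟩ := (isConj_mk_iff_matInv h h').mp (mem_carrier_mk.mp hg').symm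
    exact hf'.scaleRoots l
  · intro hf
    exact ⟨g, mem_carrier_mk.mpr (IsConj.refl _), hasType_iff.mpr ⟨f, h, hf⟩⟩

theorem inverts_iff {g b : GL (Fin n) F} : (mk b : PGLF) * mk g * (mk b)⁻¹ = (mk g)⁻¹ ↔
    ∃ l : Fˣ, b * g * b⁻¹ = GeneralLinearGroup.scalar (Fin n) l * g⁻¹ := by
  rw [← map_inv, ← map_inv, ← map_mul, ← map_mul, mk_eq_mk_iff_scalar]

theorem exists_inverts_iff_matInv {g : GL (Fin n) F} {f : ℕ → F[X]} (h : MatInv g f) :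
    (∃ b : GL (Fin n) F, (mk b : PGLF) * mk g * (mk b)⁻¹ = (mk g)⁻¹) ↔
      ∃ l : Fˣ, (fun i => recip (l : F) (f i)) = f := by
  simp only [inverts_iff]
  constructor
  · rintro ⟨b, l, hb⟩
    have h1 := h.conj b
    rw [hb] at h1
    exact ⟨l, (h.scalar_mul_inv l).unique h1⟩
  · rintro ⟨l, hl⟩
    have h1 := h.scalar_mul_inv l
    rw [hl] at h1
    obtain ⟨b, hb⟩ := h.exists_conj h1
    exact ⟨b, l, hb⟩

/-- Every class of `PGL` inside `PSL` has a representative of determinant one. -/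
theorem InPSL.exists_rep {C : ConjClasses PGLF} (hC : InPSL C) : ∃ (g : GL (Fin n) F)
    (f : ℕ → F[X]), GeneralLinearGroup.det g = 1 ∧ MatInv g f ∧ ConjClasses.mk (mk g) = C := by
  obtain ⟨x, rfl⟩ := ConjClasses.exists_rep C
  obtain ⟨g, hg, rfl⟩ := mem_range_toPGL.mp (inPSL_mk.mp hC)
  obtain ⟨f, hf⟩ := exists_matInv g
  exact ⟨g, f, hg, hf, rfl⟩

/-- An element of determinant one which is inverted in `PGL` is inverted in `PSL` if the sign of
its type is a power of exponent `h_ν`. -/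
theorem MatInv.invertedInPSL [Finite F] (hq : Odd (Nat.card F)) (hn : n ≠ 0) {g : GL (Fin n) F}
    {ν : n.Partition} {f : ℕ → F[X]} (h : MatInv g f) (hf : IsTuple ν f)
    (hs : ∃ y : Fˣ, (-1) ^ signExp ν = y ^ hNu (Nat.card F) ν) {b : GL (Fin n) F}
    (hb : (mk b : PGLF) * mk g * (mk b)⁻¹ = (mk g)⁻¹) : InvertedInPSL (mk g : PGLF) := by
  obtain ⟨l, hl⟩ := inverts_iff.mp hb
  obtain ⟨y, hy⟩ := (h.exists_det_eq_pow hq hn hf b l).2 hl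
  obtain ⟨z, hz⟩ := hs
  -- The determinant of `b` is the `hNu`-th power of `z * y`; multiplying `b` by an element of the
  -- centralizer of `g` corrects it to one without changing the action on `g`.
  obtain ⟨c, hc, hdet⟩ := h.exists_commute_det hf (z * y)⁻¹
  refine ⟨b * c, ?_, inverts_iff.mpr ⟨l, ?_⟩⟩
  · rw [map_mul, hy, hdet, hz, ← mul_pow, ← mul_pow, mul_inv_cancel, one_pow]
  · rw [← hl, _root_.mul_inv_rev, mul_assoc b, hc]
    group

/-- A part i = 2t contributes t(2t-1) to the sign exponent and t to n/2, together 2t². Hence the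
sign exponent has the parity of `A` = n/2. -/
theorem exists_signExp_add {ν : n.Partition} (h : ¬ HasOddPart ν) :
    ∃ A B : ℕ, n = 2 * A ∧ signExp ν + A = 2 * B := by
  have heven : ∀ i ∈ ν.parts.toFinset, i = 2 * (i / 2) := by
    intro i hi
    have : ¬ Odd i := fun ho => h ⟨i, ho, (mem_parts_iff ν i).mp hi⟩
    rw [Nat.not_odd_iff_even, even_iff_two_dvd] at this
    omega
  refine ⟨∑ i ∈ ν.parts.toFinset, i / 2 * mult ν i,
    ∑ i ∈ ν.parts.toFinset, mult ν i * (i / 2 * (i / 2)), ?_, ?_⟩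
  · rw [Finset.mul_sum]
    exact (sum_mult ν).symm.trans (Finset.sum_congr rfl fun i hi => by
      rw [← mul_assoc, ← heven i hi])
  · rw [signExp, ← Finset.sum_add_distrib, Finset.mul_sum]
    refine Finset.sum_congr rfl fun i hi => ?_
    obtain ⟨t, ht⟩ : ∃ t, i = 2 * t := ⟨_, heven i hi⟩
    have hpos := ν.parts_pos (Multiset.mem_toFinset.mp hi)
    obtain ⟨u, rfl⟩ : ∃ u, t = u + 1 := ⟨t - 1, by omega⟩
    subst ht
    have h1 : 2 * (u + 1) * (2 * (u + 1) - 1) / 2 = (u + 1) * (2 * u + 1) := by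
      rw [mul_assoc, Nat.mul_div_cancel_left _ two_pos]
      rfl
    rw [h1, Nat.mul_div_cancel_left _ two_pos]
    ring

/-- An odd part makes `hNu` odd, so that 1 and -1 are their own `hNu`-th powers. Otherwise 4 divides
`n` and the sign is already 1. -/
theorem exists_signExp_eq_pow (ν : n.Partition) (h : 4 ∣ n ∨ HasOddPart ν) (q : ℕ) :
    ∃ y : Fˣ, (-1) ^ signExp ν = y ^ hNu q ν := by
  by_cases ho : HasOddPart ν
  · obtain ⟨i, hi, hi'⟩ := ho
    have hodd : Odd (hNu q ν) := hi.of_dvd_nat (hNu_dvd q ν hi')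
    exact ⟨(-1) ^ signExp ν, by rw [pow_right_comm, hodd.neg_one_pow]⟩
  · obtain ⟨A, B, hA, hB⟩ := exists_signExp_add ho
    have h4 := h.resolve_right ho
    have : Even (signExp ν) := by rw [even_iff_two_dvd]; omega
    exact ⟨1, by rw [this.neg_one_pow, one_pow]⟩

theorem pslNuPGL_eq_pslNu [Finite F] (hq : Odd (Nat.card F)) (hn : n ≠ 0) (ν : n.Partition)
    (h : 4 ∣ n ∨ HasOddPart ν) : pslNuPGL F ν = pslNu F ν := by
  rw [pslNuPGL, pslNu]
  congr 1
  congr 1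
  funext C
  refine propext (and_congr_right fun ht => and_congr_right fun hC => ?_)
  obtain ⟨g, f, hg, hf, rfl⟩ := hC.exists_rep
  rw [forall_isReal_mk, forall_isReal_psl_mk (inPSL_mk.mp hC)]
  exact ⟨fun ⟨b, hb⟩ => hf.invertedInPSL hq hn ((classHasType_mk hf).mp ht)
    (exists_signExp_eq_pow ν h _) hb, fun ⟨b, _, hb⟩ => ⟨b, hb⟩⟩

theorem two_pow_dvd_iff {a b : ℕ} (ha : a ≠ 0) (hb : b ≠ 0) (h : twoPart a = twoPart b) (k : ℕ) :
    2 ^ k ∣ a ↔ 2 ^ k ∣ b := by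
  rw [padicValNat_dvd_iff_le ha, padicValNat_dvd_iff_le hb,
    Nat.pow_right_injective le_rfl h]

/-- The sign exponent is odd and `hNu` is even, so an inverting matrix of determinant one would make
-1 a square. But n, being even and not divisible by 4, forces q to be 3 modulo 4. -/
theorem pslNu_eq_zero [Finite F] (hq : Odd (Nat.card F)) (hn : n ≠ 0)
    (h2 : twoPart n = twoPart (Nat.card F - 1)) (h4 : ¬ 4 ∣ n) {ν : n.Partition}
    (ho : ¬ HasOddPart ν) : pslNu F ν = 0 := by
  have := Fintype.ofFinite F
  have hq1 : Nat.card F - 1 ≠ 0 := by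
    have := Finite.one_lt_card (α := F)
    omega
  rw [pslNu, Nat.card_eq_zero]
  left
  refine ⟨fun ⟨C, ht, hC, hr⟩ => ?_⟩
  obtain ⟨g, f, hg, hf, rfl⟩ := hC.exists_rep
  obtain ⟨b, hb, hbg⟩ := (forall_isReal_psl_mk (inPSL_mk.mp hC)).mp hr
  obtain ⟨l, hl⟩ := inverts_iff.mp hbg
  obtain ⟨y, hy⟩ := (hf.exists_det_eq_pow hq hn ((classHasType_mk hf).mp ht) b l).2 hl
  obtain ⟨A, B, hA, hB⟩ := exists_signExp_add ho
  have hodd : Odd (signExp ν) := by rw [Nat.odd_iff]; omega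
  have heven : 2 ∣ hNu (Nat.card F) ν := by
    refine Nat.dvd_gcd ?_ (Multiset.dvd_gcd.mpr fun i hi => ?_)
    · obtain ⟨r, hr⟩ := hq
      omega
    · by_contra h
      exact ho ⟨i, by rwa [← Nat.not_even_iff_odd, even_iff_two_dvd], Multiset.count_pos.mpr hi⟩
  obtain ⟨r, hr⟩ := heven
  rw [hb, hodd.neg_one_pow, hr, pow_mul'] at hy
  have hsq : IsSquare (-1 : F) := by
    refine ⟨((y⁻¹ ^ r : Fˣ) : F), ?_⟩
    rw [← Units.val_mul, ← pow_two, inv_pow, inv_pow, ← Units.val_one, ← Units.val_neg]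
    congr 1
    rw [eq_inv_iff_mul_eq_one]
    exact hy.symm
  rw [FiniteField.isSquare_neg_one_iff] at hsq
  apply hsq
  have h3 := two_pow_dvd_iff hn hq1 h2 2
  rw [← Nat.card_eq_fintype_card]
  rw [Nat.odd_iff] at hq
  omega

/-- The class of `b g b⁻¹` in `PSL`, for `g` of determinant one. -/
noncomputable def conjClassPSL (g : SpecialLinearGroup (Fin n) F) (b : GL (Fin n) F) :
    PSLF :=
  QuotientGroup.mk ⟨((b * SpecialLinearGroup.toGL g * b⁻¹ : GL (Fin n) F) : Matrix _ _ F), by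
    have : GeneralLinearGroup.det (b * SpecialLinearGroup.toGL g * b⁻¹) = 1 := by
      rw [map_mul, map_mul, SpecialLinearGroup.coeToGL_det, map_inv]
      simp
    exact congrArg Units.val this⟩

theorem toPGL_conjClassPSL (g : SpecialLinearGroup (Fin n) F) (b : GL (Fin n) F) :
    ProjectiveSpecialLinearGroup.toPGL (conjClassPSL g b) =
      mk b * mk (SpecialLinearGroup.toGL g) * (mk b)⁻¹ := by
  rw [← map_inv, ← map_mul, ← map_mul]
  refine (ProjectiveSpecialLinearGroup.toPGL_mk _).trans ?_
  congr 1
  exact Units.ext rfl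

/-- A conjugating element `s` of determinant one gives b'⁻¹ s b, which centralizes `g` up to a
scalar and so has an `hNu`-th power as determinant. Conversely an element `c` of the centralizer
adjusts b' c b⁻¹ to determinant one. -/
theorem isConj_conjClassPSL_iff [Finite F] (hq : Odd (Nat.card F)) (hn : n ≠ 0)
    {g : SpecialLinearGroup (Fin n) F} {ν : n.Partition} {f : ℕ → F[X]}
    (h : MatInv (SpecialLinearGroup.toGL g) f) (hf : IsTuple ν f) (b b' : GL (Fin n) F) :
    IsConj (conjClassPSL g b) (conjClassPSL g b') ↔
      (GeneralLinearGroup.det b)⁻¹ * GeneralLinearGroup.det b' ∈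
        (powMonoidHom (hNu (Nat.card F) ν) : Fˣ →* Fˣ).range := by
  rw [isConj_iff]
  constructor
  · rintro ⟨z, hz⟩
    obtain ⟨s, hs, hsz⟩ := mem_range_toPGL.mp ⟨z, rfl⟩
    have h1 := congrArg ProjectiveSpecialLinearGroup.toPGL hz
    rw [map_mul, map_mul, map_inv, ← hsz, toPGL_conjClassPSL, toPGL_conjClassPSL] at h1
    have h2 : (mk (b'⁻¹ * s * b) : PGLF) * mk (SpecialLinearGroup.toGL g) *
        (mk (b'⁻¹ * s * b))⁻¹ = mk (SpecialLinearGroup.toGL g) := by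
      rw [map_mul, map_mul, map_inv]
      calc _ = (mk b')⁻¹ * (mk s * (mk b * mk (SpecialLinearGroup.toGL g) * (mk b)⁻¹) *
            (mk s)⁻¹) * mk b' := by group
        _ = _ := by rw [h1]; group
    rw [← map_inv, ← map_mul, ← map_mul, mk_eq_mk_iff_scalar] at h2
    obtain ⟨l, hl⟩ := h2
    obtain ⟨y, hy⟩ := (h.exists_det_eq_pow hq hn hf _ l).1 hl
    refine ⟨y⁻¹, ?_⟩
    rw [map_mul, map_mul, hs, mul_one, map_inv] at hy
    rw [powMonoidHom_apply, inv_pow, ← hy, _root_.mul_inv_rev, inv_inv]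
  · rintro ⟨y, hy⟩
    rw [powMonoidHom_apply] at hy
    obtain ⟨c, hc, hdet⟩ := h.exists_commute_det hf y⁻¹
    obtain ⟨z, hz⟩ := mem_range_toPGL.mpr ⟨b' * c * b⁻¹, by
      rw [map_mul, map_mul, hdet, inv_pow, hy, map_inv, _root_.mul_inv_rev, inv_inv,
        mul_inv_cancel_left, mul_inv_cancel], rfl⟩
    refine ⟨z, ProjectiveSpecialLinearGroup.toPGL_injective ?_⟩
    have hc' : (mk c : PGLF) * mk (SpecialLinearGroup.toGL g) =
        mk (SpecialLinearGroup.toGL g) * mk c := by rw [← map_mul, hc, map_mul]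
    rw [map_mul, map_mul, map_inv, hz, toPGL_conjClassPSL, toPGL_conjClassPSL, map_mul, map_mul,
      map_inv]
    calc _ = mk b' * (mk c * mk (SpecialLinearGroup.toGL g)) * (mk c)⁻¹ * (mk b')⁻¹ := by group
      _ = _ := by rw [hc']; group

/-- A class of `PGL` of type `ν` inside `PSL` is the union of `h_ν` classes of `PSL`. -/
theorem card_classes_over [Finite F] (hq : Odd (Nat.card F)) (hn : n ≠ 0) {C : ConjClasses PGLF}
    {ν : n.Partition} (ht : ClassHasType C ν) (hC : InPSL C) :
    Nat.card {D : ConjClasses PSLF //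
      ConjClasses.map ProjectiveSpecialLinearGroup.toPGL D = C} = hNu (Nat.card F) ν := by
  obtain ⟨g, f, hg, h, rfl⟩ := hC.exists_rep
  have hf := (classHasType_mk h).mp ht
  obtain ⟨g, rfl⟩ : ∃ g' : SpecialLinearGroup (Fin n) F, SpecialLinearGroup.toGL g' = g :=
    ⟨⟨g, congrArg Units.val hg⟩, Units.ext rfl⟩
  have : Nonempty (Fin n) := ⟨⟨0, Nat.pos_of_ne_zero hn⟩⟩
  set K : Subgroup Fˣ := (powMonoidHom (hNu (Nat.card F) ν) : Fˣ →* Fˣ).range with hK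
  -- The unit group is cyclic of order q - 1, which `hNu` divides.
  have hidx : K.index = hNu (Nat.card F) ν := by
    rw [hK, IsCyclic.index_powMonoidHom_range, Nat.card_units]
    exact Nat.gcd_eq_right (Nat.gcd_dvd_left _ _)
  rw [← hidx, ← Subgroup.index_comap_of_surjective K
    (GeneralLinearGroup.det_surjective (n := Fin n) (R := F)), Subgroup.index]
  let Ψ : GL (Fin n) F → {D : ConjClasses PSLF // ConjClasses.map
      ProjectiveSpecialLinearGroup.toPGL D = ConjClasses.mk (mk (SpecialLinearGroup.toGL g))} :=
    fun b => ⟨ConjClasses.mk (conjClassPSL g b), by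
      change ConjClasses.mk (ProjectiveSpecialLinearGroup.toPGL (conjClassPSL g b)) = _
      rw [ConjClasses.mk_eq_mk_iff_isConj, toPGL_conjClassPSL, isConj_comm, isConj_iff]
      exact ⟨mk b, rfl⟩⟩
  have hΨ : ∀ b b', Ψ b = Ψ b' ↔ (QuotientGroup.leftRel (K.comap GeneralLinearGroup.det)) b b' := by
    intro b b'
    rw [QuotientGroup.leftRel_apply, Subgroup.mem_comap, map_mul, map_inv,
      ← isConj_conjClassPSL_iff hq hn h hf, Subtype.mk_eq_mk, ConjClasses.mk_eq_mk_iff_isConj]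
  symm
  refine Nat.card_congr (Equiv.ofBijective
    (Quotient.lift Ψ fun b b' hb => (hΨ b b').mpr hb) ⟨?_, ?_⟩)
  · rintro ⟨b⟩ ⟨b'⟩ hb
    exact Quotient.sound ((hΨ b b').mp hb)
  · rintro ⟨D, hD⟩
    obtain ⟨y, rfl⟩ := ConjClasses.exists_rep D
    change ConjClasses.mk (ProjectiveSpecialLinearGroup.toPGL y) = _ at hD
    rw [ConjClasses.mk_eq_mk_iff_isConj, isConj_comm, isConj_iff] at hD
    obtain ⟨c, hc⟩ := hD
    obtain ⟨b, rfl⟩ := mk_surjective c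
    refine ⟨Quotient.mk _ b, Subtype.ext ?_⟩
    change ConjClasses.mk (conjClassPSL g b) = ConjClasses.mk y
    congr 1
    apply ProjectiveSpecialLinearGroup.toPGL_injective
    rw [toPGL_conjClassPSL, hc]

theorem ClassHasType.unique {C : ConjClasses PGLF} {ν ν' : n.Partition} (h : ClassHasType C ν)
    (h' : ClassHasType C ν') : ν = ν' := by
  obtain ⟨x, rfl⟩ := ConjClasses.exists_rep C
  obtain ⟨g, rfl⟩ := mk_surjective x
  obtain ⟨f, hf⟩ := exists_matInv g
  exact ((classHasType_mk hf).mp h).type_unique ((classHasType_mk hf).mp h')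

theorem exists_classHasType (C : ConjClasses PGLF) : ∃ ν : n.Partition, ClassHasType C ν := by
  obtain ⟨x, rfl⟩ := ConjClasses.exists_rep C
  obtain ⟨g, rfl⟩ := mk_surjective x
  obtain ⟨f, hf⟩ := exists_matInv g
  obtain ⟨ν, hν⟩ := exists_isTuple hf
  exact ⟨ν, (classHasType_mk hf).mpr hν⟩

theorem forall_isReal_iff_map {D : ConjClasses PSLF} : (∀ y ∈ D.carrier, IsReal y) ↔
    ∀ y : PSLF, ProjectiveSpecialLinearGroup.toPGL y ∈
      (ConjClasses.map ProjectiveSpecialLinearGroup.toPGL D).carrier → IsReal y := by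
  obtain ⟨y, rfl⟩ := ConjClasses.exists_rep D
  refine (Iff.trans ?_ (forall_isReal_psl_mk ⟨y, rfl⟩).symm)
  constructor
  · intro h
    exact (isReal_iff_invertedInPSL y).mp (h y (mem_carrier_mk.mpr (IsConj.refl y)))
  · intro h y' hy'
    exact (isReal_iff_invertedInPSL y').mpr (h.conj
      (MonoidHom.map_isConj _ (mem_carrier_mk.mp hy').symm))

theorem inPSL_map (D : ConjClasses PSLF) :
    InPSL (ConjClasses.map ProjectiveSpecialLinearGroup.toPGL D) := by
  obtain ⟨y, rfl⟩ := ConjClasses.exists_rep D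
  exact inPSL_mk.mpr ⟨y, rfl⟩

/-- Real classes of PSL are sorted by the PGL class containing them and by its type. Reality depends
only on the PGL class, and each one contributes `hNu` classes of PSL. -/
theorem numRealClasses_psl [Finite F] (hq : Odd (Nat.card F)) (hn : n ≠ 0) :
    numRealClasses PSLF = ∑ ν : n.Partition, hNu (Nat.card F) ν * pslNu F ν := by
  have : Finite PGLF := Finite.of_surjective _ mk_surjective
  have : Finite (ConjClasses PGLF) := Quotient.finite _
  have : Finite (ConjClasses PSLF) := Quotient.finite _
  let A : n.Partition → Type _ := fun ν => {C : ConjClasses PGLF //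
    ClassHasType C ν ∧ InPSL C ∧ ∀ y : PSLF,
      ProjectiveSpecialLinearGroup.toPGL y ∈ C.carrier → IsReal y}
  let B : ∀ ν, A ν → Type _ := fun ν C => {D : ConjClasses PSLF //
      ConjClasses.map ProjectiveSpecialLinearGroup.toPGL D = C.1}
  let Θ : (Σ ν, Σ C : A ν, B ν C) → {D : ConjClasses PSLF // ∀ y ∈ D.carrier, IsReal y} :=
    fun x => ⟨x.2.2.1, by
      rw [forall_isReal_iff_map, x.2.2.2]
      exact x.2.1.2.2.2⟩
  have hΘ : Function.Bijective Θ := by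
    constructor
    · rintro ⟨ν, ⟨C, hC⟩, ⟨D, hD⟩⟩ ⟨ν', ⟨C', hC'⟩, ⟨D', hD'⟩⟩ h
      obtain rfl : D = D' := congrArg Subtype.val h
      obtain rfl : C = C' := hD.symm.trans hD'
      obtain rfl := hC.1.unique hC'.1
      rfl
    · rintro ⟨D, hD⟩
      obtain ⟨ν, hν⟩ := exists_classHasType
        (ConjClasses.map ProjectiveSpecialLinearGroup.toPGL D)
      exact ⟨⟨ν, ⟨_, hν, inPSL_map D, forall_isReal_iff_map.mp hD⟩, ⟨D, rfl⟩⟩, rfl⟩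
  rw [numRealClasses, ← Nat.card_congr (Equiv.ofBijective Θ hΘ), Nat.card_sigma]
  refine Finset.sum_congr rfl fun ν _ => ?_
  have := Fintype.ofFinite (A ν)
  rw [Nat.card_sigma, Finset.sum_congr rfl fun C _ => card_classes_over hq hn C.2.1 C.2.2.1,
    Finset.sum_const, smul_eq_mul, mul_comm, Finset.card_univ, ← Nat.card_eq_fintype_card]
  rfl

end Projective

end RealClasses

namespace RealClasses

open Polynomial

/-! ### Counting polynomials with roots invariant under α ↦ l/α, with signs -/

section Counting

/-- Counting the families of signed elements whose signs have product `c`. -/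
theorem two_mul_card_prod_eq {I : Type*} [Fintype I] {S : I → Type*} [∀ i, Finite (S i)]
    (ε : ∀ i, S i → ℤ) (hε : ∀ i p, ε i p = 1 ∨ ε i p = -1) {c : ℤ} (hc : c = 1 ∨ c = -1)
    (s : I → ℤ) (hs : ∀ i [Fintype (S i)], ∑ p, ε i p = s i) :
    2 * (Nat.card {φ : ∀ i, S i // ∏ i, ε i (φ i) = c} : ℤ) =
      ∏ i, (Nat.card (S i) : ℤ) + c * ∏ i, s i := by
  classical
  have := fun i => Fintype.ofFinite (S i)
  have h1 : ∏ i, s i = ∑ φ : (∀ i, S i), ∏ i, ε i (φ i) := by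
    simp only [← hs]
    rw [Finset.prod_univ_sum, Fintype.piFinset_univ]
  have h2 : ∏ i, (Nat.card (S i) : ℤ) = ∑ φ : (∀ i, S i), 1 := by
    rw [Finset.sum_const, Finset.card_univ, Fintype.card_pi]
    simp
  have hprod : ∀ φ : (∀ i, S i), ∏ i, ε i (φ i) = 1 ∨ ∏ i, ε i (φ i) = -1 := by
    intro φ
    refine Finset.prod_induction _ (fun x => x = 1 ∨ x = -1) ?_ (Or.inl rfl) fun i _ => hε i (φ i)
    rintro a b (rfl | rfl) (rfl | rfl) <;> simp
  rw [h1, h2, Finset.mul_sum, ← Finset.sum_add_distrib, Nat.card_eq_fintype_card,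
    Fintype.card_subtype, Finset.card_filter, Nat.cast_sum, Finset.mul_sum]
  refine Finset.sum_congr rfl fun φ _ => ?_
  -- Twice the indicator of "the product of signs is c" equals 1 + c times that product.
  rcases hprod φ with h | h <;> rcases hc with rfl | rfl <;> rw [h] <;> norm_num

variable {F : Type*} [Field F]

/-- The polynomials of degree `m` whose multiset of roots is invariant under `α ↦ l / α`. -/
def recipSet (l : F) (m : ℕ) : Set F[X] := {p | MonicUnit p ∧ p.natDegree = m ∧ recip l p = p}

instance [Finite F] (l : F) (m : ℕ) : Finite (recipSet l m) := by
  refine Finite.of_injective (β := Fin (m + 1) → F) (fun p j => p.1.coeff j) ?_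
  intro p p' h
  refine Subtype.ext (ext_of_natDegree (p.2.2.1.trans p'.2.2.1.symm) fun i hi => ?_)
  rw [p.2.2.1] at hi
  exact congrFun h ⟨i, by omega⟩

theorem rootProd_sq {l : F} {m : ℕ} {p : F[X]} (hp : p ∈ recipSet l m) :
    rootProd p * rootProd p = l ^ m := by
  have h := hp.1.rootProd_recip l
  rw [hp.2.2, hp.2.1] at h
  nth_rw 2 [h]
  rw [mul_inv_cancel_left₀ hp.1.rootProd_ne_zero]

/-- The sign of a polynomial whose multiset of roots is invariant under `α ↦ l / α`. -/
noncomputable def recipSign (l : F) (p : F[X]) : ℤ :=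
  open Classical in if rootProd p = l ^ (p.natDegree / 2) then 1 else -1

theorem recipSign_eq (l : F) (p : F[X]) : recipSign l p = 1 ∨ recipSign l p = -1 := by
  rw [recipSign]
  split_ifs <;> simp

/-- The square of the product of roots is l^m. For this to be the square of `l ^ (m / 2)`, with
rounded-down division, one needs `m` even or l = 1. -/
theorem rootProd_eq_sign {l : F} {m : ℕ} {p : F[X]} (hp : p ∈ recipSet l m)
    (h : l = 1 ∨ Even m) : rootProd p = (recipSign l p : F) * l ^ (m / 2) := by
  have h1 : rootProd p * rootProd p = l ^ (m / 2) * l ^ (m / 2) := by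
    rw [rootProd_sq hp, ← pow_add]
    rcases h with rfl | h
    · simp
    · obtain ⟨r, rfl⟩ := h
      congr 1
      omega
  rw [recipSign, hp.2.1]
  split_ifs with h2
  · rw [h2]; simp
  · rw [(mul_self_eq_mul_self_iff.mp h1).resolve_left h2]; simp

theorem ncard_fixed (l c : F) (hl : l ≠ 0) [Finite F] (hq : Odd (Nat.card F)) (s : ℕ) :
    (c = l ^ s → Nat.card {x : F // x * l ^ s = c * x} = Nat.card F) ∧
    (c = -l ^ s → Nat.card {x : F // x * l ^ s = c * x} = 1) := by
  have := Fintype.ofFinite F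
  constructor
  · rintro rfl
    exact Nat.card_congr (Equiv.subtypeUnivEquiv fun x => mul_comm _ _)
  · rintro rfl
    have hchar : ringChar F ≠ 2 := fun h => by
      have := FiniteField.even_card_iff_char_two.mp h
      rw [Nat.card_eq_fintype_card, Nat.odd_iff] at hq
      omega
    have h0 : ∀ x : F, x * l ^ s = -l ^ s * x → x = 0 := by
      intro x hx
      have h1 : 2 * (l ^ s * x) = 0 := by linear_combination hx
      have h2 := (mul_eq_zero.mp h1).resolve_left (Ring.two_ne_zero hchar)
      exact (mul_eq_zero.mp h2).resolve_left (pow_ne_zero _ hl)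
    rw [Nat.card_eq_one_iff_unique]
    exact ⟨⟨fun x y => Subtype.ext ((h0 _ x.2).trans (h0 _ y.2).symm)⟩, ⟨⟨0, by simp⟩⟩⟩

/-- Invariance pairs the coefficients of index i and 2(s+1) - i. The constant term is `c`, those of
index 1 to s are free, and the middle one is subject only to the displayed equation. It is arbitrary
when c = l^(s+1) and, in odd characteristic, zero when c = -l^(s+1) (`ncard_fixed`). -/
theorem card_recipSet_even [Finite F] {l c : F} (hl : l ≠ 0) (s : ℕ)
    (hc : c * c = l ^ (2 * (s + 1))) :
    Nat.card {p : recipSet l (2 * (s + 1)) // rootProd p.1 = c} =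
      Nat.card F ^ s * Nat.card {x : F // x * l ^ (s + 1) = c * x} := by
  have hc0 : c ≠ 0 := fun h => pow_ne_zero (2 * (s + 1)) hl (by rw [← hc, h, zero_mul])
  have hcoeff0 : ∀ p : {p : recipSet l (2 * (s + 1)) // rootProd p.1 = c}, p.1.1.coeff 0 = c := by
    rintro ⟨⟨p, hp⟩, h⟩
    rw [rootProd, hp.2.1] at h
    simpa using h
  have hrel : ∀ p : {p : recipSet l (2 * (s + 1)) // rootProd p.1 = c}, ∀ i ≤ 2 * (s + 1),
      p.1.1.coeff (2 * (s + 1) - i) * l ^ (2 * (s + 1) - i) = c * p.1.1.coeff i := by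
    intro p i hi
    have h1 := p.1.2.1.coeff_recip l (i := i) (by rw [p.1.2.2.1]; exact hi)
    rw [p.1.2.2.2, p.1.2.2.1, hcoeff0] at h1
    rw [h1]
    field_simp
  let Θ : {p : recipSet l (2 * (s + 1)) // rootProd p.1 = c} →
      (Fin s → F) × {x : F // x * l ^ (s + 1) = c * x} :=
    fun p => (fun j => p.1.1.coeff (j + 1), ⟨p.1.1.coeff (s + 1), by
      have := hrel p (s + 1) (by omega)
      rwa [show 2 * (s + 1) - (s + 1) = s + 1 by omega] at this⟩)
  have hΘ : Function.Bijective Θ := by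
    constructor
    · intro p p' h
      have h1 : ∀ i ≤ s + 1, p.1.1.coeff i = p'.1.1.coeff i := by
        intro i hi
        rcases i with _ | i
        · rw [hcoeff0, hcoeff0]
        · rcases Nat.lt_or_ge i s with his | his
          · exact congrFun (congrArg Prod.fst h) ⟨i, his⟩
          · obtain rfl : i = s := by omega
            exact congrArg Subtype.val (congrArg Prod.snd h)
      refine Subtype.ext (Subtype.ext (ext_of_natDegree
        (p.1.2.2.1.trans p'.1.2.2.1.symm) fun i hi => ?_))
      rw [p.1.2.2.1] at hi
      rcases le_or_gt i (s + 1) with his | his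
      · exact h1 i his
      · have h2 := hrel p (2 * (s + 1) - i) (by omega)
        have h3 := hrel p' (2 * (s + 1) - i) (by omega)
        rw [h1 (2 * (s + 1) - i) (by omega), ← h3, Nat.sub_sub_self hi] at h2
        exact mul_right_cancel₀ (pow_ne_zero _ hl) h2
    · rintro ⟨v, x, hx⟩
      let b : Fin (s + 1) → F := Fin.cons c v
      -- The lower half is prescribed, the middle coefficient is `x`, and the upper half is forced
      -- by the symmetry.
      let a : ℕ → F := fun i => if h : i < s + 1 then b ⟨i, h⟩ else if i = s + 1 then x else
        if h : 2 * (s + 1) - i < s + 1 then c * b ⟨2 * (s + 1) - i, h⟩ / l ^ i else 0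
      have ha0 : a 0 = c := by simp [a, b]
      have ha1 : ∀ j (hj : j < s), a (j + 1) = v ⟨j, hj⟩ := by
        intro j hj
        simp only [a, dif_pos (show j + 1 < s + 1 by omega)]
        rfl
      have has : a (s + 1) = x := by simp [a]
      have hrel' : ∀ i ≤ 2 * (s + 1), a (2 * (s + 1) - i) * l ^ (2 * (s + 1) - i) = c * a i := by
        have key : ∀ i, i < s + 1 →
            a (2 * (s + 1) - i) * l ^ (2 * (s + 1) - i) = c * a i := by
          intro i hi
          simp only [a, dif_pos hi]
          rw [dif_neg (by omega), if_neg (by omega), dif_pos (by omega),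
            div_mul_cancel₀ _ (pow_ne_zero _ hl)]
          congr 3
          omega
        intro i hi
        rcases lt_trichotomy i (s + 1) with h | rfl | h
        · exact key i h
        · rw [show 2 * (s + 1) - (s + 1) = s + 1 by omega, has, hx]
        · have h2 := key (2 * (s + 1) - i) (by omega)
          rw [Nat.sub_sub_self hi] at h2
          apply mul_left_cancel₀ hc0
          rw [← mul_assoc, ← h2, ← mul_assoc, hc, mul_assoc, ← pow_add,
            Nat.add_sub_cancel' hi]
          ring
      have ha2 : a (2 * (s + 1)) = 1 := by
        have h := hrel' 0 (Nat.zero_le _)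
        rw [Nat.sub_zero, ha0, hc] at h
        exact mul_right_cancel₀ (pow_ne_zero _ hl) (h.trans (one_mul _).symm)
      let p : F[X] := ∑ i ∈ Finset.range (2 * (s + 1) + 1), C (a i) * X ^ i
      have hp : ∀ i ≤ 2 * (s + 1), p.coeff i = a i := by
        intro i hi
        simp only [p, finsetSum_coeff, coeff_C_mul, coeff_X_pow]
        rw [Finset.sum_eq_single i]
        · simp
        · intro j _ hj
          simp [hj.symm]
        · intro h
          exact absurd (Finset.mem_range_succ_iff.mpr hi) h
      have hdeg : p.natDegree = 2 * (s + 1) := by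
        refine natDegree_eq_of_le_of_coeff_ne_zero ?_ (by rw [hp _ le_rfl, ha2]; exact one_ne_zero)
        refine natDegree_sum_le_of_forall_le _ _ fun i hi => ?_
        exact (natDegree_C_mul_X_pow_le _ _).trans (Finset.mem_range_succ_iff.mp hi)
      have hpu : MonicUnit p := by
        refine ⟨?_, ?_⟩
        · rw [Monic, leadingCoeff, hdeg, hp _ le_rfl, ha2]
        · rw [hp _ (Nat.zero_le _), ha0]; exact hc0
      have hmem : p ∈ recipSet l (2 * (s + 1)) := by
        refine ⟨hpu, hdeg, ext_of_natDegree (hpu.natDegree_recip l) fun i hi => ?_⟩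
        rw [hpu.natDegree_recip, hdeg] at hi
        rw [hpu.coeff_recip _ (by rwa [hdeg]), hdeg, hp _ (Nat.zero_le _), ha0,
          hp _ (Nat.sub_le _ _), hp _ hi, mul_assoc, hrel' i hi, inv_mul_cancel_left₀ hc0]
      refine ⟨⟨⟨p, hmem⟩, ?_⟩, ?_⟩
      · rw [rootProd, hdeg, hp _ (Nat.zero_le _), ha0]
        simp
      · refine Prod.ext (funext fun j => ?_) (Subtype.ext ?_)
        · change p.coeff (j + 1) = v j
          rw [hp _ (by omega), ha1 _ j.2]
        · change p.coeff (s + 1) = x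
          rw [hp _ (by omega), has]
  rw [Nat.card_congr (Equiv.ofBijective Θ hΘ), Nat.card_prod, Nat.card_fun, Nat.card_fin]

theorem sum_recipSign [Finite F] (l : F) (m : ℕ) [Fintype (recipSet l m)] :
    ∑ p : recipSet l m, recipSign l p.1 =
      (Nat.card {p : recipSet l m // rootProd p.1 = l ^ (m / 2)} : ℤ) -
        Nat.card {p : recipSet l m // ¬ rootProd p.1 = l ^ (m / 2)} := by
  classical
  have h : ∀ p : recipSet l m, recipSign l p.1 =
      (if rootProd p.1 = l ^ (m / 2) then 1 else 0) -
        (if ¬ rootProd p.1 = l ^ (m / 2) then 1 else 0) := by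
    intro p
    rw [recipSign, p.2.2.1]
    split_ifs <;> simp_all
  rw [Finset.sum_congr rfl fun p _ => h p, Finset.sum_sub_distrib, Nat.card_eq_fintype_card,
    Nat.card_eq_fintype_card, Fintype.card_subtype, Fintype.card_subtype, Finset.card_filter,
    Finset.card_filter]
  simp

theorem card_recipSet_eq_add [Finite F] (l : F) (m : ℕ) :
    Nat.card (recipSet l m) = Nat.card {p : recipSet l m // rootProd p.1 = l ^ (m / 2)} +
        Nat.card {p : recipSet l m // ¬ rootProd p.1 = l ^ (m / 2)} := by
  classical
  rw [← Nat.card_sum]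
  exact Nat.card_congr (Equiv.sumCompl _).symm

theorem card_pos_neg_even [Finite F] (hq : Odd (Nat.card F)) {l : F} (hl : l ≠ 0) (s : ℕ) :
    Nat.card {p : recipSet l (2 * (s + 1)) // rootProd p.1 = l ^ (2 * (s + 1) / 2)} =
      Nat.card F ^ (s + 1) ∧
    Nat.card {p : recipSet l (2 * (s + 1)) // ¬ rootProd p.1 = l ^ (2 * (s + 1) / 2)} =
      Nat.card F ^ s := by
  have := Fintype.ofFinite F
  have h2 : 2 * (s + 1) / 2 = s + 1 := by omega
  have hpow : l ^ (s + 1) * l ^ (s + 1) = l ^ (2 * (s + 1)) := by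
    rw [← pow_add]; congr 1; omega
  rw [h2]
  constructor
  · rw [card_recipSet_even hl s hpow, (ncard_fixed l _ hl hq (s + 1)).1 rfl, pow_succ]
  · have hneg : ∀ p : recipSet l (2 * (s + 1)), ¬ rootProd p.1 = l ^ (s + 1) ↔
        rootProd p.1 = -l ^ (s + 1) := by
      intro p
      have h1 := rootProd_sq p.2
      rw [← hpow] at h1
      refine ⟨fun h => (mul_self_eq_mul_self_iff.mp h1).resolve_left h, fun h h' => ?_⟩
      have hchar : ringChar F ≠ 2 := fun h => by
        have := FiniteField.even_card_iff_char_two.mp h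
        rw [Nat.card_eq_fintype_card, Nat.odd_iff] at hq
        omega
      rw [h'] at h
      exact pow_ne_zero (s + 1) hl ((Ring.eq_self_iff_eq_zero_of_char_ne_two hchar).mp h.symm)
    rw [Nat.card_congr (Equiv.subtypeEquivRight hneg), card_recipSet_even hl s
      (by rw [neg_mul_neg, hpow]), (ncard_fixed l _ hl hq (s + 1)).2 rfl, mul_one]

theorem card_recipSet_two_mul [Finite F] (hq : Odd (Nat.card F)) {l : F} (hl : l ≠ 0) (s : ℕ) :
    Nat.card (recipSet l (2 * (s + 1))) = Nat.card F ^ (s + 1) + Nat.card F ^ s := by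
  rw [card_recipSet_eq_add, (card_pos_neg_even hq hl s).1, (card_pos_neg_even hq hl s).2]

theorem sum_recipSign_two_mul [Finite F] (hq : Odd (Nat.card F)) {l : F} (hl : l ≠ 0) (s : ℕ)
    [Fintype (recipSet l (2 * (s + 1)))] : ∑ p : recipSet l (2 * (s + 1)), recipSign l p.1 =
      (Nat.card F : ℤ) ^ (s + 1) - (Nat.card F : ℤ) ^ s := by
  rw [sum_recipSign, (card_pos_neg_even hq hl s).1, (card_pos_neg_even hq hl s).2]
  push_cast
  rfl

/-- The involution α ↦ -α on roots preserves invariance under inversion and, the degree being odd,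
reverses the sign. -/
theorem sum_recipSign_one_odd [Finite F] (hq : Odd (Nat.card F)) {m : ℕ} (hm : Odd m)
    [Fintype (recipSet (1 : F) m)] : ∑ p : recipSet (1 : F) m, recipSign 1 p.1 = 0 := by
  have := Fintype.ofFinite F
  have hchar : ringChar F ≠ 2 := fun h => by
    have := FiniteField.even_card_iff_char_two.mp h
    rw [Nat.card_eq_fintype_card, Nat.odd_iff] at hq
    omega
  have h1 : (-1 : F) ≠ 0 := neg_ne_zero.mpr one_ne_zero
  have hmem : ∀ p ∈ recipSet (1 : F) m, p.scaleRoots (-1) ∈ recipSet (1 : F) m := by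
    intro p hp
    refine ⟨hp.1.scaleRoots h1, by rw [natDegree_scaleRoots, hp.2.1], ?_⟩
    rw [hp.1.recip_scaleRoots h1]
    nth_rw 2 [← hp.2.2]
    rw [scaleRoots_recip]
    norm_num
  let σ : recipSet (1 : F) m → recipSet (1 : F) m := fun p => ⟨_, hmem p.1 p.2⟩
  have hσ : Function.Involutive σ := by
    intro p
    refine Subtype.ext ?_
    change (p.1.scaleRoots (-1)).scaleRoots (-1) = p.1
    rw [← scaleRoots_mul]
    simp
  have hsign : ∀ p, recipSign 1 (σ p).1 = -recipSign 1 p.1 := by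
    intro p
    have hr : rootProd (σ p).1 = -rootProd p.1 := by
      change rootProd (p.1.scaleRoots (-1)) = _
      rw [rootProd_scaleRoots, p.2.2.1, hm.neg_one_pow, mul_neg_one]
    have h2 := rootProd_sq p.2
    rw [one_pow, mul_self_eq_one_iff] at h2
    have hne : (-1 : F) ≠ 1 := Ring.neg_one_ne_one_of_char_ne_two hchar
    rw [recipSign, recipSign, hr, one_pow, one_pow]
    rcases h2 with h2 | h2 <;> rw [h2] <;> simp [hne]
  have h3 : ∑ p, recipSign (1 : F) (σ p).1 = ∑ p : recipSet (1 : F) m, recipSign 1 p.1 :=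
    Equiv.sum_comp hσ.toPerm fun p : recipSet (1 : F) m => recipSign 1 p.1
  simp only [hsign, Finset.sum_neg_distrib] at h3
  omega

theorem recip_X_sub_C {a : F} (ha : a ≠ 0) : recip 1 (X - C a) = X - C a⁻¹ := by
  have h : MonicUnit (X - C a) := ⟨monic_X_sub_C a, by simpa using ha⟩
  refine ext_of_natDegree (by rw [h.natDegree_recip, natDegree_X_sub_C, natDegree_X_sub_C])
    fun i hi => ?_
  rw [h.natDegree_recip, natDegree_X_sub_C] at hi
  rw [h.coeff_recip 1 (by rwa [natDegree_X_sub_C]), natDegree_X_sub_C]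
  interval_cases i
  · simp [inv_neg]
  · simp [coeff_X, coeff_C, ha]

theorem MonicUnit.map_recip {K : Type*} [Field K] (φ : F →+* K) {p : F[X]} (hp : MonicUnit p)
    (l : F) : (RealClasses.recip l p).map φ = RealClasses.recip (φ l) (p.map φ) := by
  have hp' : MonicUnit (p.map φ) := ⟨hp.1.map φ, by
    rw [coeff_map]; exact (map_ne_zero φ).mpr hp.2⟩
  refine ext_of_natDegree ?_ fun i hi => ?_
  · rw [natDegree_map, hp.natDegree_recip, hp'.natDegree_recip, natDegree_map]
  · rw [natDegree_map, hp.natDegree_recip] at hi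
    rw [coeff_map, hp.coeff_recip _ hi, hp'.coeff_recip _ (by rwa [natDegree_map]), natDegree_map,
      coeff_map, coeff_map, map_mul, map_mul, map_pow, map_inv₀]

theorem selfReciprocal_iff {p : F[X]} (hp : MonicUnit p) :
    SelfReciprocal p ↔ recip 1 p = p := by
  set K := AlgebraicClosure F
  have hprod : ∀ r : F[X], r.Monic → r.map (algebraMap F K) =
      ((r.aroots K).map fun a => X - C a).prod := fun r hr =>
    (IsAlgClosed.splits _).eq_prod_roots_of_monic (hr.map _)
  have hroots : ∀ a ∈ p.aroots K, a ≠ 0 := by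
    rintro a ha rfl
    rw [mem_aroots] at ha
    have := ha.2
    rw [aeval_def, eval₂_at_zero] at this
    exact hp.2 ((map_eq_zero _).mp this)
  have key : (recip 1 p).aroots K = (p.aroots K).map fun a => a⁻¹ := by
    rw [aroots, hp.map_recip, map_one, hprod p hp.1, recip_multiset_prod, Multiset.map_map,
      ← roots_multiset_prod_X_sub_C ((p.aroots K).map fun a => a⁻¹), Multiset.map_map]
    congr 2
    exact Multiset.map_congr rfl fun a ha => recip_X_sub_C (hroots a ha)
  rw [SelfReciprocal, ← key]
  constructor
  · intro h
    apply map_injective _ (algebraMap F K).injective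
    rw [hprod _ (hp.recip one_ne_zero).1, h, ← hprod p hp.1]
  · intro h
    rw [h]

/-- The normalizations f(0) = 1 and monic are exchanged by a constant factor, which does not affect
the roots. -/
theorem nSelfRec_eq (m : ℕ) : nSelfRec F m = Nat.card (recipSet (1 : F) m) := by
  symm
  have hself : ∀ (c : F) (p : F[X]), c ≠ 0 → (SelfReciprocal (C c * p) ↔ SelfReciprocal p) := by
    intro c p hc
    rw [SelfReciprocal, SelfReciprocal, aroots_C_mul _ hc]
  let Θ : recipSet (1 : F) m → {f : F[X] // f.natDegree = m ∧ f.eval 0 = 1 ∧ SelfReciprocal f} :=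
    fun p => ⟨C (p.1.coeff 0)⁻¹ * p.1, by
      have h0 := p.2.1.2
      refine ⟨by rw [natDegree_C_mul (inv_ne_zero h0), p.2.2.1], ?_, ?_⟩
      · rw [eval_mul, eval_C, ← coeff_zero_eq_eval_zero, inv_mul_cancel₀ h0]
      · rw [hself _ _ (inv_ne_zero h0), selfReciprocal_iff p.2.1]
        exact p.2.2.2⟩
  refine Nat.card_congr (Equiv.ofBijective Θ ⟨fun p p' h => ?_, fun ⟨f, hf, hf0, hfs⟩ => ?_⟩)
  · have h1 : C (p.1.coeff 0)⁻¹ * p.1 = C (p'.1.coeff 0)⁻¹ * p'.1 := congrArg Subtype.val h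
    have h2 := congrArg leadingCoeff h1
    rw [leadingCoeff_mul, leadingCoeff_mul, leadingCoeff_C, leadingCoeff_C, p.2.1.1, p'.2.1.1,
      mul_one, mul_one] at h2
    rw [h2] at h1
    exact Subtype.ext (mul_left_cancel₀ (C_ne_zero.mpr (inv_ne_zero p'.2.1.2)) h1)
  · have hne : f ≠ 0 := fun h => by simp [h] at hf0
    have hlc : f.leadingCoeff ≠ 0 := leadingCoeff_ne_zero.mpr hne
    have hc0 : f.coeff 0 = 1 := by rw [coeff_zero_eq_eval_zero, hf0]
    have hmu : MonicUnit (C f.leadingCoeff⁻¹ * f) := by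
      refine ⟨?_, by rw [coeff_C_mul, hc0, mul_one]; exact inv_ne_zero hlc⟩
      rw [Monic, leadingCoeff_mul, leadingCoeff_C, inv_mul_cancel₀ hlc]
    refine ⟨⟨C f.leadingCoeff⁻¹ * f, hmu, ?_, ?_⟩, Subtype.ext ?_⟩
    · rw [natDegree_C_mul (inv_ne_zero hlc), hf]
    · rw [← selfReciprocal_iff hmu, hself _ _ (inv_ne_zero hlc)]
      exact hfs
    · change C ((C f.leadingCoeff⁻¹ * f).coeff 0)⁻¹ * (C f.leadingCoeff⁻¹ * f) = f
      rw [coeff_C_mul, hc0, mul_one, inv_inv, ← mul_assoc, ← C_mul, mul_inv_cancel₀ hlc, C_1,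
        one_mul]

end Counting

end RealClasses

/-! ### A Burnside count of the PGL classes -/

namespace RealClasses

open Polynomial Module Matrix Matrix.ProjGenLinGroup

/-- A variant of Burnside's lemma: `P l x` says that `x` is fixed by the symmetry `l`, and the set
of these `l` is a coset of the stabilizer of `x`. -/
theorem two_mul_card_orbits {A X : Type*} [CommGroup A] [Finite A] [Finite X] [MulAction A X]
    (P : A → X → Prop) (h1 : ∀ x, ∃ l, P l x)
    (h2 : ∀ l l' x, P l x → (P l' x ↔ (l' / l) • x = x))
    (h3 : ∀ l a x, P (l * (a * a)) (a • x) ↔ P l x) (z : A)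
    (hz : ∀ l : A, IsSquare l ∨ IsSquare (l / z)) :
    2 * Nat.card (MulAction.orbitRel.Quotient A X) =
      Nat.card {x // P 1 x} + Nat.card {x // P z x} := by
  have := Fintype.ofFinite A
  choose c hc using h1
  -- Dividing by a chosen symmetry `c x` turns pairs (symmetry, point) into pairs (stabilizing
  -- element, point), which Burnside's lemma counts.
  let e : A × X ≃ A × X :=
    { toFun := fun p => (p.1 / c p.2, p.2)
      invFun := fun p => (p.1 * c p.2, p.2)
      left_inv := fun p => by simp
      right_inv := fun p => by simp }
  have h4 : Nat.card {p : A × X // P p.1 p.2} =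
      Nat.card (MulAction.orbitRel.Quotient A X) * Nat.card A := by
    rw [← Nat.card_prod, ← Nat.card_congr (MulAction.sigmaFixedByEquivOrbitsProdGroup A X)]
    refine Nat.card_congr ((e.subtypeEquiv (q := fun p => p.1 • p.2 = p.2) fun p =>
      h2 _ _ _ (hc p.2)).trans
      (Equiv.subtypeProdEquivSigmaSubtype fun (a : A) (x : X) => a • x = x))
  rw [Nat.card_congr (Equiv.subtypeProdEquivSigmaSubtype P), Nat.card_sigma] at h4
  -- Acting by `a` carries points with symmetry `l` to points with symmetry `l * a²`, so the count
  -- depends only on `l` modulo squares.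
  have hN : ∀ l a, Nat.card {x // P (l * (a * a)) x} = Nat.card {x // P l x} := fun l a =>
    (Nat.card_congr ((MulAction.toPerm a).subtypeEquiv fun x => (h3 l a x).symm)).symm
  have h5 : ∑ l, Nat.card {x // P (z * l) x} = ∑ l, Nat.card {x // P l x} :=
    Equiv.sum_comp (Equiv.mulLeft z) fun l => Nat.card {x // P l x}
  have h6 : ∀ l, Nat.card {x // P l x} + Nat.card {x // P (z * l) x} =
      Nat.card {x // P 1 x} + Nat.card {x // P z x} := by
    intro l
    rcases hz l with ⟨a, rfl⟩ | ⟨a, ha⟩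
    · rw [hN z a, ← hN 1 a, one_mul]
    · obtain rfl : l = z * (a * a) := by rw [← ha, mul_div_cancel]
      rw [hN z a, ← hN 1 (z * a), add_comm, one_mul]
      congr 4
      funext x
      congr 1
      rw [← mul_assoc, mul_mul_mul_comm]
  have h7 : 2 * ∑ l, Nat.card {x // P l x} =
      Nat.card A * (Nat.card {x // P 1 x} + Nat.card {x // P z x}) := by
    rw [two_mul]
    nth_rw 2 [← h5]
    rw [← Finset.sum_add_distrib, Finset.sum_congr rfl fun l _ => h6 l, Finset.sum_const,
      Finset.card_univ, ← Nat.card_eq_fintype_card, smul_eq_mul]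
  rw [h4] at h7
  have h8 : 0 < Nat.card A := Nat.card_pos
  refine Nat.eq_of_mul_eq_mul_left h8 ?_
  rw [← h7]
  ring

section Tuples

variable {F : Type*} [Field F] {n : ℕ}

/-- The determinant of the matrices with invariant polynomials `f`. -/
noncomputable def tupleDet (ν : n.Partition) (f : ℕ → F[X]) : F :=
  ∏ i ∈ ν.parts.toFinset, rootProd (f i) ^ i

/-- The invariant polynomials of the matrices of type `ν` that represent an element of `PSL` which
is real in `PGL`. -/
def RealTuple (F : Type*) [Field F] {n : ℕ} (ν : n.Partition) : Type _ :=
  {f : ℕ → F[X] // IsTuple ν f ∧ (∃ u : Fˣ, tupleDet ν f = (u : F) ^ n) ∧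
    ∃ l : Fˣ, (fun i => recip (l : F) (f i)) = f}

theorem IsTuple.tupleDet_scaleRoots {ν : n.Partition} {f : ℕ → F[X]} (hf : IsTuple ν f) (l : F) :
    tupleDet ν (fun i => (f i).scaleRoots l) = tupleDet ν f * l ^ n := by
  simp only [tupleDet, rootProd_scaleRoots, mul_pow, Finset.prod_mul_distrib, (hf _).2]
  congr 1
  simp only [← pow_mul]
  rw [Finset.prod_pow_eq_pow_sum]
  congr 1
  exact (Finset.sum_congr rfl fun i _ => mul_comm _ _).trans (sum_mult ν)

theorem IsTuple.recip_scaleRoots_iff {ν : n.Partition} {f : ℕ → F[X]} (hf : IsTuple ν f)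
    (l a : Fˣ) : ((fun i => recip ((l * (a * a) : Fˣ) : F) ((f i).scaleRoots (a : F))) =
      fun i => (f i).scaleRoots (a : F)) ↔ (fun i => recip (l : F) (f i)) = f := by
  simp only [funext_iff]
  refine forall_congr' fun i => ?_
  rw [(hf i).1.recip_scaleRoots a.ne_zero, Units.val_mul, Units.val_mul, ← mul_assoc,
    mul_div_cancel_right₀ _ a.ne_zero, ← scaleRoots_recip]
  refine ⟨fun h => ?_, fun h => by rw [h]⟩
  have h1 := congrArg (fun p => p.scaleRoots ((a⁻¹ : Fˣ) : F)) h
  simpa only [← scaleRoots_mul, Units.mul_inv, scaleRoots_one] using h1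

/-- This is multiplication of matrices by scalars: the determinant changes by a^n, and a symmetry
`l` becomes `l * a²`. -/
noncomputable instance (ν : n.Partition) : MulAction Fˣ (RealTuple F ν) where
  smul a f := ⟨fun i => (f.1 i).scaleRoots (a : F), f.2.1.scaleRoots a, by
    obtain ⟨u, hu⟩ := f.2.2.1
    exact ⟨u * a, by rw [f.2.1.tupleDet_scaleRoots, hu, Units.val_mul, mul_pow]⟩, by
    obtain ⟨l, hl⟩ := f.2.2.2
    exact ⟨l * (a * a), (f.2.1.recip_scaleRoots_iff l a).mpr hl⟩⟩
  one_smul f := Subtype.ext (funext fun i => scaleRoots_one (f.1 i))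
  mul_smul a b f := Subtype.ext (funext fun i => by
    change (f.1 i).scaleRoots ((a * b : Fˣ) : F) = ((f.1 i).scaleRoots (b : F)).scaleRoots (a : F)
    rw [← scaleRoots_mul, Units.val_mul, mul_comm])

theorem RealTuple.val_inj {ν : n.Partition} {f f' : RealTuple F ν} : f.1 = f'.1 ↔ f = f' :=
  Subtype.ext_iff.symm

theorem RealTuple.smul_val {ν : n.Partition} (a : Fˣ) (f : RealTuple F ν) :
    (a • f).1 = fun i => (f.1 i).scaleRoots (a : F) := rfl

theorem finite_isTuple [Finite F] (ν : n.Partition) :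
    Finite {f : ℕ → F[X] // IsTuple ν f} := by
  refine Finite.of_injective (β := ∀ i : ν.parts.toFinset, Fin (mult ν i + 1) → F)
    (fun f i j => (f.1 i).coeff j) fun f f' h => Subtype.ext (funext fun i => ?_)
  by_cases hi : i ∈ ν.parts.toFinset
  · refine ext_of_natDegree ((f.2 i).2.trans (f'.2 i).2.symm) fun j hj => ?_
    rw [(f.2 i).2] at hj
    exact congrFun (congrFun h ⟨i, hi⟩) ⟨j, by dsimp only; omega⟩
  · rw [f.2.eq_one i hi, f'.2.eq_one i hi]

instance [Finite F] (ν : n.Partition) : Finite (RealTuple F ν) := by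
  have := finite_isTuple (F := F) ν
  exact Finite.of_injective (β := {f : ℕ → F[X] // IsTuple ν f}) (fun f => ⟨f.1, f.2.1⟩)
    fun f f' h => Subtype.ext (Subtype.mk.inj h)

theorem inPSL_mk_iff_det {g : GL (Fin n) F} :
    InPSL (ConjClasses.mk (mk g : Matrix.ProjGenLinGroup (Fin n) F)) ↔
      ∃ u : Fˣ, (GeneralLinearGroup.det g : F) = (u : F) ^ n := by
  have hdet : ∀ l : Fˣ, GeneralLinearGroup.det (GeneralLinearGroup.scalar (Fin n) l) = l ^ n := by
    intro l
    refine Units.ext ?_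
    simp
  rw [inPSL_mk, mem_range_toPGL]
  constructor
  · rintro ⟨b, hb, hbg⟩
    obtain ⟨l, rfl⟩ := mk_eq_mk_iff_scalar.mp hbg.symm
    exact ⟨l, by rw [map_mul, hb, hdet, mul_one, Units.val_pow_eq_pow_val]⟩
  · rintro ⟨u, hu⟩
    refine ⟨GeneralLinearGroup.scalar (Fin n) u⁻¹ * g, ?_, mk_eq_mk_iff_scalar.mpr ⟨_, rfl⟩⟩
    rw [map_mul, hdet]
    refine Units.ext ?_
    rw [Units.val_mul, hu, ← Units.val_pow_eq_pow_val, ← Units.val_mul, ← mul_pow, inv_mul_cancel,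
      one_pow]

/-- Each sequence is realised by a matrix, and two matrices give the same PGL class exactly when
their sequences differ by scaling. -/
theorem card_orbits_realTuple (ν : n.Partition) :
    Nat.card (MulAction.orbitRel.Quotient Fˣ (RealTuple F ν)) = pslNuPGL F ν := by
  choose g hg using fun f : RealTuple F ν => f.2.1.exists_matInv
  let Θ : RealTuple F ν → {C : ConjClasses (Matrix.ProjGenLinGroup (Fin n) F) //
      ClassHasType C ν ∧ InPSL C ∧ ∀ x ∈ C.carrier, IsReal x} := fun f =>
    ⟨ConjClasses.mk (mk (g f)), (classHasType_mk (hg f)).mpr f.2.1,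
      inPSL_mk_iff_det.mpr (by rw [(hg f).det_eq f.2.1]; exact f.2.2.1),
      forall_isReal_mk.mpr ((exists_inverts_iff_matInv (hg f)).mpr f.2.2.2)⟩
  have hΘ : ∀ f f', Θ f = Θ f' ↔ MulAction.orbitRel Fˣ (RealTuple F ν) f f' := by
    intro f f'
    rw [Subtype.mk.injEq, ConjClasses.mk_eq_mk_iff_isConj, isConj_mk_iff_matInv (hg f) (hg f'),
      MulAction.orbitRel_apply]
    refine exists_congr fun l => ?_
    rw [eq_comm]
    exact RealTuple.val_inj (f := l • f') (f' := f)
  refine Nat.card_congr (Equiv.ofBijective (Quotient.lift Θ fun f f' h => (hΘ f f').mpr h)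
    ⟨fun x y => ?_, ?_⟩)
  · induction x using Quotient.inductionOn
    induction y using Quotient.inductionOn
    exact fun h => Quotient.sound ((hΘ _ _).mp h)
  · rintro ⟨C, ht, hC, hr⟩
    obtain ⟨b, f, hb, hf, rfl⟩ := hC.exists_rep
    have hft := (classHasType_mk hf).mp ht
    let f' : RealTuple F ν := ⟨f, hft, by
      rw [tupleDet, ← hf.det_eq hft]
      exact inPSL_mk_iff_det.mp hC, (exists_inverts_iff_matInv hf).mp (forall_isReal_mk.mp hr)⟩
    refine ⟨Quotient.mk _ f', Subtype.ext ?_⟩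
    change ConjClasses.mk (mk (g f')) = ConjClasses.mk (mk b)
    rw [ConjClasses.mk_eq_mk_iff_isConj, isConj_mk_iff_matInv (hg f') hf]
    exact ⟨1, funext fun i => (scaleRoots_one (f i)).symm⟩

theorem two_mul_pslNuPGL [Finite F] (ν : n.Partition) (z : Fˣ)
    (hz : ∀ l : Fˣ, IsSquare l ∨ IsSquare (l / z)) : 2 * pslNuPGL F ν =
      Nat.card {f : RealTuple F ν // (fun i => recip ((1 : Fˣ) : F) (f.1 i)) = f.1} +
      Nat.card {f : RealTuple F ν // (fun i => recip (z : F) (f.1 i)) = f.1} := by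
  rw [← card_orbits_realTuple]
  refine two_mul_card_orbits
    (fun (l : Fˣ) (f : RealTuple F ν) => (fun i => recip (l : F) (f.1 i)) = f.1)
    (fun f => f.2.2.2) (fun l l' f hl => ?_) (fun l a f => f.2.1.recip_scaleRoots_iff l a) z hz
  rw [← RealTuple.val_inj, RealTuple.smul_val]
  have h : (fun i => (f.1 i).scaleRoots ((l' / l : Fˣ) : F)) =
      fun i => recip (l' : F) (f.1 i) := by
    funext i
    nth_rw 1 [← congrFun hl i]
    rw [scaleRoots_recip, ← Units.val_mul, mul_div_cancel]
  rw [h]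

end Tuples

end RealClasses

namespace RealClasses

open Polynomial

/-! ### Evaluation of the count under |n|_2 = |q-1|_2 -/

section Evaluation

variable {F : Type*} [Field F]

theorem ringChar_ne_two_of_odd [Finite F] (hq : Odd (Nat.card F)) : ringChar F ≠ 2 := fun h => by
  have := Fintype.ofFinite F
  have := FiniteField.even_card_iff_char_two.mp h
  rw [Nat.card_eq_fintype_card, Nat.odd_iff] at hq
  omega

theorem isSquare_or_isSquare_div [Finite F] {z : Fˣ} (hz : ¬ IsSquare z) (l : Fˣ) :
    IsSquare l ∨ IsSquare (l / z) := by
  have := Fintype.ofFinite F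
  by_cases hF : ringChar F = 2
  · exfalso
    obtain ⟨b, hb⟩ := FiniteField.isSquare_of_char_two hF (z : F)
    have hb0 : b ≠ 0 := fun h => z.ne_zero (by rw [hb, h, zero_mul])
    exact hz ⟨Units.mk0 b hb0, Units.ext hb⟩
  · rw [FiniteField.unit_isSquare_iff hF] at hz ⊢
    rw [FiniteField.unit_isSquare_iff hF, div_pow]
    have key : ∀ a : Fˣ, a ^ (Fintype.card F / 2) = 1 ∨ a ^ (Fintype.card F / 2) = -1 := by
      intro a
      rcases FiniteField.pow_dichotomy hF a.ne_zero with h | h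
      · exact Or.inl (Units.ext (by simpa using h))
      · exact Or.inr (Units.ext (by simpa using h))
    rcases key l with h | h
    · exact Or.inl h
    · rw [h, (key z).resolve_left hz]
      simp

/-- With q - 1 = 2^(a+1) t and n = 2^(a+1) s for odd s and t, take z = x^t for a nonsquare x. Then
z^(n/2) = (x^((q-1)/2))^s = (-1)^s = -1. -/
theorem exists_nonsquare_pow_eq_neg_one [Finite F] (hq : Odd (Nat.card F)) {n : ℕ} (hn : n ≠ 0)
    (h2 : twoPart n = twoPart (Nat.card F - 1)) :
    ∃ z : Fˣ, ¬ IsSquare z ∧ (z : F) ^ (n / 2) = -1 := by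
  have := Fintype.ofFinite F
  have hF := ringChar_ne_two_of_odd hq
  have hne : (-1 : F) ≠ 1 := Ring.neg_one_ne_one_of_char_ne_two hF
  have hlt := Finite.one_lt_card (α := F)
  obtain ⟨a, t, ht, hqa⟩ := Nat.exists_eq_two_pow_mul_odd (n := Nat.card F - 1) (by omega)
  obtain ⟨b, s, hs, hnb⟩ := Nat.exists_eq_two_pow_mul_odd hn
  have hab : ∀ k, k ≤ b ↔ k ≤ a := by
    intro k
    have h := two_pow_dvd_iff hn (by omega) h2 k
    rwa [hqa, hnb, (Nat.Coprime.pow_left k hs.coprime_two_left).dvd_mul_right,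
      (Nat.Coprime.pow_left k ht.coprime_two_left).dvd_mul_right,
      Nat.pow_dvd_pow_iff_le_right one_lt_two, Nat.pow_dvd_pow_iff_le_right one_lt_two] at h
  obtain rfl : a = b := le_antisymm ((hab a).mpr le_rfl) ((hab b).mp le_rfl)
  obtain ⟨a, rfl⟩ : ∃ c, a = c + 1 := by
    refine Nat.exists_eq_succ_of_ne_zero ?_
    rintro rfl
    rw [pow_zero, one_mul] at hqa
    rw [← hqa] at ht
    rw [Nat.odd_iff] at ht hq
    omega
  have hq2 : Nat.card F / 2 = 2 ^ a * t := by
    rw [pow_succ] at hqa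
    rw [Nat.odd_iff] at hq
    have : Nat.card F - 1 = 2 * (2 ^ a * t) := by rw [hqa]; ring
    omega
  have hn2 : n / 2 = 2 ^ a * s := by
    have : n = 2 * (2 ^ a * s) := by rw [hnb]; ring
    omega
  obtain ⟨x, hx⟩ := FiniteField.exists_nonsquare hF
  have hx0 : x ≠ 0 := fun h => hx (by rw [h]; exact ⟨0, by simp⟩)
  have hx1 : x ^ (2 ^ a * t) = -1 := by
    rw [← hq2, Nat.card_eq_fintype_card]
    exact (FiniteField.pow_dichotomy hF hx0).resolve_left
      fun h => hx ((FiniteField.isSquare_iff hF hx0).mpr h)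
  refine ⟨Units.mk0 x hx0 ^ t, ?_, ?_⟩
  · rw [FiniteField.unit_isSquare_iff hF, ← Nat.card_eq_fintype_card, hq2]
    intro h
    have h' := congrArg Units.val h
    rw [← pow_mul, mul_comm, Units.val_pow_eq_pow_val, Units.val_mk0, pow_mul, hx1,
      ht.neg_one_pow, Units.val_one] at h'
    exact hne h'
  · rw [hn2, Units.val_pow_eq_pow_val, Units.val_mk0, ← pow_mul,
      show t * (2 ^ a * s) = 2 ^ a * t * s by ring, pow_mul, hx1, hs.neg_one_pow]

theorem pow_ne_neg_one [Finite F] (hq : Odd (Nat.card F)) {n : ℕ} (hn : n ≠ 0)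
    (h2 : twoPart n = twoPart (Nat.card F - 1)) (u : Fˣ) : (u : F) ^ n ≠ -1 := by
  intro h
  have hne : (-1 : F) ≠ 1 := Ring.neg_one_ne_one_of_char_ne_two (ringChar_ne_two_of_odd hq)
  have hlt := Finite.one_lt_card (α := F)
  obtain ⟨a, t, ht, hqa⟩ := Nat.exists_eq_two_pow_mul_odd (n := Nat.card F - 1) (by omega)
  obtain ⟨c, hc⟩ : 2 ^ a ∣ n := (two_pow_dvd_iff hn (by omega) h2 a).mpr ⟨t, hqa⟩
  -- The odd number `t` is chosen so that q - 1 divides `n * t`; an n-th power equal to -1 would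
  -- give (-1)^t = 1.
  have h1 : (u : F) ^ (n * t) = 1 := by
    rw [hc, show 2 ^ a * c * t = (Nat.card F - 1) * c by rw [hqa]; ring, pow_mul,
      ← Units.val_pow_eq_pow_val, ← Nat.card_units, pow_card_eq_one', Units.val_one, one_pow]
  rw [pow_mul, h, ht.neg_one_pow] at h1
  exact hne h1

variable {n : ℕ} {ν : n.Partition}

theorem tupleDet_eq_sign {l : Fˣ} (hl : l = 1 ∨ ∀ i, Even (mult ν i)) {f : ℕ → F[X]}
    (hf : IsTuple ν f) (hfl : (fun i => recip (l : F) (f i)) = f) :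
    tupleDet ν f =
      ((∏ i : ν.parts.toFinset, recipSign (l : F) (f i) ^ (i : ℕ) : ℤ) : F) * (l : F) ^ (n / 2) := by
  have h1 : ∀ i, rootProd (f i) ^ i =
      (recipSign (l : F) (f i) : F) ^ i * (l : F) ^ (i * (mult ν i / 2)) := by
    intro i
    rw [rootProd_eq_sign (m := mult ν i) ⟨(hf i).1, (hf i).2, congrFun hfl i⟩
      (hl.imp (fun h => by rw [h, Units.val_one]) fun h => h i), mul_pow, ← pow_mul, mul_comm i]
  rw [tupleDet, Finset.prod_congr rfl fun i _ => h1 i, Finset.prod_mul_distrib,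
    Finset.prod_pow_eq_pow_sum]
  congr 1
  · push_cast
    exact (Finset.prod_coe_sort ν.parts.toFinset
      fun i => (recipSign (l : F) (f i) : F) ^ i).symm
  · rcases hl with rfl | h
    · simp
    · congr 1
      have h2 : ∑ i ∈ ν.parts.toFinset, i * mult ν i =
          2 * ∑ i ∈ ν.parts.toFinset, i * (mult ν i / 2) := by
        rw [Finset.mul_sum]
        refine Finset.sum_congr rfl fun i _ => ?_
        obtain ⟨r, hr⟩ := h i
        rw [hr, ← two_mul, Nat.mul_div_cancel_left _ two_pos]
        ring
      rw [sum_mult] at h2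
      omega

theorem two_mul_card_fixed [Finite F] {l : Fˣ} (hl : l = 1 ∨ ∀ i, Even (mult ν i)) {c : ℤ}
    (hc : c = 1 ∨ c = -1) (hlc : (l : F) ^ (n / 2) = c) (hneg : ∀ u : Fˣ, (u : F) ^ n ≠ -1)
    (s : ℕ → ℤ) (hs : ∀ i ∈ ν.parts.toFinset, ∀ [Fintype (recipSet (l : F) (mult ν i))],
      ∑ p : recipSet (l : F) (mult ν i), recipSign (l : F) p.1 ^ i = s i) :
    2 * (Nat.card {f : RealTuple F ν // (fun i => recip (l : F) (f.1 i)) = f.1} : ℤ) =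
      ∏ i ∈ ν.parts.toFinset, (Nat.card (recipSet (l : F) (mult ν i)) : ℤ) +
        c * ∏ i ∈ ν.parts.toFinset, s i := by
  have hsign : ∀ (i : ν.parts.toFinset) (p : recipSet (l : F) (mult ν i)),
      recipSign (l : F) p.1 ^ (i : ℕ) = 1 ∨ recipSign (l : F) p.1 ^ (i : ℕ) = -1 := by
    intro i p
    rcases recipSign_eq (l : F) p.1 with h | h <;> rw [h]
    · exact Or.inl (one_pow _)
    · exact neg_one_pow_eq_or ℤ _
  have h := two_mul_card_prod_eq (I := ν.parts.toFinset)
    (S := fun i => recipSet (l : F) (mult ν i))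
    (fun i p => recipSign (l : F) p.1 ^ (i : ℕ)) hsign hc (fun i => s i)
    (fun i _ => hs i i.2)
  rw [Finset.prod_coe_sort ν.parts.toFinset s, Finset.prod_coe_sort ν.parts.toFinset
    fun i => (Nat.card (recipSet (l : F) (mult ν i)) : ℤ)] at h
  rw [← h]
  congr 1
  -- The determinant is the product of signs times l^(n/2) = c, hence 1 or -1. As -1 is not an n-th
  -- power, the determinant is one exactly when the product of signs is `c`.
  have hdet : ∀ f : ℕ → F[X], IsTuple ν f → (fun i => recip (l : F) (f i)) = f →
      ((∃ u : Fˣ, tupleDet ν f = (u : F) ^ n) ↔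
        ∏ i : ν.parts.toFinset, recipSign (l : F) (f i) ^ (i : ℕ) = c) := by
    intro f hf hfl
    rw [tupleDet_eq_sign hl hf hfl, hlc]
    have hpm : ∏ i : ν.parts.toFinset, recipSign (l : F) (f i) ^ (i : ℕ) = 1 ∨
        ∏ i : ν.parts.toFinset, recipSign (l : F) (f i) ^ (i : ℕ) = -1 := by
      refine Finset.prod_induction _ (fun x => x = 1 ∨ x = -1) ?_ (Or.inl rfl) fun i _ =>
        hsign i ⟨f i, (hf i).1, (hf i).2, congrFun hfl i⟩
      rintro a b (rfl | rfl) (rfl | rfl) <;> simp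
    constructor
    · rintro ⟨u, hu⟩
      have := hneg u
      rcases hpm with h1 | h1 <;> rcases hc with rfl | rfl <;> rw [h1] at hu ⊢ <;>
        simp at hu <;> exact absurd hu.symm this
    · intro h1
      refine ⟨1, ?_⟩
      rw [h1]
      rcases hc with rfl | rfl <;> simp
  let Θ : {f : RealTuple F ν // (fun i => recip (l : F) (f.1 i)) = f.1} →
      {φ : ∀ i : ν.parts.toFinset, recipSet (l : F) (mult ν i) //
        ∏ i, recipSign (l : F) (φ i).1 ^ (i : ℕ) = c} := fun f =>
    ⟨fun i => ⟨f.1.1 i, (f.1.2.1 i).1, (f.1.2.1 i).2, congrFun f.2 i⟩,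
      (hdet _ f.1.2.1 f.2).mp f.1.2.2.1⟩
  refine congrArg Nat.cast
    (Nat.card_congr (Equiv.ofBijective Θ ⟨fun f f' h => ?_, fun ⟨φ, hφ⟩ => ?_⟩))
  · refine Subtype.ext (RealTuple.val_inj.mp (funext fun i => ?_))
    by_cases hi : i ∈ ν.parts.toFinset
    · exact congrArg Subtype.val (congrFun (congrArg Subtype.val h) ⟨i, hi⟩)
    · rw [f.1.2.1.eq_one i hi, f'.1.2.1.eq_one i hi]
  · let f : ℕ → F[X] := fun i => if hi : i ∈ ν.parts.toFinset then (φ ⟨i, hi⟩).1 else 1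
    have hfi : ∀ i : ν.parts.toFinset, f i = (φ i).1 := fun i => dif_pos i.2
    have hf1 : ∀ i ∉ ν.parts.toFinset, f i = 1 := fun i hi => dif_neg hi
    have hf : IsTuple ν f := by
      intro i
      by_cases hi : i ∈ ν.parts.toFinset
      · rw [hfi ⟨i, hi⟩]
        exact ⟨(φ ⟨i, hi⟩).2.1, (φ ⟨i, hi⟩).2.2.1⟩
      · rw [hf1 i hi, natDegree_one]
        rw [mem_parts_iff] at hi
        exact ⟨monicUnit_one, by omega⟩
    have hfl : (fun i => recip (l : F) (f i)) = f := by
      funext i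
      by_cases hi : i ∈ ν.parts.toFinset
      · rw [hfi ⟨i, hi⟩]
        exact (φ ⟨i, hi⟩).2.2.2
      · rw [hf1 i hi, recip_one]
    have hd : ∃ u : Fˣ, tupleDet ν f = (u : F) ^ n := by
      rw [hdet f hf hfl, ← hφ]
      exact Finset.prod_congr rfl fun i _ => by rw [hfi]
    refine ⟨⟨⟨f, hf, hd, l, hfl⟩, hfl⟩, Subtype.ext (funext fun i => Subtype.ext (hfi i))⟩

/-- Pairing roots gives (product of roots)² = l^(n_i); with n_i odd this makes `l` a square. -/
theorem card_fixed_eq_zero {l : Fˣ} (hl : ¬ IsSquare l) {i : ℕ} (hi : Odd (mult ν i)) :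
    Nat.card {f : RealTuple F ν // (fun i => recip (l : F) (f.1 i)) = f.1} = 0 := by
  rw [Nat.card_eq_zero]
  left
  refine ⟨fun ⟨f, hf⟩ => hl ?_⟩
  have h := rootProd_sq (l := (l : F)) (m := mult ν i)
    ⟨(f.2.1 i).1, (f.2.1 i).2, congrFun hf i⟩
  obtain ⟨r, hr⟩ := hi
  refine ⟨Units.mk0 _ (f.2.1 i).1.rootProd_ne_zero / l ^ r, ?_⟩
  rw [div_mul_div_comm, eq_div_iff_mul_eq', ← pow_add, ← pow_succ']
  refine Units.ext ?_
  rw [Units.val_pow_eq_pow_val, Units.val_mul, Units.val_mk0, h, hr]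
  congr 1
  omega

/-- The sum of the signs `ε ^ i` over the polynomials of degree `m` with roots invariant under
inversion. -/
noncomputable def signSum (F : Type*) [Field F] (i m : ℕ) : ℤ :=
  if Even i then nSelfRec F m
  else if Even m then (Nat.card F : ℤ) ^ (m / 2) - (Nat.card F : ℤ) ^ (m / 2 - 1)
  else 0

theorem exists_eq_two_mul_succ {m : ℕ} (hm : 0 < m) (h : Even m) : ∃ s, m = 2 * (s + 1) := by
  obtain ⟨r, rfl⟩ := h
  exact ⟨r - 1, by omega⟩

theorem card_recipSet_eq [Finite F] (hq : Odd (Nat.card F)) {l : Fˣ} {m : ℕ} (hm : 0 < m)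
    (hl : l = 1 ∨ Even m) : Nat.card (recipSet (l : F) m) = nSelfRec F m := by
  rw [nSelfRec_eq]
  rcases hl with rfl | h
  · rw [Units.val_one]
  · obtain ⟨s, rfl⟩ := exists_eq_two_mul_succ hm h
    rw [card_recipSet_two_mul hq l.ne_zero, card_recipSet_two_mul hq one_ne_zero]

/-- For even `m` the answer does not depend on `l`; this is what lets the contributions of l = 1 and
of the nonsquare cancel. -/
theorem sum_recipSign_pow [Finite F] (hq : Odd (Nat.card F)) {l : Fˣ} {m : ℕ} (hm : 0 < m)
    (hl : l = 1 ∨ Even m) (i : ℕ) [Fintype (recipSet (l : F) m)] :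
    ∑ p : recipSet (l : F) m, recipSign (l : F) p.1 ^ i = signSum F i m := by
  rw [signSum]
  split_ifs with hi h
  · rw [← card_recipSet_eq hq hm hl, Nat.card_eq_fintype_card, Fintype.card, Finset.card_eq_sum_ones,
      Nat.cast_sum]
    refine Finset.sum_congr rfl fun p _ => ?_
    rcases recipSign_eq (l : F) p.1 with h | h <;> simp [h, hi.neg_one_pow]
  all_goals
    have hi' := Nat.not_even_iff_odd.mp hi
    have hpow : ∀ p : recipSet (l : F) m, recipSign (l : F) p.1 ^ i = recipSign (l : F) p.1 := by
      intro p
      rcases recipSign_eq (l : F) p.1 with h | h <;> simp [h, hi'.neg_one_pow]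
    rw [Finset.sum_congr rfl fun p _ => hpow p]
  · obtain ⟨s, rfl⟩ := exists_eq_two_mul_succ hm h
    rw [sum_recipSign_two_mul hq l.ne_zero, Nat.mul_div_cancel_left _ two_pos,
      Nat.add_sub_cancel]
  · obtain rfl := hl.resolve_right h
    have hm' := Nat.not_even_iff_odd.mp h
    have : Fintype (recipSet (1 : F) m) := Fintype.ofFinite _
    rw [← sum_recipSign_one_odd (F := F) hq hm']
    congr!

/-- An odd i with n_i even contributes (q+1) q^(n_i/2-1) to the plain count and (q-1) q^(n_i/2-1) to
the signed one. An even i contributes equally to both, and an odd i with n_i odd kills the signed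
product. -/
theorem slNu_eq [Finite F] (hq : Odd (Nat.card F)) (ν : n.Partition) :
    2 * slNu F ν = glNu F ν + ((∏ i ∈ ν.parts.toFinset, signSum F i (mult ν i) : ℤ) : ℚ) := by
  classical
  rw [slNu]
  split_ifs with h1 h2
  · have h : ∏ i ∈ ν.parts.toFinset, signSum F i (mult ν i) = (glNu F ν : ℤ) := by
      rw [glNu, Nat.cast_prod]
      refine Finset.prod_congr rfl fun i hi => ?_
      rw [mem_parts_iff] at hi
      have : Even i := by
        by_contra h
        have := h1 i (Nat.not_even_iff_odd.mp h)
        omega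
      rw [signSum, if_pos this]
    rw [h]
    push_cast
    ring
  · obtain ⟨i, hi⟩ := h2
    rw [Nat.odd_mul] at hi
    rw [Finset.prod_eq_zero ((mem_parts_iff ν i).mpr hi.2.pos)]
    · push_cast
      ring
    · rw [signSum, if_neg (Nat.not_even_iff_odd.mpr hi.1), if_neg (Nat.not_even_iff_odd.mpr hi.2)]
  · have hodd : ∀ i ∈ ν.parts.toFinset.filter (fun i => Odd i), ∃ s, mult ν i = 2 * (s + 1) := by
      intro i hi
      rw [Finset.mem_filter, mem_parts_iff] at hi
      refine exists_eq_two_mul_succ hi.1 ?_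
      by_contra h
      exact h2 ⟨i, Nat.odd_mul.mpr ⟨hi.2, Nat.not_even_iff_odd.mp h⟩⟩
    have hsplit : ∀ a : ℕ → ℚ, ∏ i ∈ ν.parts.toFinset, a i =
        (∏ i ∈ ν.parts.toFinset.filter (fun i => Odd i), a i) *
          ∏ i ∈ ν.parts.toFinset.filter (fun i => Even i), a i := by
      intro a
      rw [← Finset.prod_filter_mul_prod_filter_not ν.parts.toFinset (fun i => Odd i)]
      simp only [Nat.not_odd_iff_even]
    have hgl : ∏ i ∈ ν.parts.toFinset.filter (fun i => Odd i), (nSelfRec F (mult ν i) : ℚ) =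
        (Nat.card F + 1 : ℚ) ^ (ν.parts.toFinset.filter (fun i => Odd i)).card *
          ∏ i ∈ ν.parts.toFinset.filter (fun i => Odd i), (Nat.card F : ℚ) ^ (mult ν i / 2 - 1) := by
      rw [← Finset.prod_const, ← Finset.prod_mul_distrib]
      refine Finset.prod_congr rfl fun i hi => ?_
      obtain ⟨s, hs⟩ := hodd i hi
      rw [hs, nSelfRec_eq, card_recipSet_two_mul hq one_ne_zero, Nat.mul_div_cancel_left _ two_pos,
        Nat.add_sub_cancel]
      push_cast
      ring
    have hsg : ∏ i ∈ ν.parts.toFinset.filter (fun i => Odd i), (signSum F i (mult ν i) : ℚ) =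
        (Nat.card F - 1 : ℚ) ^ (ν.parts.toFinset.filter (fun i => Odd i)).card *
          ∏ i ∈ ν.parts.toFinset.filter (fun i => Odd i), (Nat.card F : ℚ) ^ (mult ν i / 2 - 1) := by
      rw [← Finset.prod_const, ← Finset.prod_mul_distrib]
      refine Finset.prod_congr rfl fun i hi => ?_
      obtain ⟨s, hs⟩ := hodd i hi
      rw [signSum, if_neg (Nat.not_even_iff_odd.mpr (Finset.mem_filter.mp hi).2), hs,
        if_pos (even_two_mul _), Nat.mul_div_cancel_left _ two_pos, Nat.add_sub_cancel]
      push_cast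
      ring
    have hev : ∏ i ∈ ν.parts.toFinset.filter (fun i => Even i), (signSum F i (mult ν i) : ℚ) =
        ∏ i ∈ ν.parts.toFinset.filter (fun i => Even i), (nSelfRec F (mult ν i) : ℚ) := by
      refine Finset.prod_congr rfl fun i hi => ?_
      rw [signSum, if_pos (Finset.mem_filter.mp hi).2, Int.cast_natCast]
    rw [glNu]
    push_cast
    rw [hsplit, hsplit, hgl, hsg, hev]
    ring

theorem one_lt_dNu_iff (hn : n ≠ 0) (ν : n.Partition) :
    1 < dNu ν ↔ ∀ i, Even (mult ν i) := by
  have hout : ∀ i ∉ Finset.Icc 1 n, mult ν i = 0 := by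
    intro i hi
    by_contra h
    have hmem : i ∈ ν.parts := Multiset.count_pos.mp (Nat.pos_of_ne_zero h)
    have h1 := ν.parts_pos hmem
    have h2 := Multiset.le_sum_of_mem hmem
    rw [ν.parts_sum] at h2
    exact hi (Finset.mem_Icc.mpr ⟨h1, h2⟩)
  -- Needed because `padicValNat` is 0 at 0 and would not detect divisibility by 2.
  have h0 : (Finset.Icc 1 n).gcd (mult ν) ≠ 0 := by
    intro h
    rw [Finset.gcd_eq_zero_iff] at h
    have hs := sum_mult ν
    rw [Finset.sum_eq_zero fun i _ => ?_] at hs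
    · exact hn hs.symm
    · by_cases hi : i ∈ Finset.Icc 1 n
      · rw [h i hi, mul_zero]
      · rw [hout i hi, mul_zero]
  rw [dNu, twoPart, Nat.one_lt_two_pow_iff, ← Nat.pos_iff_ne_zero, Nat.lt_iff_add_one_le, zero_add,
    ← padicValNat_dvd_iff_le h0, pow_one, Finset.dvd_gcd_iff]
  refine ⟨fun h i => ?_, fun h i _ => (h i).two_dvd⟩
  by_cases hi : i ∈ Finset.Icc 1 n
  · exact even_iff_two_dvd.mpr (h i hi)
  · rw [hout i hi]
    exact Even.zero

theorem pslNuPGL_eq [Finite F] (hq : Odd (Nat.card F)) (hn : n ≠ 0)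
    (h2 : twoPart n = twoPart (Nat.card F - 1)) (ν : n.Partition) :
    (1 < dNu ν → (pslNuPGL F ν : ℚ) = 1 / 2 * glNu F ν) ∧
    (¬ 1 < dNu ν → (pslNuPGL F ν : ℚ) = 1 / 2 * slNu F ν) := by
  obtain ⟨z, hz, hzn⟩ := exists_nonsquare_pow_eq_neg_one hq hn h2
  have hneg := pow_ne_neg_one hq hn h2
  have hB := two_mul_pslNuPGL ν z (isSquare_or_isSquare_div hz)
  have hN : ∀ (l : Fˣ) (c : ℤ), (l = 1 ∨ ∀ i, Even (mult ν i)) → (c = 1 ∨ c = -1) →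
      (l : F) ^ (n / 2) = c →
      2 * (Nat.card {f : RealTuple F ν // (fun i => recip (l : F) (f.1 i)) = f.1} : ℤ) =
        glNu F ν + c * ∏ i ∈ ν.parts.toFinset, signSum F i (mult ν i) := by
    intro l c hl hc hlc
    rw [two_mul_card_fixed hl hc hlc hneg (fun i => signSum F i (mult ν i)) fun i hi _ =>
      sum_recipSign_pow hq ((mem_parts_iff ν i).mp hi) (hl.imp_right fun h => h i) i, glNu,
      Nat.cast_prod]
    congr 1
    refine Finset.prod_congr rfl fun i hi => ?_
    rw [card_recipSet_eq hq ((mem_parts_iff ν i).mp hi) (hl.imp_right fun h => h i)]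
  have hN1 := hN 1 1 (Or.inl rfl) (Or.inl rfl) (by simp)
  rw [one_lt_dNu_iff hn]
  constructor
  · intro h
    have hNz := hN z (-1) (Or.inr h) (Or.inr rfl) (by simpa using hzn)
    -- The signed counts for l = 1 and l = z enter with opposite signs and cancel.
    have h4 : (2 * pslNuPGL F ν : ℤ) = glNu F ν := by
      have hB' := congrArg (Nat.cast : ℕ → ℤ) hB
      rw [Nat.cast_mul, Nat.cast_add, Nat.cast_ofNat] at hB'
      linarith
    have h5 : (2 * pslNuPGL F ν : ℚ) = glNu F ν := by exact_mod_cast h4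
    linarith
  · intro h
    rw [not_forall] at h
    obtain ⟨i, hi⟩ := h
    rw [card_fixed_eq_zero hz (Nat.not_even_iff_odd.mp hi), add_zero] at hB
    rw [← hB, one_mul] at hN1
    have h5 := slNu_eq hq ν
    have h6 : (2 * (2 * pslNuPGL F ν) : ℚ) =
        glNu F ν + ((∏ i ∈ ν.parts.toFinset, signSum F i (mult ν i) : ℤ) : ℚ) := by
      exact_mod_cast hN1
    linarith

theorem slNu_of_not_hasOddPart (ν : n.Partition) (h : ¬ HasOddPart ν) :
    slNu F ν = glNu F ν := by
  rw [slNu, if_pos]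
  intro i hi
  by_contra h'
  exact h ⟨i, hi, Nat.pos_of_ne_zero h'⟩

end Evaluation

end RealClasses

theorem theoremt {F : Type*} [Field F] [Finite F] (n : ℕ)
    (hq : Odd (Nat.card F))
    (hn : RealClasses.twoPart n = RealClasses.twoPart (Nat.card F - 1)) :
    -- the number of real classes of `PSL_n(q)`
    RealClasses.numRealClasses (Matrix.ProjectiveSpecialLinearGroup (Fin n) F) =
      ∑ ν : n.Partition, RealClasses.hNu (Nat.card F) ν * RealClasses.pslNu F ν ∧
    -- the values of `psl_ν` when `4` divides `n`
    (4 ∣ n → ∀ ν : n.Partition,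
      ((1 < RealClasses.dNu ν ∧ RealClasses.HasOddPart ν) →
        (RealClasses.pslNu F ν : ℚ) =
          1 / 2 * ∏ i ∈ ν.parts.toFinset,
            (RealClasses.nSelfRec F (RealClasses.mult ν i) : ℚ)) ∧
      (¬ (1 < RealClasses.dNu ν ∧ RealClasses.HasOddPart ν) →
        (RealClasses.pslNu F ν : ℚ) = 1 / 2 * RealClasses.slNu F ν)) ∧
    -- the values of `psl_ν` when `4` does not divide `n`
    (¬ 4 ∣ n → ∀ ν : n.Partition,
      ((1 < RealClasses.dNu ν ∧ RealClasses.HasOddPart ν) →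
        (RealClasses.pslNu F ν : ℚ) =
          1 / 2 * ∏ i ∈ ν.parts.toFinset,
            (RealClasses.nSelfRec F (RealClasses.mult ν i) : ℚ)) ∧
      ((RealClasses.dNu ν = 1 ∧ RealClasses.HasOddPart ν) →
        (RealClasses.pslNu F ν : ℚ) = 1 / 2 * RealClasses.slNu F ν) ∧
      (¬ RealClasses.HasOddPart ν → RealClasses.pslNu F ν = 0)) ∧
    -- unless `4` does not divide `n` and `ν` has no odd part, reality in `PGL_n(q)` may be
    -- used instead of reality in `PSL_n(q)` to define `psl_ν`
    (∀ ν : n.Partition, (4 ∣ n ∨ RealClasses.HasOddPart ν) →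
      RealClasses.pslNuPGL F ν = RealClasses.pslNu F ν) := by
  -- By convention `twoPart 0` is 1, whereas the 2-part of the even number q - 1 is at least 2.
  have hn0 : n ≠ 0 := by
    rintro rfl
    obtain ⟨r, hr⟩ := hq
    have hlt := Finite.one_lt_card (α := F)
    have h1 : 1 ≤ padicValNat 2 (Nat.card F - 1) :=
      one_le_padicValNat_of_dvd (by omega) (by omega)
    rw [RealClasses.twoPart, RealClasses.twoPart, padicValNat_zero_right] at hn
    have h2 := Nat.pow_right_injective le_rfl hn
    omega
  have hglNu : ∀ ν : n.Partition, (RealClasses.glNu F ν : ℚ) =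
      ∏ i ∈ ν.parts.toFinset, (RealClasses.nSelfRec F (RealClasses.mult ν i) : ℚ) := fun ν => by
    rw [RealClasses.glNu, Nat.cast_prod]
  have hpgl := RealClasses.pslNuPGL_eq_pslNu (F := F) hq hn0
  have hval := RealClasses.pslNuPGL_eq (F := F) hq hn0 hn
  refine ⟨RealClasses.numRealClasses_psl hq hn0, fun h4 ν => ⟨fun ⟨hd, ho⟩ => ?_, fun h => ?_⟩,
    fun h4 ν => ⟨fun ⟨hd, ho⟩ => ?_, fun ⟨hd, ho⟩ => ?_, fun ho => ?_⟩, hpgl⟩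
  · rw [← hpgl ν (Or.inl h4), (hval ν).1 hd, hglNu]
  · rw [← hpgl ν (Or.inl h4)]
    by_cases hd : 1 < RealClasses.dNu ν
    -- When d > 1 but no part is odd, the formula with `glNu` agrees with the one stated through
    -- `slNu`.
    · rw [(hval ν).1 hd, RealClasses.slNu_of_not_hasOddPart ν fun ho => h ⟨hd, ho⟩]
    · exact (hval ν).2 hd
  · rw [← hpgl ν (Or.inr ho), (hval ν).1 hd, hglNu]
  · rw [← hpgl ν (Or.inr ho), (hval ν).2 (by omega)]
  · exact RealClasses.pslNu_eq_zero hq hn0 hn h4 ho
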